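/- **Setting.** Let $\mathbb{T}^3=\mathbb{R}^3/\mathbb{Z}^3$, $T>0$, $Q_T=[0,T]\times\mathbb{T}^3$, and for $F\in\mathbb{M}^{3\times3}$ put $\Phi(F)=(F,\mathrm{cof}\,F,\det F)\in\mathbb{R}^{19}$; write $\xi=(F,\zeta,w)\in\mathbb{M}^{3\times3}\times\mathbb{M}^{3\times3}\times\mathbb{R}$. Repeated indices are summed. Let $\hat e\in C^3(\mathbb{R}^{19}\times[0,\infty))$ be an internal energy, $\hat\theta=\partial\hat e/\partial\eta$, and $$\Sigma_{i\alpha}(F,\eta)=\frac{\partial\hat e}{\partial\xi^B}(\Phi(F),\eta)\,\frac{\partial\Phi^B}{\partial F_{i\alpha}}(F).$$ Assume that $\nabla^2_{(\xi,\eta)}\hat e\ge c_0\,\mathbb{I}$ for some $c_0>0$, that $\hat\theta\ge\delta$ for some $\delta>0$, and that there are exponents $p\ge4$, $q\ge2$, $\rho>1$, $\ell>1$ and constants $c,C>0$ such that, with $X(\xi,\eta)=|F|^p+|\zeta|^q+|w|^\rho+|\eta|^\ell$, $$cX-C\le\hat e\le CX+C,\qquad \lim_{X\to\infty}\frac{\hat\theta}{X}=0,\qquad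 |\partial_F\hat e|^{\frac p{p-1}}+|\partial_\zeta\hat e|^{\frac p{p-2}}+|\partial_w\hat e|^{\frac p{p-3}}\le CX+C$$ on $\mathbb{R}^{19}\times[0,\infty)$. Let $r\in L^\infty(Q_T)$. **Lipschitz solution.** Let $\bar U=(\bar F,\bar v,\bar\eta)$ be Lipschitz on $Q_T$, with $\bar\eta\ge0$ and with values in $\Gamma_M=\{|\bar F|\le M,\ |\bar v|\le M,\ |\bar\eta|\le M\}$, such that a.e. on $Q_T$ $$\partial_t\Phi^B(\bar F)=\partial_\alpha\Big(\frac{\partial\Phi^B}{\partial F_{i\alpha}}(\bar F)\bar v_i\Big),\quad \partial_t\bar\eta=\frac{r}{\hat\theta(\Phi(\bar F),\bar\eta)},\quad \partial_t\bar v_i=\partial_\alpha\Sigma_{i\alpha}(\bar F,\bar\eta),$$ $$\partial_t\big(\tfrac12|\bar v|^2+\hat e(\Phi(\bar F),\bar\eta)\big)=\partial_\alpha\big(\Sigma_{i\alpha}(\bar F,\bar\eta)\bar v_i\big)+r .$$ **Dissipative measure-valued solution.** Let $\boldsymbol\nu=(\boldsymbol\nu_{(t,x)})$ be a measurable family of probability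 measures on states $\lambda=(\lambda_F,\lambda_v,\lambda_\eta)\in\mathbb{M}^{3\times3}\times\mathbb{R}^3\times[0,\infty)$, $\boldsymbol\nu_0=(\boldsymbol\nu_{(0,x)})$ an initial family of the same kind, $\boldsymbol\gamma\ge0$ and $\boldsymbol\gamma_0\ge0$ finite measures on $Q_T$ and $\mathbb{T}^3$, and $U=(F,v,\eta)$ a function on $Q_T$. The triple $(\boldsymbol\nu,\boldsymbol\gamma,U)$ is a dissipative measure-valued solution with initial data $(\boldsymbol\nu_0,\boldsymbol\gamma_0)$ if: 1. $\int_{Q_T}\langle\boldsymbol\nu,|\lambda_v|^2+X(\Phi(\lambda_F),\lambda_\eta)\rangle\,dx\,dt<\infty$, and likewise for $\boldsymbol\nu_0$ on $\mathbb{T}^3$; 2. $U=\langle\boldsymbol\nu,\lambda\rangle$ and $\langle\boldsymbol\nu,\Phi(\lambda_F)\rangle=\Phi(F)$ a.e. on $Q_T$; 3. $v\in L^\infty(L^2)$, $\Phi(F)\in L^\infty(L^p)\times L^\infty(L^q)\times L^\infty(L^\rho)$, $\eta\in L^\infty(L^\ell)$, and $F=\nabla y$, $v=\partial_ty$ for some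 $y\in W^{1,\infty}(L^2(\mathbb{T}^3))\cap L^\infty(W^{1,p}(\mathbb{T}^3))$; 4. in the sense of distributions on $[0,T)\times\mathbb{T}^3$, that is, tested against $\phi\in C^\infty_c([0,T)\times\mathbb{T}^3)$ and with initial values $\Phi(\langle\boldsymbol\nu_0,\lambda_F\rangle)$, $\langle\boldsymbol\nu_0,\lambda_\eta\rangle$, $\langle\boldsymbol\nu_0,\lambda_v\rangle$, $$\partial_t\Phi^B(F)=\partial_\alpha\Big(\frac{\partial\Phi^B}{\partial F_{i\alpha}}(F)v_i\Big),\quad \partial_t\langle\boldsymbol\nu,\lambda_\eta\rangle=\Big\langle\boldsymbol\nu,\frac{r}{\hat\theta(\Phi(\lambda_F),\lambda_\eta)}\Big\rangle,\quad \partial_t\langle\boldsymbol\nu,\lambda_{v_i}\rangle=\partial_\alpha\langle\boldsymbol\nu,\Sigma_{i\alpha}(\lambda_F,\lambda_\eta)\rangle;$$ 5. with $E(\lambda)=\tfrac12|\lambda_v|^2+\hat e(\Phi(\lambda_F),\lambda_\eta)$, for all $\varphi\in C_c^\infty([0,T))$ with $\varphi\ge0$, $$-\varphi(0)\Big(\int_{\mathbb{T}^3}\langle\boldsymbol\nu_0,E\rangle\,dx+\boldsymbol\gamma_0(\mathbb{T}^3)\Big)-\int_{Q_T}\varphi'(t)\big(\langle\boldsymbol\nu,E\rangle\,dx\,dt+\boldsymbol\gamma(dx\,dt)\big)\le\int_{Q_T}r\,\varphi(t)\,dx\,dt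 .$$ **Theorem.** Let $\hat e$, $r$ and $\bar U$ be as above, and let $(\boldsymbol\nu,\boldsymbol\gamma,U)$ be a dissipative measure-valued solution with the same heat supply $r$, whose initial data are $\boldsymbol\nu_{(0,x)}=\delta_{U_0(x)}$ for a.e. $x$, for some $U_0$, with no initial concentration, $\boldsymbol\gamma_0=0$. If $U_0(x)=\bar U(0,x)$ for a.e. $x\in\mathbb{T}^3$, then $\boldsymbol\nu=\delta_{\bar U}$ and $U=\bar U$ a.e. on $Q_T$. -/

import Mathlib

open MeasureTheory ProbabilityTheory Set Filter Topology
open scoped ContDiff NNReal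

noncomputable section

namespace Thermoelasticity

/-! ### Spaces -/

/-- Euclidean three-space. -/
abbrev E3 := EuclideanSpace ℝ (Fin 3)

/-- Real `3 × 3` matrices `(F_{iα})` with the Frobenius norm. -/
abbrev Mat3 := EuclideanSpace ℝ (Fin 3 × Fin 3)

/-- The extended variable `ξ = (F, ζ, w)`, an element of a space of dimension 19. -/
abbrev Ext := Mat3 × Mat3 × ℝ

/-- States `U = (F, v, η)`: deformation gradient, velocity, entropy. -/
abbrev State := Mat3 × E3 × ℝ

/-- The `i`-th unit vector of three-space. -/
abbrev unitVec (i : Fin 3) : E3 := EuclideanSpace.single i 1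

/-- The matrix unit with a single entry `1` at position `(i, α)`. -/
abbrev unitMat (i α : Fin 3) : Mat3 := EuclideanSpace.single (i, α) 1

/-! ### The null Lagrangians -/

/-- The matrix with entries `F_{iα}`. -/
def toMatrix (F : Mat3) : Matrix (Fin 3) (Fin 3) ℝ := Matrix.of fun i α => F (i, α)

/-- The cofactor matrix, i.e. the transposed adjugate. -/
def cof (F : Mat3) : Mat3 := WithLp.toLp 2 fun k => (toMatrix F).adjugate k.2 k.1

/-- `Φ(F) = (F, cof F, det F)`. -/
def Phi (F : Mat3) : Ext := (F, cof F, (toMatrix F).det)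

/-- The vector `(∂Φ^B / ∂F_{iα} (F))_B`. -/
def dPhi (F : Mat3) (i α : Fin 3) : Ext := fderiv ℝ Phi F (unitMat i α)

/-! ### Constitutive functions

The internal energy `e (ξ, η)` is only used for `η ≥ 0`, and its derivatives at `η = 0` are
one-sided in `η`. -/

/-- The domain of the internal energy: `η ≥ 0`. -/
def dom : Set (Ext × ℝ) := {z | 0 ≤ z.2}

/-- The temperature `θ = ∂e/∂η`. -/
def theta (e : Ext × ℝ → ℝ) (z : Ext × ℝ) : ℝ := fderivWithin ℝ e dom z (0, 1)

/-- The gradient `∂e/∂F`. -/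
def gradF (e : Ext × ℝ → ℝ) (z : Ext × ℝ) : Mat3 :=
  WithLp.toLp 2 fun k => fderivWithin ℝ e dom z ((EuclideanSpace.single k 1, 0, 0), 0)

/-- The gradient `∂e/∂ζ`. -/
def gradZeta (e : Ext × ℝ → ℝ) (z : Ext × ℝ) : Mat3 :=
  WithLp.toLp 2 fun k => fderivWithin ℝ e dom z ((0, EuclideanSpace.single k 1, 0), 0)

/-- The derivative `∂e/∂w`. -/
def derivW (e : Ext × ℝ → ℝ) (z : Ext × ℝ) : ℝ := fderivWithin ℝ e dom z ((0, 0, 1), 0)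

/-- The stress `Σ_{iα} = ∑_B ∂e/∂ξ^B (Φ(F), η) ∂Φ^B/∂F_{iα} (F)`. -/
def stress (e : Ext × ℝ → ℝ) (F : Mat3) (η : ℝ) (i α : Fin 3) : ℝ :=
  fderivWithin ℝ e dom (Phi F, η) (dPhi F i α, 0)

/-- The total energy density `½|v|² + e(Φ(F), η)`. -/
def energy (e : Ext × ℝ → ℝ) (U : State) : ℝ := (1 / 2) * ‖U.2.1‖ ^ 2 + e (Phi U.1, U.2.2)

/-- The weight `|F|^p + |ζ|^q + |w|^ρ + |η|^ℓ`. -/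
def weight (p q ρ l : ℝ) (z : Ext × ℝ) : ℝ :=
  ‖z.1.1‖ ^ p + ‖z.1.2.1‖ ^ q + |z.1.2.2| ^ ρ + |z.2| ^ l

/-- Constitutive assumptions on the internal energy: smoothness, uniform convexity, positivity of
the temperature, and growth. -/
structure ConstitutiveAssumptions (e : Ext × ℝ → ℝ) (p q ρ l : ℝ) : Prop where
  four_le_p : 4 ≤ p
  two_le_q : 2 ≤ q
  one_lt_ρ : 1 < ρ
  one_lt_l : 1 < l
  smooth : ContDiffOn ℝ 3 e dom
  uniformly_convex : ∃ c > 0, ∀ z ∈ dom, ∀ h : Ext × ℝ,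
    c * (‖h.1.1‖ ^ 2 + ‖h.1.2.1‖ ^ 2 + h.1.2.2 ^ 2 + h.2 ^ 2) ≤
      fderivWithin ℝ (fderivWithin ℝ e dom) dom z h h
  temperature_pos : ∃ δ > 0, ∀ z ∈ dom, δ ≤ theta e z
  growth_energy : ∃ c > 0, ∃ C > 0, ∀ z ∈ dom,
    c * weight p q ρ l z - C ≤ e z ∧ e z ≤ C * weight p q ρ l z + C
  growth_temperature :
    Tendsto (fun z => theta e z / weight p q ρ l z) (comap (weight p q ρ l) atTop ⊓ 𝓟 dom) (𝓝 0)
  growth_stress : ∃ C > 0, ∀ z ∈ dom,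
    ‖gradF e z‖ ^ (p / (p - 1)) + ‖gradZeta e z‖ ^ (p / (p - 2)) + |derivW e z| ^ (p / (p - 3)) ≤
      C * weight p q ρ l z + C

/-! ### The space-time cylinder

The torus is `ℝ³/ℤ³`. Points of it are represented by their representatives in the half-open unit
cell, and smooth functions on it by `ℤ³`-periodic functions on `ℝ³`. -/

/-- The half-open unit cell. -/
def cell : Set E3 := {x | ∀ i, x i ∈ Ico (0 : ℝ) 1}

/-- The space-time cylinder `[0, T] × 𝕋³`; points are `(t, x)`. -/
def cylinder (T : ℝ) : Set (ℝ × E3) := Icc 0 T ×ˢ cell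

/-- `dx dt` on the cylinder. -/
abbrev volQ (T : ℝ) : Measure (ℝ × E3) := volume.restrict (cylinder T)

/-- `dx` on the torus. -/
abbrev volX : Measure E3 := volume.restrict cell

section Derivatives
variable {V : Type*} [NormedAddCommGroup V] [NormedSpace ℝ V]

/-- The time derivative `∂_t f`. -/
def dt (f : ℝ × E3 → V) (z : ℝ × E3) : V := fderiv ℝ f z (1, 0)

/-- The space derivative `∂_α f`. -/
def dx (α : Fin 3) (f : ℝ × E3 → V) (z : ℝ × E3) : V := fderiv ℝ f z (0, unitVec α)

/-- `f ∈ L^∞(0, T; L^s(𝕋³))`. -/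
def MemLinfLs (T s : ℝ) (f : ℝ × E3 → V) : Prop :=
  AEStronglyMeasurable f (volQ T) ∧
    ∃ C : ℝ≥0, ∀ᵐ t ∂(volume.restrict (Icc 0 T)),
      eLpNorm (fun x => f (t, x)) (ENNReal.ofReal s) volX ≤ C

end Derivatives

/-- Test functions in `C_c^∞([0, T) × 𝕋³)`. -/
structure IsTest (T : ℝ) (φ : ℝ × E3 → ℝ) : Prop where
  smooth : ContDiff ℝ ∞ φ
  periodic : ∀ t x i, φ (t, x + unitVec i) = φ (t, x)
  support : ∃ b < T, ∀ t x, b ≤ t → φ (t, x) = 0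

/-- Test functions in `C_c^∞((0, T) × 𝕋³)`. -/
structure IsInteriorTest (T : ℝ) (φ : ℝ × E3 → ℝ) : Prop extends IsTest T φ where
  support_left : ∃ a > 0, ∀ t x, t ≤ a → φ (t, x) = 0

/-- Non-negative test functions in `C_c^∞([0, T))`. -/
structure IsTimeTest (T : ℝ) (φ : ℝ → ℝ) : Prop where
  smooth : ContDiff ℝ ∞ φ
  nonneg : ∀ t, 0 ≤ t → 0 ≤ φ t
  support : ∃ b < T, ∀ t, b ≤ t → φ t = 0

/-! ### Lipschitz solutions -/

/-- The compact set `Γ_M` of states with `|F|, |v|, |η| ≤ M` (and `η ≥ 0`). -/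
def Gam (M : ℝ) : Set State := {U | ‖U.1‖ ≤ M ∧ ‖U.2.1‖ ≤ M ∧ |U.2.2| ≤ M ∧ 0 ≤ U.2.2}

/-- `Ubar = (F, v, η)` is a Lipschitz solution on `[0, T] × 𝕋³`, with values in `Γ_M` and with heat
supply `r`, of the system of polyconvex thermoelasticity. Every function that is differentiated
below is Lipschitz, hence differentiable almost everywhere, and the equations hold almost
everywhere. -/
structure IsLipschitzSolution (e : Ext × ℝ → ℝ) (r : ℝ × E3 → ℝ) (T M : ℝ)
    (Ubar : ℝ × E3 → State) : Prop where
  lipschitz : ∃ K, LipschitzOnWith K Ubar (Icc 0 T ×ˢ univ)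
  periodic : ∀ t ∈ Icc 0 T, ∀ x i, Ubar (t, x + unitVec i) = Ubar (t, x)
  mem_Gam : ∀ t ∈ Icc 0 T, ∀ x, Ubar (t, x) ∈ Gam M
  eq_Phi : ∀ᵐ z ∂(volQ T), dt (fun y => Phi (Ubar y).1) z =
    ∑ i, ∑ α, dx α (fun y => (Ubar y).2.1 i • dPhi (Ubar y).1 i α) z
  eq_entropy : ∀ᵐ z ∂(volQ T), dt (fun y => (Ubar y).2.2) z =
    r z / theta e (Phi (Ubar z).1, (Ubar z).2.2)
  eq_velocity : ∀ i, ∀ᵐ z ∂(volQ T), dt (fun y => (Ubar y).2.1 i) z =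
    ∑ α, dx α (fun y => stress e (Ubar y).1 (Ubar y).2.2 i α) z
  eq_energy : ∀ᵐ z ∂(volQ T), dt (fun y => energy e (Ubar y)) z =
    (∑ i, ∑ α, dx α (fun y => stress e (Ubar y).1 (Ubar y).2.2 i α * (Ubar y).2.1 i) z) + r z

/-! ### Dissipative measure-valued solutions -/

/-- `(ν, γ, U)` is a dissipative measure-valued solution on `[0, T] × 𝕋³` with heat supply `r`,
initial Young measure `ν₀` and initial concentration measure `γ₀`. A Young measure is a measurable
family of probability measures on the states `λ = (λ_F, λ_v, λ_η)`. -/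
structure IsDissipativeMVSolution (e : Ext × ℝ → ℝ) (p q ρ l : ℝ) (r : ℝ × E3 → ℝ) (T : ℝ)
    (ν₀ : Kernel E3 State) (γ₀ : Measure E3)
    (ν : Kernel (ℝ × E3) State) (γ : Measure (ℝ × E3)) (U : ℝ × E3 → State) : Prop where
  /-- the Young measures live on the domain of the energy -/
  entropy_nonneg : ∀ᵐ z ∂(volQ T), ∀ᵐ lam ∂(ν z), 0 ≤ lam.2.2
  entropy_nonneg_init : ∀ᵐ x ∂volX, ∀ᵐ lam ∂(ν₀ x), 0 ≤ lam.2.2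
  /-- finiteness of the moments that the energy controls -/
  moments : ∫⁻ z, ∫⁻ lam, ENNReal.ofReal
    (‖lam.2.1‖ ^ 2 + weight p q ρ l (Phi lam.1, lam.2.2)) ∂(ν z) ∂(volQ T) < ⊤
  moments_init : ∫⁻ x, ∫⁻ lam, ENNReal.ofReal
    (‖lam.2.1‖ ^ 2 + weight p q ρ l (Phi lam.1, lam.2.2)) ∂(ν₀ x) ∂volX < ⊤
  /-- `U = (F, v, η)` is the average of `ν` -/
  average : ∀ᵐ z ∂(volQ T), U z = ∫ lam, lam ∂(ν z)
  /-- the null Lagrangians commute with averaging -/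
  average_Phi : ∀ᵐ z ∂(volQ T), ∫ lam, Phi lam.1 ∂(ν z) = Phi (U z).1
  /-- regularity of the averages -/
  mem_v : MemLinfLs T 2 (fun z => (U z).2.1)
  mem_F : MemLinfLs T p (fun z => (U z).1)
  mem_cof : MemLinfLs T q (fun z => cof (U z).1)
  mem_det : MemLinfLs T ρ (fun z => (toMatrix (U z).1).det)
  mem_eta : MemLinfLs T l (fun z => (U z).2.2)
  /-- `v = ∂_t y` and `F = ∇y` weakly, for a motion `y` in `W^{1,∞}(L²) ∩ L^∞(W^{1,p})` -/
  motion : ∃ y : ℝ × E3 → E3, MemLinfLs T 2 y ∧ MemLinfLs T p y ∧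
    ∀ φ, IsInteriorTest T φ → ∀ i,
      (∫ z, y z i * dt φ z ∂(volQ T) = -∫ z, (U z).2.1 i * φ z ∂(volQ T)) ∧
      ∀ α, ∫ z, y z i * dx α φ z ∂(volQ T) = -∫ z, (U z).1 (i, α) * φ z ∂(volQ T)
  /-- `∂_t Φ^B(F) = ∂_α (∂Φ^B/∂F_{iα}(F) v_i)` -/
  eq_Phi : ∀ φ, IsTest T φ →
    (∫ z, dt φ z • Phi (U z).1 ∂(volQ T)) + ∫ x, φ (0, x) • Phi (∫ lam, lam.1 ∂(ν₀ x)) ∂volX =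
      ∫ z, ∑ i, ∑ α, (dx α φ z * (U z).2.1 i) • dPhi (U z).1 i α ∂(volQ T)
  /-- `∂_t ⟨ν, λ_η⟩ = ⟨ν, r / θ(Φ(λ_F), λ_η)⟩` -/
  eq_entropy : ∀ φ, IsTest T φ →
    (∫ z, dt φ z * ∫ lam, lam.2.2 ∂(ν z) ∂(volQ T)) +
        ∫ x, φ (0, x) * ∫ lam, lam.2.2 ∂(ν₀ x) ∂volX =
      -∫ z, φ z * ∫ lam, r z / theta e (Phi lam.1, lam.2.2) ∂(ν z) ∂(volQ T)
  /-- `∂_t ⟨ν, λ_{v_i}⟩ = ∂_α ⟨ν, Σ_{iα}(λ_F, λ_η)⟩` -/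
  eq_velocity : ∀ φ, IsTest T φ → ∀ i,
    (∫ z, dt φ z * ∫ lam, lam.2.1 i ∂(ν z) ∂(volQ T)) +
        ∫ x, φ (0, x) * ∫ lam, lam.2.1 i ∂(ν₀ x) ∂volX =
      ∫ z, ∑ α, dx α φ z * ∫ lam, stress e lam.1 lam.2.2 i α ∂(ν z) ∂(volQ T)
  /-- the integrated averaged energy inequality with concentration measure -/
  energy_ineq : ∀ φ, IsTimeTest T φ →
    -(φ 0 * ((∫ x, ∫ lam, energy e lam ∂(ν₀ x) ∂volX) + γ₀.real cell)) -
        ((∫ z, deriv φ z.1 * ∫ lam, energy e lam ∂(ν z) ∂(volQ T)) +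
          ∫ z in cylinder T, deriv φ z.1 ∂γ) ≤
      ∫ z, r z * φ z.1 ∂(volQ T)

end Thermoelasticity

end

open Thermoelasticity

/-!
The proof is the relative energy method. The state `λ` is compared with the Lipschitz solution `W`
through `relEnergy e λ W`, the remainder of the energy, as a function of the extended variables
`(Φ(F), η)` and of `v`, at its first-order Taylor expansion at `W`. Strong convexity makes it
control the squared distances of `(Φ(F), η)` and of `v` (`exists_sq_le_relEnergy`). Far from `W` it
also dominates `weight`, and therefore, by the growth conditions, the stress and the temperature;
hence all errors that are quadratic near `W` are bounded by it (`exists_le_relEnergy`,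
`exists_errors_le`).

The relative energy inequality (`relEnergy_ineq`) is the energy inequality minus the balance laws
of `Φ(F)`, `η` and `v`, tested with the gradient of the energy at `W` and with the velocity of `W`
(`integral_grad`, `integral_velocity`). These test functions are merely Lipschitz; weak
formulations extend to them by mollification (`weakForm_eq_zero`). The zeroth-order term of the
Taylor expansion depends on `W` alone and is differentiated directly (`dt_dualEnergy`).

On the right-hand side remain the errors nonlinear in `λ`, which `exists_production_le` estimates
before averaging, and the terms in the averages `F` and `v`. Among the latter `∂_α (v_i ∂e/∂ξ^B)(W)
∂Φ^B/∂F_{iα}(F)` is only linear in the difference of the two solutions, but a null Lagrangian makes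
it vanish after integration. To avoid the Piola identity for the determinant of a weak gradient,
`∂Φ/∂F(F)` is replaced by `nullTensor`, which differs from it by the matrix of cofactors of the
difference of the deformation gradients. This error is quadratic and is absorbed by the relative
energy, while `nullTensor` is affine in `F`, so that its divergence vanishes as soon as `F` is
weakly curl-free and the deformation gradient of `W` is curl-free almost everywhere
(`integral_nullForm`). The first holds because `F` is the gradient of a motion, and the second
because both deformation gradients have the same initial value and a time derivative that is a
gradient (`IsStrongSolution.curl_free`). By Jensen's inequality the quadratic terms in the averages
are bounded by the average of the relative energy, so the whole right-hand side is at most `C`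
times that average (`exists_meanProduction_le`).

Instead of applying Gronwall's lemma, the inequality is tested with `φ(t) = exp (-C t)
expNegInvGlue (b - t)`, for which `-φ' - C φ` is positive on `[0, b)`, and `-φ' ≥ 0`, so that the
concentration measure contributes with a favourable sign. The average of the relative energy is
then zero, and since the relative energy vanishes only at `W`, the Young measure is the Dirac
measure at `W`.
-/

noncomputable section

namespace Thermoelasticity

/-! ### Algebra of the null Lagrangians -/

theorem cof_apply (F : Mat3) (i α : Fin 3) :
    cof F (i, α) = F (i + 1, α + 1) * F (i + 2, α + 2) - F (i + 1, α + 2) * F (i + 2, α + 1) := by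
  fin_cases i <;> fin_cases α <;>
    simp [cof, toMatrix, Matrix.adjugate_fin_three] <;> ring

/-- The polar form of the quadratic map `cof`, so that `cofPolar F F = 2 cof F`. -/
def cofPolar (F G : Mat3) : Mat3 := WithLp.toLp 2 fun k =>
  F (k.1 + 1, k.2 + 1) * G (k.1 + 2, k.2 + 2) + G (k.1 + 1, k.2 + 1) * F (k.1 + 2, k.2 + 2)
    - F (k.1 + 1, k.2 + 2) * G (k.1 + 2, k.2 + 1) - G (k.1 + 1, k.2 + 2) * F (k.1 + 2, k.2 + 1)

theorem cofPolar_apply (F G : Mat3) (i α : Fin 3) : cofPolar F G (i, α) =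
    F (i + 1, α + 1) * G (i + 2, α + 2) + G (i + 1, α + 1) * F (i + 2, α + 2)
    - F (i + 1, α + 2) * G (i + 2, α + 1) - G (i + 1, α + 2) * F (i + 2, α + 1) := rfl

theorem cof_add (F G : Mat3) : cof (F + G) = cof F + cofPolar F G + cof G := by
  ext ⟨i, α⟩
  simp only [PiLp.add_apply, cof_apply, cofPolar_apply]
  ring

theorem cof_smul (t : ℝ) (F : Mat3) : cof (t • F) = t ^ 2 • cof F := by
  ext ⟨i, α⟩
  simp only [PiLp.smul_apply, cof_apply, smul_eq_mul]
  ring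

theorem cofPolar_smul_right (t : ℝ) (F G : Mat3) : cofPolar F (t • G) = t • cofPolar F G := by
  ext ⟨i, α⟩
  simp only [PiLp.smul_apply, cofPolar_apply, smul_eq_mul]
  ring

theorem cofPolar_add_left (F G H : Mat3) :
    cofPolar (F + G) H = cofPolar F H + cofPolar G H := by
  ext ⟨i, α⟩
  simp only [PiLp.add_apply, cofPolar_apply]
  ring

theorem cofPolar_sub_left (F G H : Mat3) :
    cofPolar (F - G) H = cofPolar F H - cofPolar G H := by
  ext ⟨i, α⟩
  simp only [PiLp.sub_apply, cofPolar_apply]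
  ring

theorem cofPolar_comm (F G : Mat3) : cofPolar F G = cofPolar G F := by
  ext ⟨i, α⟩
  simp only [cofPolar_apply]
  ring

theorem det_add_smul (F G : Mat3) (t : ℝ) : (toMatrix (F + t • G)).det =
    (toMatrix F).det + t * (∑ k, cof F k * G k) + t ^ 2 * (∑ k, F k * cof G k)
      + t ^ 3 * (toMatrix G).det := by
  simp only [Matrix.det_fin_three, toMatrix, Matrix.of_apply, PiLp.add_apply, PiLp.smul_apply,
    smul_eq_mul, Fintype.sum_prod_type, Fin.sum_univ_three, cof_apply]
  simp only [Fin.isValue, zero_add, Fin.reduceAdd]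
  ring

theorem contDiff_cof {n : WithTop ℕ∞} : ContDiff ℝ n cof := by
  rw [contDiff_euclidean]
  rintro ⟨i, α⟩
  simp only [cof_apply]
  fun_prop

theorem contDiff_Phi {n : WithTop ℕ∞} : ContDiff ℝ n Phi := by
  refine contDiff_id.prodMk (contDiff_cof.prodMk ?_)
  simp only [Matrix.det_fin_three, toMatrix, Matrix.of_apply]
  fun_prop

theorem continuous_Phi : Continuous Phi := contDiff_Phi (n := 0) |>.continuous

theorem continuous_cof : Continuous cof := contDiff_cof (n := 0) |>.continuous

theorem differentiable_Phi : Differentiable ℝ Phi := contDiff_Phi.differentiable one_ne_zero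

/-- Along a line `t ↦ F + t G` the three components of `Φ` are polynomials in `t`, and the
derivative is the coefficient of `t`. -/
theorem fderiv_Phi_apply (F G : Mat3) :
    fderiv ℝ Phi F G = (G, cofPolar F G, ∑ k, cof F k * G k) := by
  have h1 : HasDerivAt (fun t : ℝ => Phi (F + t • G)) (fderiv ℝ Phi F G) 0 := by
    have h0 : HasFDerivAt Phi (fderiv ℝ Phi F) (F + (0 : ℝ) • G) := by
      simpa using (differentiable_Phi F).hasFDerivAt
    have h2 : HasDerivAt (fun t : ℝ => F + t • G) G 0 := by
      simpa using ((hasDerivAt_id (0 : ℝ)).smul_const G).const_add F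
    exact h0.comp_hasDerivAt 0 h2
  have h2 : HasDerivAt (fun t : ℝ => Phi (F + t • G)) (G, cofPolar F G, ∑ k, cof F k * G k) 0 := by
    have e : (fun t : ℝ => Phi (F + t • G)) = fun t => (F + t • G,
        cof F + t • cofPolar F G + t ^ 2 • cof G,
        (toMatrix F).det + t * (∑ k, cof F k * G k) + t ^ 2 * (∑ k, F k * cof G k)
          + t ^ 3 * (toMatrix G).det) := by
      funext t
      rw [← det_add_smul, ← cof_smul, ← cofPolar_smul_right, ← cof_add]
      rfl
    rw [e]
    have hid := hasDerivAt_id (0 : ℝ)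
    have hp2 : HasDerivAt (fun t : ℝ => t ^ 2) 0 0 := by simpa using hasDerivAt_pow 2 (0 : ℝ)
    have hp3 : HasDerivAt (fun t : ℝ => t ^ 3) 0 0 := by simpa using hasDerivAt_pow 3 (0 : ℝ)
    refine HasDerivAt.prodMk (by simpa using (hid.smul_const G).const_add F)
      (HasDerivAt.prodMk ?_ ?_)
    · simpa using ((hid.smul_const (cofPolar F G)).const_add (cof F)).fun_add
        (hp2.smul_const (cof G))
    · simpa using (((hid.mul_const (∑ k, cof F k * G k)).const_add ((toMatrix F).det)).fun_add
        (hp2.mul_const (∑ k, F k * cof G k))).fun_add (hp3.mul_const (toMatrix G).det)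
  exact h1.unique h2

theorem dPhi_eq (F : Mat3) (i α : Fin 3) :
    dPhi F i α = (unitMat i α, cofPolar F (unitMat i α), cof F (i, α)) := by
  rw [dPhi, fderiv_Phi_apply]
  simp

theorem dPhi_sub (F G : Mat3) (i α : Fin 3) :
    dPhi F i α - dPhi G i α = (0, cofPolar (F - G) (unitMat i α), cof F (i, α) - cof G (i, α)) := by
  simp [dPhi_eq, cofPolar_sub_left]

theorem sum_smul_unitMat (G : Mat3) : ∑ i, ∑ α, G (i, α) • unitMat i α = G := by
  ext ⟨j, β⟩
  simp [PiLp.single_apply, Fin.sum_univ_three]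
  fin_cases j <;> fin_cases β <;> simp

theorem fderiv_Phi_eq_sum (F G : Mat3) :
    fderiv ℝ Phi F G = ∑ i, ∑ α, G (i, α) • dPhi F i α := by
  conv_lhs => rw [← sum_smul_unitMat G]
  simp [map_sum, dPhi]

theorem contDiff_dPhi (i α : Fin 3) {n : WithTop ℕ∞} : ContDiff ℝ n (fun F => dPhi F i α) :=
  ((contDiff_Phi (n := n + 1)).fderiv_right le_rfl).clm_apply contDiff_const

theorem continuous_dPhi (i α : Fin 3) : Continuous (fun F => dPhi F i α) :=
  (contDiff_dPhi i α (n := 0)).continuous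

theorem abs_apply_le_norm (F : Mat3) (k : Fin 3 × Fin 3) : |F k| ≤ ‖F‖ := by
  simpa using PiLp.norm_apply_le F k

theorem norm_le_of_abs_le {F : Mat3} {c : ℝ} (h : ∀ k, |F k| ≤ c) : ‖F‖ ≤ 3 * c := by
  have hc : 0 ≤ c := (abs_nonneg _).trans (h (0, 0))
  rw [EuclideanSpace.norm_eq]
  apply Real.sqrt_le_iff.2 ⟨by positivity, ?_⟩
  calc ∑ k, ‖F k‖ ^ 2 ≤ ∑ _k : Fin 3 × Fin 3, c ^ 2 := by
        gcongr with k; exact h k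
    _ = (3 * c) ^ 2 := by simp; ring

theorem norm_cofPolar_le (F G : Mat3) : ‖cofPolar F G‖ ≤ 12 * (‖F‖ * ‖G‖) := by
  have : ∀ k, |cofPolar F G k| ≤ 4 * (‖F‖ * ‖G‖) := by
    rintro ⟨i, α⟩
    rw [cofPolar_apply]
    have h (k l : Fin 3 × Fin 3) : |F k * G l| ≤ ‖F‖ * ‖G‖ := by
      rw [abs_mul]; gcongr <;> exact abs_apply_le_norm _ _
    have h' (k l : Fin 3 × Fin 3) : |G k * F l| ≤ ‖F‖ * ‖G‖ := by
      rw [mul_comm]; exact h _ _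
    have h1 := abs_le.1 (h (i + 1, α + 1) (i + 2, α + 2))
    have h2 := abs_le.1 (h' (i + 1, α + 1) (i + 2, α + 2))
    have h3 := abs_le.1 (h (i + 1, α + 2) (i + 2, α + 1))
    have h4 := abs_le.1 (h' (i + 1, α + 2) (i + 2, α + 1))
    exact abs_le.2 ⟨by linarith, by linarith⟩
  exact (norm_le_of_abs_le this).trans (by linarith)

theorem norm_cof_le (F : Mat3) : ‖cof F‖ ≤ 6 * ‖F‖ ^ 2 := by
  have h : cof F = (1 / 2 : ℝ) • cofPolar F F := by
    ext ⟨i, α⟩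
    simp only [PiLp.smul_apply, cofPolar_apply, cof_apply, smul_eq_mul]
    ring
  rw [h, norm_smul]
  have := norm_cofPolar_le F F
  norm_num
  nlinarith

theorem norm_unitMat (i α : Fin 3) : ‖unitMat i α‖ = 1 := by simp

theorem norm_cofPolar_unitMat_le (F : Mat3) (i α : Fin 3) :
    ‖cofPolar F (unitMat i α)‖ ≤ 12 * ‖F‖ := by
  simpa [norm_unitMat] using norm_cofPolar_le F (unitMat i α)

/-- Algebraic form of the Piola identity for `∂ cof / ∂F`: the array `A α` stands for `∂_α F`, and
the hypothesis says that `F` is curl-free. -/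
theorem sum_cofPolar_unitMat_eq_zero {A : Fin 3 → Mat3}
    (hA : ∀ k α β, A α (k, β) = A β (k, α)) (i : Fin 3) :
    ∑ α, cofPolar (A α) (unitMat i α) = 0 := by
  ext ⟨j, β⟩
  have h01 := fun k => hA k 0 1
  have h02 := fun k => hA k 0 2
  have h12 := fun k => hA k 1 2
  fin_cases i <;> fin_cases j <;> fin_cases β <;>
    simp [Fin.sum_univ_three, cofPolar_apply, h01, h02, h12]

/-- Algebraic form of the Piola identity for `∂ det / ∂F = cof`. -/
theorem sum_cofPolar_apply_eq_zero {A : Fin 3 → Mat3}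
    (hA : ∀ k α β, A α (k, β) = A β (k, α)) (F : Mat3) (i : Fin 3) :
    ∑ α, cofPolar F (A α) (i, α) = 0 := by
  simp only [Fin.sum_univ_three, cofPolar_apply]
  simp only [Fin.isValue, zero_add, Fin.reduceAdd]
  rw [hA _ 1 0, hA _ 2 0, hA _ 2 1, hA _ 1 0, hA _ 2 0, hA _ 2 1]
  ring

/-! ### Calculus on the domain of the energy -/

theorem convex_dom : Convex ℝ dom :=
  convex_halfSpace_ge (LinearMap.isLinear (LinearMap.snd ℝ Ext ℝ)) 0

theorem isClosed_dom : IsClosed dom := isClosed_le continuous_const continuous_snd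

theorem isOpen_pos_snd : IsOpen {z : Ext × ℝ | 0 < z.2} := isOpen_lt continuous_const continuous_snd

theorem dom_subset_closure_interior : dom ⊆ closure (interior dom) := by
  intro z hz
  have h1 : {z : Ext × ℝ | 0 < z.2} ⊆ interior dom :=
    interior_maximal (fun w (hw : 0 < w.2) => show 0 ≤ w.2 from hw.le) isOpen_pos_snd
  refine closure_mono h1 ?_
  have h2 : Tendsto (fun s : ℝ => (z.1, z.2 + s)) (𝓝[>] 0) (𝓝 z) := by
    have : Continuous (fun s : ℝ => (z.1, z.2 + s)) := by fun_prop
    have h := (this.tendsto 0).mono_left (nhdsWithin_le_nhds (s := Ioi 0))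
    simpa using h
  refine mem_closure_of_tendsto h2 ?_
  filter_upwards [self_mem_nhdsWithin] with s hs
  have h3 : (0 : ℝ) ≤ z.2 := hz
  have h4 : (0 : ℝ) < s := hs
  show 0 < z.2 + s
  linarith

theorem uniqueDiffOn_dom : UniqueDiffOn ℝ dom := by
  refine uniqueDiffOn_convex convex_dom ?_
  by_contra h
  rw [not_nonempty_iff_eq_empty] at h
  have := dom_subset_closure_interior (show (0 : Ext × ℝ) ∈ dom from le_refl (0 : ℝ))
  simp [h] at this

/-- The part of `dom` in a closed ball: compact and convex. -/
def domBall (R : ℝ) : Set (Ext × ℝ) := Metric.closedBall 0 R ∩ dom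

theorem isCompact_domBall (R : ℝ) : IsCompact (domBall R) :=
  (isCompact_closedBall 0 R).inter_right isClosed_dom

theorem convex_domBall (R : ℝ) : Convex ℝ (domBall R) := (convex_closedBall 0 R).inter convex_dom

theorem exists_bound_on_domBall {V : Type*} [NormedAddCommGroup V] {f : Ext × ℝ → V}
    (hf : ContinuousOn f dom) (R : ℝ) :
    ∃ L, 0 ≤ L ∧ ∀ z ∈ domBall R, ‖f z‖ ≤ L := by
  obtain ⟨L, hL⟩ := (isCompact_domBall R).exists_bound_of_continuousOn (hf.mono inter_subset_right)
  exact ⟨max L 0, le_max_right _ _, fun z hz => (hL z hz).trans (le_max_left _ _)⟩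

section
variable {V : Type*} [NormedAddCommGroup V] [NormedSpace ℝ V] {f : Ext × ℝ → V}

theorem hasFDerivWithinAt_domBall (hf : ContDiffOn ℝ 1 f dom) {R : ℝ} {z : Ext × ℝ}
    (hz : z ∈ domBall R) : HasFDerivWithinAt f (fderivWithin ℝ f dom z) (domBall R) z :=
  ((hf.differentiableOn one_ne_zero z hz.2).hasFDerivWithinAt).mono inter_subset_right

theorem exists_lipschitz_on_domBall (hf : ContDiffOn ℝ 1 f dom) (R : ℝ) :
    ∃ L, 0 ≤ L ∧ ∀ z ∈ domBall R, ∀ w ∈ domBall R, ‖f w - f z‖ ≤ L * ‖w - z‖ := by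
  obtain ⟨L, hL0, hL⟩ := exists_bound_on_domBall (f := fderivWithin ℝ f dom)
    (hf.continuousOn_fderivWithin uniqueDiffOn_dom le_rfl) R
  exact ⟨L, hL0, fun z hz w hw => (convex_domBall R).norm_image_sub_le_of_norm_hasFDerivWithin_le
    (fun x hx => hasFDerivWithinAt_domBall hf hx) hL hz hw⟩

theorem exists_taylor_on_domBall (hf : ContDiffOn ℝ 2 f dom) (R : ℝ) :
    ∃ L, 0 ≤ L ∧ ∀ z ∈ domBall R, ∀ w ∈ domBall R,
      ‖f w - f z - fderivWithin ℝ f dom z (w - z)‖ ≤ L * ‖w - z‖ ^ 2 := by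
  obtain ⟨L, hL0, hL⟩ := exists_lipschitz_on_domBall (f := fderivWithin ℝ f dom)
    (hf.fderivWithin uniqueDiffOn_dom (by norm_num)) R
  refine ⟨L, hL0, fun z hz w hw => ?_⟩
  have hseg : segment ℝ z w ⊆ domBall R := (convex_domBall R).segment_subset hz hw
  have h := (convex_segment z w).norm_image_sub_le_of_norm_hasFDerivWithin_le' (f := f)
    (f' := fderivWithin ℝ f dom) (φ := fderivWithin ℝ f dom z) (C := L * ‖w - z‖)
    (fun x hx => (hasFDerivWithinAt_domBall (hf.of_le (by norm_num)) (hseg hx)).mono hseg)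
    (fun x hx => ?_) (left_mem_segment ℝ z w) (right_mem_segment ℝ z w)
  · calc _ ≤ _ := h
      _ = _ := by ring
  · refine (hL z hz x (hseg hx)).trans ?_
    gcongr
    obtain ⟨a, b, ha, hb, hab, rfl⟩ := hx
    have : a • z + b • w - z = b • (w - z) := by
      rw [← eq_sub_iff_add_eq] at hab
      rw [hab, sub_smul, one_smul, smul_sub]; abel
    rw [this, norm_smul, Real.norm_of_nonneg hb]
    exact mul_le_of_le_one_left (norm_nonneg _) (by linarith)

end

/-! ### The relative energy -/

/-- The point `(Φ(F), η)` of the domain of the energy that belongs to a state. -/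
def ext (U : State) : Ext × ℝ := (Phi U.1, U.2.2)

/-- The relative energy `½|v - v'|² + e(ξ, η | ξ', η')`, where the last term is the remainder of
the first order Taylor expansion of `e` at `(ξ', η') = (Φ(F'), η')`. -/
def relEnergy (e : Ext × ℝ → ℝ) (U V : State) : ℝ :=
  (1 / 2) * ‖U.2.1 - V.2.1‖ ^ 2 +
    (e (ext U) - e (ext V) - fderivWithin ℝ e dom (ext V) (ext U - ext V))

theorem continuous_ext : Continuous ext :=
  (continuous_Phi.comp continuous_fst).prodMk (continuous_snd.comp continuous_snd)

theorem ext_mem_dom {U : State} (h : 0 ≤ U.2.2) : ext U ∈ dom := h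

/-- The squared Euclidean norm on `Ext × ℝ`. -/
def sqNorm (h : Ext × ℝ) : ℝ := ‖h.1.1‖ ^ 2 + ‖h.1.2.1‖ ^ 2 + h.1.2.2 ^ 2 + h.2 ^ 2

theorem sq_norm_le_sqNorm (h : Ext × ℝ) : ‖h‖ ^ 2 ≤ sqNorm h := by
  obtain ⟨⟨F, ζ, w⟩, η⟩ := h
  simp only [sqNorm, Prod.norm_mk, Real.norm_eq_abs]
  have h1 := sq_nonneg ‖F‖
  have h2 := sq_nonneg ‖ζ‖
  have h3 := sq_abs w
  have h4 := sq_abs η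
  have h5 := sq_nonneg w
  have h6 := sq_nonneg η
  rcases max_choice (max ‖F‖ (max ‖ζ‖ |w|)) |η| with h | h <;> rw [h]
  · rcases max_choice ‖F‖ (max ‖ζ‖ |w|) with h | h <;> rw [h]
    · linarith
    · rcases max_choice ‖ζ‖ |w| with h | h <;> rw [h] <;> linarith
  · linarith

section
variable {e : Ext × ℝ → ℝ} {p q ρ l : ℝ}

theorem ConstitutiveAssumptions.contDiffOn_grad (he : ConstitutiveAssumptions e p q ρ l) :
    ContDiffOn ℝ 2 (fderivWithin ℝ e dom) dom :=
  he.smooth.fderivWithin uniqueDiffOn_dom (by norm_num)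

theorem ConstitutiveAssumptions.continuousOn_grad (he : ConstitutiveAssumptions e p q ρ l) :
    ContinuousOn (fderivWithin ℝ e dom) dom := he.contDiffOn_grad.continuousOn

theorem ConstitutiveAssumptions.hess_symm (he : ConstitutiveAssumptions e p q ρ l)
    {z : Ext × ℝ} (hz : z ∈ dom) (h k : Ext × ℝ) :
    fderivWithin ℝ (fderivWithin ℝ e dom) dom z h k =
      fderivWithin ℝ (fderivWithin ℝ e dom) dom z k h :=
  (he.smooth z hz).isSymmSndFDerivWithinAt (by simp; norm_num) uniqueDiffOn_dom
    (dom_subset_closure_interior hz) hz h k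

/-- Uniform convexity in integrated form. -/
theorem ConstitutiveAssumptions.exists_le_remainder (he : ConstitutiveAssumptions e p q ρ l) :
    ∃ c > 0, ∀ a ∈ dom, ∀ b ∈ dom,
      c * sqNorm (a - b) ≤ e a - e b - fderivWithin ℝ e dom b (a - b) := by
  obtain ⟨c, hc, h⟩ := he.uniformly_convex
  refine ⟨c / 2, by positivity, fun a ha b hb => ?_⟩
  set d := a - b with hd
  set γ : ℝ → Ext × ℝ := fun s => b + s • d with hγ
  have hmem : ∀ s ∈ Icc (0 : ℝ) 1, γ s ∈ dom := fun s hs =>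
    convex_dom.add_smul_sub_mem hb ha hs
  have hγ' : ∀ s : ℝ, ∀ S, HasDerivWithinAt γ d S s := fun s S => by
    have h := ((hasDerivAt_id s).smul_const d).const_add b
    rw [one_smul] at h
    exact h.hasDerivWithinAt
  have h1 : ∀ s ∈ Icc (0 : ℝ) 1, HasDerivWithinAt (fun s => e (γ s))
      (fderivWithin ℝ e dom (γ s) d) (Icc 0 1) s := fun s hs =>
    (he.smooth.differentiableOn (by norm_num) _ (hmem s hs)).hasFDerivWithinAt.comp_hasDerivWithinAt
      s (hγ' s _) hmem
  have h2 : ∀ s ∈ Icc (0 : ℝ) 1, HasDerivWithinAt (fun s => fderivWithin ℝ e dom (γ s) d)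
      (fderivWithin ℝ (fderivWithin ℝ e dom) dom (γ s) d d) (Icc 0 1) s := fun s hs => by
    have := (he.contDiffOn_grad.differentiableOn (by norm_num) _
      (hmem s hs)).hasFDerivWithinAt.comp_hasDerivWithinAt s (hγ' s _) hmem
    simpa using this.clm_apply (hasDerivWithinAt_const s _ d)
  -- Two applications of monotonicity on `[0, 1]`.
  have mono : ∀ (f f' : ℝ → ℝ), (∀ s ∈ Icc (0 : ℝ) 1, HasDerivWithinAt f (f' s) (Icc 0 1) s) →
      (∀ s ∈ Icc (0 : ℝ) 1, 0 ≤ f' s) → ∀ s ∈ Icc (0 : ℝ) 1, f 0 ≤ f s := by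
    intro f f' hf hf' s hs
    refine monotoneOn_of_hasDerivWithinAt_nonneg (convex_Icc 0 1)
      (fun s hs => (hf s hs).continuousWithinAt) (f' := f')
      (fun s hs => ?_) (fun s hs => hf' s (interior_subset hs)) (by simp) hs hs.1
    exact (hf s (interior_subset hs)).mono interior_subset
  have h3 : ∀ s ∈ Icc (0 : ℝ) 1, 0 ≤ fderivWithin ℝ e dom (γ s) d - fderivWithin ℝ e dom b d
      - c * sqNorm d * s := by
    intro s hs
    have := mono (fun s => fderivWithin ℝ e dom (γ s) d - c * sqNorm d * s)
      (fun s => fderivWithin ℝ (fderivWithin ℝ e dom) dom (γ s) d d - c * sqNorm d)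
      (fun s hs => by
        simpa using (h2 s hs).fun_sub ((hasDerivWithinAt_id s _).const_mul (c * sqNorm d)))
      (fun s hs => sub_nonneg.2 (h _ (hmem s hs) d)) s hs
    have e0 : γ 0 = b := by simp [hγ]
    simp only [e0] at this
    linarith
  have h4 := mono (fun s => e (γ s) - fderivWithin ℝ e dom b d * s - c * sqNorm d / 2 * s ^ 2)
    (fun s => fderivWithin ℝ e dom (γ s) d - fderivWithin ℝ e dom b d - c * sqNorm d * s)
    (fun s hs => by
      have := ((h1 s hs).sub ((hasDerivWithinAt_id s (Icc 0 1)).const_mul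
        (fderivWithin ℝ e dom b d))).sub
        (((hasDerivAt_pow 2 s).hasDerivWithinAt (s := Icc 0 1)).const_mul (c * sqNorm d / 2))
      convert! this using 1
      simp; ring) h3 1 (by simp)
  have e0 : γ 0 = b := by simp [hγ]
  have e1 : γ 1 = a := by simp [hγ, hd]
  simp only [e0, e1] at h4
  linarith

end

/-! ### Growth estimates -/

theorem rpow_le_one_add_rpow {x a b : ℝ} (hx : 0 ≤ x) (ha : 0 ≤ a) (hab : a ≤ b) :
    x ^ a ≤ 1 + x ^ b := by
  have hb := Real.rpow_nonneg hx b
  rcases le_total x 1 with h | h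
  · linarith [Real.rpow_le_one hx h ha]
  · linarith [Real.rpow_le_rpow_of_exponent_le h hab]

theorem le_one_add_rpow {x b : ℝ} (hx : 0 ≤ x) (hb : 1 ≤ b) : x ≤ 1 + x ^ b := by
  simpa using rpow_le_one_add_rpow hx zero_le_one hb

/-- Young's inequality without its constants. -/
theorem mul_le_rpow_add_rpow {a b s t : ℝ} (ha : 0 ≤ a) (hb : 0 ≤ b) (hst : s.HolderConjugate t) :
    a * b ≤ a ^ s + b ^ t := by
  refine (Real.young_inequality_of_nonneg ha hb hst).trans ?_
  gcongr
  · exact div_le_self (Real.rpow_nonneg ha _) hst.lt.le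
  · exact div_le_self (Real.rpow_nonneg hb _) hst.symm.lt.le

theorem weight_nonneg (p q ρ l : ℝ) (z : Ext × ℝ) : 0 ≤ weight p q ρ l z := by
  unfold weight; positivity

/-- A linear functional on the extended space in terms of its components. For the derivative of
`e` these are `gradF`, `gradZeta`, `derivW` and `theta`. -/
theorem clm_apply_eq (L : Ext × ℝ →L[ℝ] ℝ) (h : Ext × ℝ) :
    L h = inner ℝ (WithLp.toLp 2 fun k => L ((EuclideanSpace.single k 1, 0, 0), 0) : Mat3) h.1.1
      + inner ℝ (WithLp.toLp 2 fun k => L ((0, EuclideanSpace.single k 1, 0), 0) : Mat3) h.1.2.1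
      + L ((0, 0, 1), 0) * h.1.2.2 + L (0, 1) * h.2 := by
  obtain ⟨⟨F, ζ, w⟩, η⟩ := h
  have e1 (G : Mat3) : G = ∑ k, G k • (EuclideanSpace.single k 1 : Mat3) := by
    ext j; simp [Pi.single_apply]
  have hF : L ((F, 0, 0), 0) = ∑ k, F k * L ((EuclideanSpace.single k 1, 0, 0), 0) := by
    have : (((F, 0, 0), 0) : Ext × ℝ) =
        ∑ k, F k • (((EuclideanSpace.single k 1, 0, 0), 0) : Ext × ℝ) := by
      conv_lhs => rw [e1 F]
      simp [Prod.ext_iff, Prod.fst_sum, Prod.snd_sum]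
    rw [this, map_sum]; simp only [map_smul, smul_eq_mul]
  have hζ : L ((0, ζ, 0), 0) = ∑ k, ζ k * L ((0, EuclideanSpace.single k 1, 0), 0) := by
    have : (((0, ζ, 0), 0) : Ext × ℝ) =
        ∑ k, ζ k • (((0, EuclideanSpace.single k 1, 0), 0) : Ext × ℝ) := by
      conv_lhs => rw [e1 ζ]
      simp [Prod.ext_iff, Prod.fst_sum, Prod.snd_sum]
    rw [this, map_sum]; simp only [map_smul, smul_eq_mul]
  have hs : (((F, ζ, w), η) : Ext × ℝ) =
      ((F, 0, 0), 0) + ((0, ζ, 0), 0) + w • ((0, 0, 1), 0) + η • (0, 1) := by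
    simp
  conv_lhs => rw [hs]
  simp only [map_add, map_smul, hF, hζ, PiLp.inner_apply, smul_eq_mul]
  simp [mul_comm]

theorem abs_clm_apply_le (L : Ext × ℝ →L[ℝ] ℝ) (h : Ext × ℝ) :
    |L h| ≤ ‖(WithLp.toLp 2 fun k => L ((EuclideanSpace.single k 1, 0, 0), 0) : Mat3)‖ * ‖h.1.1‖
      + ‖(WithLp.toLp 2 fun k => L ((0, EuclideanSpace.single k 1, 0), 0) : Mat3)‖ * ‖h.1.2.1‖
      + |L ((0, 0, 1), 0)| * |h.1.2.2| + |L (0, 1)| * |h.2| := by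
  rw [clm_apply_eq]
  refine (abs_add_le _ _).trans (add_le_add ((abs_add_le _ _).trans (add_le_add
    ((abs_add_le _ _).trans (add_le_add ?_ ?_)) ?_)) ?_)
  · exact abs_real_inner_le_norm _ _
  · exact abs_real_inner_le_norm _ _
  · rw [abs_mul]
  · rw [abs_mul]

section
variable {e : Ext × ℝ → ℝ} {p q ρ l : ℝ}

theorem ConstitutiveAssumptions.norm_le (he : ConstitutiveAssumptions e p q ρ l) (z : Ext × ℝ) :
    ‖z‖ ≤ 1 + weight p q ρ l z := by
  obtain ⟨⟨F, ζ, w⟩, η⟩ := z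
  have h1 := le_one_add_rpow (norm_nonneg F) (by linarith [he.four_le_p] : 1 ≤ p)
  have h2 := le_one_add_rpow (norm_nonneg ζ) (by linarith [he.two_le_q] : 1 ≤ q)
  have h3 := le_one_add_rpow (abs_nonneg w) he.one_lt_ρ.le
  have h4 := le_one_add_rpow (abs_nonneg η) he.one_lt_l.le
  have k1 := Real.rpow_nonneg (norm_nonneg F) p
  have k2 := Real.rpow_nonneg (norm_nonneg ζ) q
  have k3 := Real.rpow_nonneg (abs_nonneg w) ρ
  have k4 := Real.rpow_nonneg (abs_nonneg η) l
  simp only [weight, Prod.norm_mk, Real.norm_eq_abs]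
  refine max_le (max_le ?_ (max_le ?_ ?_)) ?_ <;> linarith

theorem ConstitutiveAssumptions.continuousOn_theta (he : ConstitutiveAssumptions e p q ρ l) :
    ContinuousOn (theta e) dom := he.continuousOn_grad.clm_apply continuousOn_const

theorem ConstitutiveAssumptions.exists_theta_le (he : ConstitutiveAssumptions e p q ρ l) :
    ∃ C, 0 ≤ C ∧ ∀ z ∈ dom, |theta e z| ≤ C * (1 + weight p q ρ l z) := by
  have h1 : ∀ᶠ z in comap (weight p q ρ l) atTop ⊓ 𝓟 dom,
      |theta e z / weight p q ρ l z| < 1 := by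
    have := he.growth_temperature.eventually (Metric.ball_mem_nhds 0 one_pos)
    simpa only [Metric.mem_ball, Real.dist_eq, sub_zero] using this
  rw [eventually_inf_principal, eventually_comap, eventually_atTop] at h1
  obtain ⟨A, hA⟩ := h1
  obtain ⟨L, hL0, hL⟩ := exists_bound_on_domBall he.continuousOn_theta (1 + max A 1)
  refine ⟨1 + L, by linarith, fun z hz => ?_⟩
  have hw := weight_nonneg p q ρ l z
  rcases le_total (max A 1) (weight p q ρ l z) with h | h
  · have h2 := hA _ ((le_max_left _ _).trans h) z rfl hz
    have h3 : 0 < weight p q ρ l z := one_pos.trans_le ((le_max_right _ _).trans h)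
    rw [abs_div, abs_of_pos h3, div_lt_one h3] at h2
    nlinarith
  · have h2 : z ∈ domBall (1 + max A 1) :=
      ⟨by simpa using (he.norm_le z).trans (by linarith), hz⟩
    have := hL z h2
    rw [Real.norm_eq_abs] at this
    nlinarith

/-- All exponents in the growth condition on the stress are at least one, so the full gradient of
the energy grows at most like `weight`. -/
theorem ConstitutiveAssumptions.exists_grad_le (he : ConstitutiveAssumptions e p q ρ l) :
    ∃ C, 0 ≤ C ∧ ∀ z ∈ dom, ‖fderivWithin ℝ e dom z‖ ≤ C * (1 + weight p q ρ l z) := by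
  obtain ⟨C, hC0, hC⟩ := he.exists_theta_le
  obtain ⟨D, hD0, hD⟩ := he.growth_stress
  have hp := he.four_le_p
  refine ⟨3 * (1 + D) + C, by positivity, fun z hz => ?_⟩
  have hw := weight_nonneg p q ρ l z
  have h := hD z hz
  have k1 := le_one_add_rpow (norm_nonneg (gradF e z)) (b := p / (p - 1))
    (by rw [le_div_iff₀] <;> linarith)
  have k2 := le_one_add_rpow (norm_nonneg (gradZeta e z)) (b := p / (p - 2))
    (by rw [le_div_iff₀] <;> linarith)
  have k3 := le_one_add_rpow (abs_nonneg (derivW e z)) (b := p / (p - 3))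
    (by rw [le_div_iff₀] <;> linarith)
  have j1 := Real.rpow_nonneg (norm_nonneg (gradF e z)) (p / (p - 1))
  have j2 := Real.rpow_nonneg (norm_nonneg (gradZeta e z)) (p / (p - 2))
  have j3 := Real.rpow_nonneg (abs_nonneg (derivW e z)) (p / (p - 3))
  have hθ := hC z hz
  refine ContinuousLinearMap.opNorm_le_bound _ (by positivity) fun h => ?_
  refine (abs_clm_apply_le _ h).trans ?_
  change ‖gradF e z‖ * _ + ‖gradZeta e z‖ * _ + |derivW e z| * _ + |theta e z| * _ ≤ _
  have n1 : ‖h.1.1‖ ≤ ‖h‖ := (norm_fst_le _).trans (norm_fst_le _)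
  have n2 : ‖h.1.2.1‖ ≤ ‖h‖ := (norm_fst_le _).trans ((norm_snd_le _).trans (norm_fst_le _))
  have n3 : |h.1.2.2| ≤ ‖h‖ := (norm_snd_le h.1.2).trans ((norm_snd_le _).trans (norm_fst_le _))
  have n4 : |h.2| ≤ ‖h‖ := norm_snd_le h
  calc _ ≤ ‖gradF e z‖ * ‖h‖ + ‖gradZeta e z‖ * ‖h‖ + |derivW e z| * ‖h‖ + |theta e z| * ‖h‖ := by
        gcongr
    _ = (‖gradF e z‖ + ‖gradZeta e z‖ + |derivW e z| + |theta e z|) * ‖h‖ := by ring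
    _ ≤ _ := by gcongr; nlinarith

/-- The stress is controlled by the weight, by Young's inequality. -/
theorem ConstitutiveAssumptions.exists_stress_le (he : ConstitutiveAssumptions e p q ρ l) :
    ∃ C, 0 ≤ C ∧ ∀ U : State, 0 ≤ U.2.2 → ∀ i α,
      |fderivWithin ℝ e dom (ext U) (dPhi U.1 i α, 0)| ≤ C * (1 + weight p q ρ l (ext U)) := by
  obtain ⟨C, hC0, hC⟩ := he.exists_grad_le
  obtain ⟨D, hD0, hD⟩ := he.growth_stress
  have hp := he.four_le_p
  refine ⟨C + 12 * (D + 2) + 6 * (D + 2), by positivity, fun U hU i α => ?_⟩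
  have hz := ext_mem_dom hU
  set z := ext U with hzdef
  have hw := weight_nonneg p q ρ l z
  have h := hD z hz
  have j1 := Real.rpow_nonneg (norm_nonneg (gradF e z)) (p / (p - 1))
  have j2 := Real.rpow_nonneg (norm_nonneg (gradZeta e z)) (p / (p - 2))
  have j3 := Real.rpow_nonneg (abs_nonneg (derivW e z)) (p / (p - 3))
  have hF : ‖U.1‖ ^ p ≤ weight p q ρ l z := by
    have k2 := Real.rpow_nonneg (norm_nonneg (cof U.1)) q
    have k3 := Real.rpow_nonneg (abs_nonneg ((toMatrix U.1).det)) ρ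
    have k4 := Real.rpow_nonneg (abs_nonneg (U.2.2)) l
    simp only [weight, hzdef, ext, Phi]
    linarith
  have y2 : ‖gradZeta e z‖ * ‖U.1‖ ≤ (D + 2) * (1 + weight p q ρ l z) := by
    have hc : (p / (p - 2)).HolderConjugate (p / 2) := by
      rw [Real.holderConjugate_iff]
      refine ⟨by rw [lt_div_iff₀] <;> linarith, ?_⟩
      field_simp; ring
    have := mul_le_rpow_add_rpow (norm_nonneg (gradZeta e z)) (norm_nonneg U.1) hc
    have := rpow_le_one_add_rpow (norm_nonneg U.1) (a := p / 2) (b := p) (by linarith) (by linarith)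
    nlinarith
  have y3 : |derivW e z| * ‖U.1‖ ^ 2 ≤ (D + 2) * (1 + weight p q ρ l z) := by
    have hc : (p / (p - 3)).HolderConjugate (p / 3) := by
      rw [Real.holderConjugate_iff]
      refine ⟨by rw [lt_div_iff₀] <;> linarith, ?_⟩
      field_simp; ring
    have h1 := mul_le_rpow_add_rpow (abs_nonneg (derivW e z)) (sq_nonneg ‖U.1‖) hc
    have h2 := rpow_le_one_add_rpow (norm_nonneg U.1) (a := 2 * (p / 3)) (b := p)
      (by linarith) (by linarith)
    rw [Real.rpow_mul (norm_nonneg _)] at h2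
    norm_cast at h1 h2 ⊢
    nlinarith
  have e0 : ((dPhi U.1 i α, (0 : ℝ)) : Ext × ℝ) = ((unitMat i α, 0, 0), 0) +
      ((0, cofPolar U.1 (unitMat i α), cof U.1 (i, α)), 0) := by
    simp [dPhi_eq]
  rw [e0, map_add]
  refine (abs_add_le _ _).trans ?_
  have b1 : |fderivWithin ℝ e dom z ((unitMat i α, 0, 0), 0)| ≤ C * (1 + weight p q ρ l z) := by
    refine ((fderivWithin ℝ e dom z).le_opNorm _).trans ?_
    have : ‖(((unitMat i α, 0, 0), 0) : Ext × ℝ)‖ = 1 := by simp [Prod.norm_mk]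
    rw [this, mul_one]; exact hC z hz
  have b2 := abs_clm_apply_le (fderivWithin ℝ e dom z)
    ((0, cofPolar U.1 (unitMat i α), cof U.1 (i, α)), 0)
  change _ ≤ ‖gradF e z‖ * _ + ‖gradZeta e z‖ * _ + |derivW e z| * _ + |theta e z| * _ at b2
  simp only [norm_zero, abs_zero, mul_zero, zero_add, add_zero] at b2
  have b3 : ‖gradZeta e z‖ * ‖cofPolar U.1 (unitMat i α)‖ ≤ ‖gradZeta e z‖ * (12 * ‖U.1‖) := by
    gcongr; exact norm_cofPolar_unitMat_le _ _ _
  have b4 : |derivW e z| * |cof U.1 (i, α)| ≤ |derivW e z| * (6 * ‖U.1‖ ^ 2) := by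
    gcongr; exact (abs_apply_le_norm _ _).trans (norm_cof_le _)
  nlinarith

/-! ### The relative energy controls the error terms -/

/-- The moment of a state that occurs in the integrability assumption on the Young measure. -/
def moment (p q ρ l : ℝ) (U : State) : ℝ := ‖U.2.1‖ ^ 2 + weight p q ρ l (ext U)

theorem moment_nonneg (p q ρ l : ℝ) (U : State) : 0 ≤ moment p q ρ l U :=
  add_nonneg (sq_nonneg _) (weight_nonneg _ _ _ _ _)

theorem exists_ext_mem_domBall (M : ℝ) : ∃ R, ∀ V ∈ Gam M, ext V ∈ domBall R := by
  have hK : IsCompact (Metric.closedBall (0 : Mat3) M) := isCompact_closedBall 0 M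
  obtain ⟨R, hR⟩ := hK.exists_bound_of_continuousOn continuous_Phi.continuousOn
  refine ⟨max R M, fun V hV => ⟨?_, ext_mem_dom hV.2.2.2⟩⟩
  simp only [Metric.mem_closedBall, dist_zero_right, ext, Prod.norm_mk]
  exact max_le_max (hR _ (by simpa using hV.1)) hV.2.2.1

theorem norm_dPhi_sub_le (U V : State) (i α : Fin 3) :
    ‖dPhi U.1 i α - dPhi V.1 i α‖ ≤ 12 * ‖ext U - ext V‖ := by
  have n1 : ‖U.1 - V.1‖ ≤ ‖ext U - ext V‖ :=
    (norm_fst_le (ext U - ext V).1).trans (norm_fst_le _)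
  have n2 : ‖cof U.1 - cof V.1‖ ≤ ‖ext U - ext V‖ :=
    (norm_fst_le (ext U - ext V).1.2).trans ((norm_snd_le _).trans (norm_fst_le _))
  have n0 := norm_nonneg (ext U - ext V)
  rw [dPhi_sub]
  simp only [Prod.norm_mk, norm_zero]
  refine max_le (by positivity) (max_le ?_ ?_)
  · exact (norm_cofPolar_unitMat_le _ _ _).trans (by linarith)
  · have : |(cof U.1 - cof V.1) (i, α)| ≤ ‖cof U.1 - cof V.1‖ := abs_apply_le_norm _ _
    rw [PiLp.sub_apply] at this
    rw [Real.norm_eq_abs]; linarith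

theorem norm_dPhi_le (F : Mat3) (i α : Fin 3) : ‖dPhi F i α‖ ≤ 1 + 12 * ‖F‖ + 6 * ‖F‖ ^ 2 := by
  have h1 := norm_cofPolar_unitMat_le F i α
  have h2 := (abs_apply_le_norm (cof F) (i, α)).trans (norm_cof_le F)
  have h3 := norm_nonneg F
  rw [dPhi_eq]
  simp only [Prod.norm_mk, norm_unitMat, Real.norm_eq_abs]
  refine max_le ?_ (max_le ?_ ?_) <;> nlinarith

theorem ConstitutiveAssumptions.relEnergy_nonneg (he : ConstitutiveAssumptions e p q ρ l)
    {U V : State} (hU : 0 ≤ U.2.2) (hV : 0 ≤ V.2.2) : 0 ≤ relEnergy e U V := by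
  obtain ⟨c, hc, h⟩ := he.exists_le_remainder
  have h1 := h _ (ext_mem_dom hU) _ (ext_mem_dom hV)
  have h2 := (sq_nonneg _).trans (sq_norm_le_sqNorm (ext U - ext V))
  unfold relEnergy
  nlinarith [sq_nonneg ‖U.2.1 - V.2.1‖]

/-- Strong convexity: the relative energy controls squared distances. -/
theorem ConstitutiveAssumptions.exists_sq_le_relEnergy (he : ConstitutiveAssumptions e p q ρ l) :
    ∃ C, 0 ≤ C ∧ ∀ U V : State, 0 ≤ U.2.2 → 0 ≤ V.2.2 →
      ‖U.2.1 - V.2.1‖ ^ 2 ≤ C * relEnergy e U V ∧ ‖ext U - ext V‖ ^ 2 ≤ C * relEnergy e U V := by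
  obtain ⟨c, hc, h⟩ := he.exists_le_remainder
  refine ⟨2 + 1 / c, by positivity, fun U V hU hV => ?_⟩
  have h1 := h _ (ext_mem_dom hU) _ (ext_mem_dom hV)
  have h2 := sq_norm_le_sqNorm (ext U - ext V)
  have h3 := sq_nonneg ‖ext U - ext V‖
  have h4 := sq_nonneg ‖U.2.1 - V.2.1‖
  have h0 := he.relEnergy_nonneg hU hV
  have h5 : c * ‖ext U - ext V‖ ^ 2 ≤ relEnergy e U V := by unfold relEnergy; nlinarith
  have h6 : ‖U.2.1 - V.2.1‖ ^ 2 ≤ 2 * relEnergy e U V := by unfold relEnergy; nlinarith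
  have h7 : 0 ≤ 1 / c * relEnergy e U V := by positivity
  refine ⟨by linarith, ?_⟩
  have : ‖ext U - ext V‖ ^ 2 ≤ 1 / c * relEnergy e U V := by
    rw [one_div, ← div_eq_inv_mul, le_div_iff₀ hc]; linarith
  linarith

theorem ConstitutiveAssumptions.exists_abs_energy_le (he : ConstitutiveAssumptions e p q ρ l) :
    ∃ C, 0 ≤ C ∧ ∀ z ∈ dom, |e z| ≤ C * (1 + weight p q ρ l z) := by
  obtain ⟨c, hc, C, hC, h⟩ := he.growth_energy
  refine ⟨C, hC.le, fun z hz => ?_⟩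
  have hw := weight_nonneg p q ρ l z
  obtain ⟨h1, h2⟩ := h z hz
  rw [abs_le]
  constructor <;> nlinarith

/-- A quantity that is quadratic near the reference state and has at most the growth of the weight
far from it is controlled by the relative energy. -/
theorem ConstitutiveAssumptions.exists_le_relEnergy (he : ConstitutiveAssumptions e p q ρ l)
    (M : ℝ) : ∃ C, 0 ≤ C ∧ ∀ A, 0 ≤ A → ∀ U V : State, 0 ≤ U.2.2 → V ∈ Gam M → ∀ x : ℝ,
      (‖ext U - ext V‖ ≤ 1 → x ≤ A * ‖ext U - ext V‖ ^ 2) →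
      (1 ≤ ‖ext U - ext V‖ → x ≤ A * (1 + weight p q ρ l (ext U))) →
      x ≤ A * C * relEnergy e U V := by
  obtain ⟨R, hR⟩ := exists_ext_mem_domBall M
  obtain ⟨K, hK0, hK⟩ := he.exists_sq_le_relEnergy
  obtain ⟨c, hc, E, hE, hgr⟩ := he.growth_energy
  obtain ⟨B, hB0, hB⟩ := exists_bound_on_domBall he.smooth.continuousOn R
  obtain ⟨D, hD0, hD⟩ := exists_bound_on_domBall he.continuousOn_grad R
  refine ⟨K + (1 + (E + B + D) * K) / c, by positivity, fun A hA U V hU hV x h1 h2 => ?_⟩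
  have h0 := he.relEnergy_nonneg hU hV.2.2.2
  obtain ⟨-, hq⟩ := hK U V hU hV.2.2.2
  have hpos : 0 ≤ (1 + (E + B + D) * K) / c := by positivity
  rcases le_total ‖ext U - ext V‖ 1 with h | h
  · refine (h1 h).trans ?_
    rw [mul_assoc]
    gcongr
    refine hq.trans ?_
    gcongr
    linarith
  · refine (h2 h).trans ?_
    rw [mul_assoc]
    gcongr
    -- Far from the reference state, `1` and the distance are bounded by the squared distance.
    have hsq : ‖ext U - ext V‖ ≤ ‖ext U - ext V‖ ^ 2 := by nlinarith
    have g1 := (hgr _ (ext_mem_dom hU)).1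
    have g2 := le_of_abs_le (hB _ (hR V hV))
    have g3 := le_of_abs_le ((fderivWithin ℝ e dom (ext V)).le_opNorm (ext U - ext V))
    have g4 : ‖fderivWithin ℝ e dom (ext V)‖ * ‖ext U - ext V‖ ≤ D * ‖ext U - ext V‖ ^ 2 := by
      gcongr; exact hD _ (hR V hV)
    have g5 : e (ext U) ≤ relEnergy e U V + e (ext V) +
        fderivWithin ℝ e dom (ext V) (ext U - ext V) := by
      unfold relEnergy; nlinarith [sq_nonneg ‖U.2.1 - V.2.1‖]
    have g6 : c * weight p q ρ l (ext U) ≤ (1 + (E + B + D) * K) * relEnergy e U V := by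
      have := mul_le_mul_of_nonneg_left hq (by positivity : 0 ≤ E + B + D)
      nlinarith
    have g7 : weight p q ρ l (ext U) ≤ (1 + (E + B + D) * K) / c * relEnergy e U V := by
      rw [div_mul_eq_mul_div, le_div_iff₀ hc]; linarith
    nlinarith

/-- The error terms of the relative energy inequality are controlled by the relative energy. -/
theorem ConstitutiveAssumptions.exists_errors_le (he : ConstitutiveAssumptions e p q ρ l)
    (M : ℝ) : ∃ C, 0 ≤ C ∧ ∀ U V : State, 0 ≤ U.2.2 → V ∈ Gam M →
      ‖fderivWithin ℝ e dom (ext U) - fderivWithin ℝ e dom (ext V) -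
        fderivWithin ℝ (fderivWithin ℝ e dom) dom (ext V) (ext U - ext V)‖
          ≤ C * relEnergy e U V ∧
      |(theta e (ext U) - theta e (ext V)) * (1 / theta e (ext U) - 1 / theta e (ext V))|
          ≤ C * relEnergy e U V ∧
      ∀ i α, |(fderivWithin ℝ e dom (ext U) - fderivWithin ℝ e dom (ext V))
        (dPhi U.1 i α - dPhi V.1 i α, 0)| ≤ C * relEnergy e U V := by
  obtain ⟨R, hR⟩ := exists_ext_mem_domBall M
  obtain ⟨K, hK0, hK⟩ := he.exists_le_relEnergy M
  obtain ⟨G, hG0, hG⟩ := he.exists_grad_le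
  obtain ⟨S, hS0, hS⟩ := he.exists_stress_le
  obtain ⟨T, hT0, hT⟩ := he.exists_theta_le
  obtain ⟨δ, hδ, hθ⟩ := he.temperature_pos
  obtain ⟨L1, hL1, hlip⟩ := exists_lipschitz_on_domBall
    (he.contDiffOn_grad.of_le (by norm_num)) (R + 1)
  obtain ⟨L2, hL2, htay⟩ := exists_taylor_on_domBall he.contDiffOn_grad (R + 1)
  obtain ⟨D, hD0, hD⟩ := exists_bound_on_domBall he.continuousOn_grad R
  obtain ⟨H, hH0, hH⟩ := exists_bound_on_domBall (f := fderivWithin ℝ (fderivWithin ℝ e dom) dom)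
    (he.contDiffOn_grad.continuousOn_fderivWithin uniqueDiffOn_dom (by norm_num)) R
  have hballs : ∀ U V : State, 0 ≤ U.2.2 → V ∈ Gam M → ‖ext U - ext V‖ ≤ 1 →
      ext U ∈ domBall (R + 1) ∧ ext V ∈ domBall (R + 1) := by
    intro U V hU hV h
    have h1 := (hR V hV).1
    rw [mem_closedBall_zero_iff] at h1
    refine ⟨⟨?_, ext_mem_dom hU⟩, ⟨?_, ext_mem_dom hV.2.2.2⟩⟩
    · rw [mem_closedBall_zero_iff]
      have := norm_add_le (ext V) (ext U - ext V)
      rw [add_sub_cancel] at this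
      linarith
    · rw [mem_closedBall_zero_iff]; linarith
  have hfar : ∀ U V : State, V ∈ Gam M → ‖ext U - ext V‖ ≤
      (1 + |R|) * (1 + weight p q ρ l (ext U)) := by
    intro U V hV
    have hV := (hR V hV).1
    rw [mem_closedBall_zero_iff] at hV
    have := norm_sub_le (ext U) (ext V)
    have := he.norm_le (ext U)
    nlinarith [le_abs_self R, abs_nonneg R, weight_nonneg p q ρ l (ext U)]
  set A1 := L2 + (G + D + H * (1 + |R|)) with hA1
  set A2 := L1 * (L1 / δ ^ 2) + (T + D) * (2 / δ) with hA2
  set A3 := L1 * 12 + (S + G * (1 + 12 * |M| + 6 * |M| ^ 2) + D * (12 * (1 + |R|))) with hA3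
  have hA10 : 0 ≤ A1 := by positivity
  have hA20 : 0 ≤ A2 := by positivity
  have hA30 : 0 ≤ A3 := by positivity
  refine ⟨(A1 + A2 + A3) * K, by positivity, fun U V hU hV => ?_⟩
  have h0 := he.relEnergy_nonneg hU hV.2.2.2
  have hw := weight_nonneg p q ρ l (ext U)
  have hK' : ∀ A, 0 ≤ A → A ≤ A1 + A2 + A3 → ∀ x : ℝ,
      (‖ext U - ext V‖ ≤ 1 → x ≤ A * ‖ext U - ext V‖ ^ 2) →
      (1 ≤ ‖ext U - ext V‖ → x ≤ A * (1 + weight p q ρ l (ext U))) →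
      x ≤ (A1 + A2 + A3) * K * relEnergy e U V := by
    intro A hA hle x h1 h2
    refine (hK A hA U V hU hV x h1 h2).trans ?_
    gcongr
  have hDV := hD _ (hR V hV)
  have hGU := hG _ (ext_mem_dom hU)
  have hd := hfar U V hV
  have hd0 := norm_nonneg (ext U - ext V)
  refine ⟨hK' A1 hA10 (by linarith) _ (fun h => ?_) (fun h => ?_),
    hK' A2 hA20 (by linarith) _ (fun h => ?_) (fun h => ?_),
    fun i α => hK' A3 hA30 (by linarith) _ (fun h => ?_) (fun h => ?_)⟩
  · obtain ⟨b1, b2⟩ := hballs U V hU hV h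
    refine (htay _ b2 _ b1).trans ?_
    gcongr
    rw [hA1]
    linarith [show 0 ≤ G + D + H * (1 + |R|) by positivity]
  · refine (norm_sub_le _ _).trans ((add_le_add (norm_sub_le _ _)
      (ContinuousLinearMap.le_opNorm _ _)).trans ?_)
    have h1 : ‖fderivWithin ℝ (fderivWithin ℝ e dom) dom (ext V)‖ * ‖ext U - ext V‖ ≤
        H * ((1 + |R|) * (1 + weight p q ρ l (ext U))) := by
      gcongr; exact hH _ (hR V hV)
    have : 0 ≤ L2 * (1 + weight p q ρ l (ext U)) := by positivity
    rw [hA1]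
    nlinarith [mul_nonneg hD0 hw]
  · obtain ⟨b1, b2⟩ := hballs U V hU hV h
    have tU := hθ _ (ext_mem_dom hU)
    have tV := hθ _ (ext_mem_dom hV.2.2.2)
    have h1 : |theta e (ext U) - theta e (ext V)| ≤ L1 * ‖ext U - ext V‖ := by
      have h2 := ((fderivWithin ℝ e dom (ext U) - fderivWithin ℝ e dom (ext V)).le_opNorm (0, 1))
      have h3 : ‖((0, 1) : Ext × ℝ)‖ = 1 := by simp [Prod.norm_mk]
      rw [h3, mul_one] at h2
      exact h2.trans (hlip _ b2 _ b1)
    have h2 : (theta e (ext U) - theta e (ext V)) * (1 / theta e (ext U) - 1 / theta e (ext V)) =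
        -((theta e (ext U) - theta e (ext V)) ^ 2 / (theta e (ext U) * theta e (ext V))) := by
      have := (hδ.trans_le tU).ne'
      have := (hδ.trans_le tV).ne'
      field_simp; ring
    rw [h2, abs_neg, abs_of_nonneg (div_nonneg (sq_nonneg _)
      (mul_nonneg (hδ.le.trans tU) (hδ.le.trans tV)))]
    calc (theta e (ext U) - theta e (ext V)) ^ 2 / (theta e (ext U) * theta e (ext V))
        ≤ (L1 * ‖ext U - ext V‖) ^ 2 / (δ * δ) := by
          have := hδ.le.trans tU
          rw [← sq_abs (_ - _)]
          gcongr
      _ = L1 * (L1 / δ ^ 2) * ‖ext U - ext V‖ ^ 2 := by field_simp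
      _ ≤ _ := by gcongr; rw [hA2]; linarith [show 0 ≤ (T + D) * (2 / δ) by positivity]
  · have tU := hθ _ (ext_mem_dom hU)
    have tV := hθ _ (ext_mem_dom hV.2.2.2)
    have h1 : |theta e (ext V)| ≤ D := by
      have h2 := (fderivWithin ℝ e dom (ext V)).le_opNorm (0, 1)
      have h3 : ‖((0, 1) : Ext × ℝ)‖ = 1 := by simp [Prod.norm_mk]
      rw [h3, mul_one] at h2
      exact h2.trans hDV
    have h2 : |theta e (ext U) - theta e (ext V)| ≤ (T + D) * (1 + weight p q ρ l (ext U)) := by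
      have := abs_sub (theta e (ext U)) (theta e (ext V))
      have := hT _ (ext_mem_dom hU)
      nlinarith [mul_nonneg hD0 hw]
    have h3 : |1 / theta e (ext U) - 1 / theta e (ext V)| ≤ 2 / δ := by
      have i1 := one_div_le_one_div_of_le hδ tU
      have i2 := one_div_le_one_div_of_le hδ tV
      have i3 : 0 ≤ 1 / theta e (ext U) := one_div_nonneg.2 (hδ.le.trans tU)
      have i4 : 0 ≤ 1 / theta e (ext V) := one_div_nonneg.2 (hδ.le.trans tV)
      have i5 : 2 / δ = 1 / δ + 1 / δ := by ring
      rw [abs_le]; constructor <;> linarith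
    rw [abs_mul]
    calc _ ≤ ((T + D) * (1 + weight p q ρ l (ext U))) * (2 / δ) := by gcongr
      _ = (T + D) * (2 / δ) * (1 + weight p q ρ l (ext U)) := by ring
      _ ≤ _ := by gcongr; rw [hA2]; linarith [show 0 ≤ L1 * (L1 / δ ^ 2) by positivity]
  · obtain ⟨b1, b2⟩ := hballs U V hU hV h
    have h1 := (fderivWithin ℝ e dom (ext U) - fderivWithin ℝ e dom (ext V)).le_opNorm
      (dPhi U.1 i α - dPhi V.1 i α, 0)
    have h2 : ‖((dPhi U.1 i α - dPhi V.1 i α, 0) : Ext × ℝ)‖ ≤ 12 * ‖ext U - ext V‖ := by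
      refine max_le (norm_dPhi_sub_le U V i α) ?_
      simp only [norm_zero]; positivity
    refine h1.trans ?_
    calc _ ≤ (L1 * ‖ext U - ext V‖) * (12 * ‖ext U - ext V‖) := by
          gcongr; exact hlip _ b2 _ b1
      _ = (L1 * 12) * ‖ext U - ext V‖ ^ 2 := by ring
      _ ≤ _ := by
        gcongr; rw [hA3]
        linarith [show 0 ≤ S + G * (1 + 12 * |M| + 6 * |M| ^ 2) + D * (12 * (1 + |R|)) by
          positivity]
  · have hdiff : ((dPhi U.1 i α - dPhi V.1 i α, 0) : Ext × ℝ) =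
        (dPhi U.1 i α, 0) - (dPhi V.1 i α, 0) := by simp
    have e1 : (fderivWithin ℝ e dom (ext U) - fderivWithin ℝ e dom (ext V))
        (dPhi U.1 i α - dPhi V.1 i α, 0) = fderivWithin ℝ e dom (ext U) (dPhi U.1 i α, 0)
        - fderivWithin ℝ e dom (ext U) (dPhi V.1 i α, 0)
        - fderivWithin ℝ e dom (ext V) (dPhi U.1 i α - dPhi V.1 i α, 0) := by
      rw [sub_apply, ← map_sub, ← hdiff]
    rw [e1]
    have h1 := hS U hU i α
    have h2 : |fderivWithin ℝ e dom (ext U) (dPhi V.1 i α, 0)| ≤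
        G * (1 + weight p q ρ l (ext U)) * (1 + 12 * |M| + 6 * |M| ^ 2) := by
      refine ((fderivWithin ℝ e dom (ext U)).le_opNorm _).trans ?_
      gcongr
      have hVM : ‖V.1‖ ≤ |M| := hV.1.trans (le_abs_self M)
      rw [Prod.norm_mk, norm_zero, max_eq_left (norm_nonneg _)]
      refine (norm_dPhi_le V.1 i α).trans ?_
      gcongr
    have h3 : |fderivWithin ℝ e dom (ext V) (dPhi U.1 i α - dPhi V.1 i α, 0)| ≤
        D * (12 * ((1 + |R|) * (1 + weight p q ρ l (ext U)))) := by
      refine ((fderivWithin ℝ e dom (ext V)).le_opNorm _).trans ?_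
      gcongr
      rw [Prod.norm_mk, norm_zero, max_eq_left (norm_nonneg _)]
      exact (norm_dPhi_sub_le U V i α).trans (by gcongr)
    refine (abs_sub _ _).trans ((add_le_add_left (abs_sub _ _) _).trans ?_)
    have : 0 ≤ L1 * 12 * (1 + weight p q ρ l (ext U)) := by positivity
    rw [hA3]
    linarith

end

/-! ### Lipschitz test functions and mollification -/

instance : (volume : Measure (ℝ × E3)).IsAddHaarMeasure :=
  inferInstanceAs ((volume : Measure ℝ).prod (volume : Measure E3)).IsAddHaarMeasure

/-- Lipschitz test functions on `[0, T) × 𝕋³`. -/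
structure IsLipTest (T : ℝ) (ψ : ℝ × E3 → ℝ) : Prop where
  lipschitz : ∃ K, LipschitzWith K ψ
  periodic : ∀ t x i, ψ (t, x + unitVec i) = ψ (t, x)
  support : ∃ b < T, ∀ t x, b ≤ t → ψ (t, x) = 0

open scoped Convolution in
/-- Mollification by a bump function. -/
def mollify (β : ContDiffBump (0 : ℝ × E3)) (ψ : ℝ × E3 → ℝ) : ℝ × E3 → ℝ :=
  (β.normed volume) ⋆[ContinuousLinearMap.lsmul ℝ ℝ, volume] ψ

theorem mollify_apply (β : ContDiffBump (0 : ℝ × E3)) (ψ : ℝ × E3 → ℝ) (z : ℝ × E3) :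
    mollify β ψ z = ∫ h, β.normed volume h * ψ (z - h) := rfl

theorem contDiff_mollify (β : ContDiffBump (0 : ℝ × E3)) {ψ : ℝ × E3 → ℝ}
    (hψ : LocallyIntegrable ψ) : ContDiff ℝ ∞ (mollify β ψ) :=
  β.hasCompactSupport_normed.contDiff_convolution_left _ β.contDiff_normed hψ

theorem integrable_normed (β : ContDiffBump (0 : ℝ × E3)) :
    Integrable (β.normed volume) volume :=
  β.continuous_normed.integrable_of_hasCompactSupport β.hasCompactSupport_normed

theorem abs_mollify_le (β : ContDiffBump (0 : ℝ × E3)) {ψ : ℝ × E3 → ℝ} {c : ℝ}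
    (hψ : ∀ z, |ψ z| ≤ c) (z : ℝ × E3) : |mollify β ψ z| ≤ c := by
  rw [mollify_apply]
  have h := norm_integral_le_of_norm_le (μ := volume) (f := fun h => β.normed volume h * ψ (z - h))
    ((integrable_normed β).mul_const c) (ae_of_all _ fun h => by
      rw [norm_mul, Real.norm_of_nonneg (β.nonneg_normed h)]
      exact mul_le_mul_of_nonneg_left (hψ _) (β.nonneg_normed h))
  rw [integral_mul_const, β.integral_normed, one_mul] at h
  exact h

theorem mollify_eq_zero (β : ContDiffBump (0 : ℝ × E3)) {ψ : ℝ × E3 → ℝ} {z : ℝ × E3}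
    (h : ∀ w, dist w z < β.rOut → ψ w = 0) : mollify β ψ z = 0 := by
  rw [mollify_apply]
  refine integral_eq_zero_of_ae (ae_of_all _ fun w => ?_)
  by_cases hw : w ∈ Metric.ball (0 : ℝ × E3) β.rOut
  · simp [h (z - w) (by simpa [dist_eq_norm] using hw)]
  · rw [← β.support_normed_eq (μ := volume), Function.notMem_support] at hw
    simp [hw]

theorem mollify_periodic (β : ContDiffBump (0 : ℝ × E3)) {ψ : ℝ × E3 → ℝ}
    (h : ∀ t x i, ψ (t, x + unitVec i) = ψ (t, x)) (t : ℝ) (x : E3) (i : Fin 3) :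
    mollify β ψ (t, x + unitVec i) = mollify β ψ (t, x) := by
  simp only [mollify_apply]
  congr 1; ext w
  congr 1
  obtain ⟨s, y⟩ := w
  simp only [Prod.mk_sub_mk]
  rw [← h (t - s) (x - y) i]
  congr 2; abel

/-- Derivatives fall on the mollified function if it is Lipschitz. -/
theorem fderiv_mollify (β : ContDiffBump (0 : ℝ × E3)) {ψ : ℝ × E3 → ℝ} {K : ℝ≥0}
    (hψ : LipschitzWith K ψ) (z v : ℝ × E3) :
    fderiv ℝ (mollify β ψ) z v = mollify β (fun w => lineDeriv ℝ ψ w v) z := by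
  have hd : HasFDerivAt (mollify β ψ) (fderiv ℝ (mollify β ψ) z) z :=
    ((contDiff_mollify β hψ.continuous.locallyIntegrable).differentiable (by simp) z).hasFDerivAt
  have h1 := (hd.hasLineDerivAt v).tendsto_slope_zero_right
  have hf : LipschitzWith K (fun h => ψ (z - h)) := by
    have := hψ.comp ((LipschitzWith.const z).sub LipschitzWith.id)
    rw [zero_add, mul_one] at this
    exact this
  have h2 := hf.integral_inv_smul_sub_mul_tendsto_integral_lineDeriv_mul
    (integrable_normed β) (-v)
  have h3 : ∀ h, lineDeriv ℝ (fun h => ψ (z - h)) h (-v) = lineDeriv ℝ ψ (z - h) v := by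
    intro h
    simp only [lineDeriv]
    congr 1; ext t
    congr 1
    rw [smul_neg]; abel
  simp only [h3] at h2
  refine tendsto_nhds_unique h1 ?_
  rw [mollify_apply]
  convert! h2 using 1
  · ext t
    have hint : ∀ z, Integrable (fun h => β.normed volume h * ψ (z - h)) volume := fun z =>
      (β.continuous_normed.mul (hψ.continuous.comp (by fun_prop))).integrable_of_hasCompactSupport
        β.hasCompactSupport_normed.mul_right
    show t⁻¹ • ((∫ h, β.normed volume h * ψ (z + t • v - h)) - ∫ h, β.normed volume h * ψ (z - h)) =
      _
    rw [← integral_sub (hint _) (hint _), ← integral_smul]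
    congr 1; ext h
    have : z + t • v - h = z - (h + t • -v) := by rw [smul_neg]; abel
    rw [this, smul_eq_mul, smul_eq_mul]; ring
  · exact congrArg 𝓝 (integral_congr_ae (ae_of_all _ fun h => mul_comm _ _))

/-- A sequence of bump functions with shrinking supports. -/
def bumpSeq (n : ℕ) : ContDiffBump (0 : ℝ × E3) where
  rIn := 1 / (2 * (n + 1))
  rOut := 1 / (n + 1)
  rIn_pos := by positivity
  rIn_lt_rOut := by
    apply one_div_lt_one_div_of_lt <;> norm_cast <;> omega

theorem tendsto_bumpSeq_rOut : Tendsto (fun n => (bumpSeq n).rOut) atTop (𝓝 0) :=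
  tendsto_one_div_add_atTop_nhds_zero_nat

theorem ae_tendsto_mollify {g : ℝ × E3 → ℝ} (hg : LocallyIntegrable g) :
    ∀ᵐ z, Tendsto (fun n => mollify (bumpSeq n) g z) atTop (𝓝 (g z)) :=
  ContDiffBump.ae_convolution_tendsto_right_of_locallyIntegrable tendsto_bumpSeq_rOut (K := 2)
    (Eventually.of_forall fun n => by simp only [bumpSeq]; field_simp; exact le_refl _) hg

theorem tendsto_mollify {g : ℝ × E3 → ℝ} (hg : Continuous g) (z : ℝ × E3) :
    Tendsto (fun n => mollify (bumpSeq n) g z) atTop (𝓝 (g z)) :=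
  ContDiffBump.convolution_tendsto_right_of_continuous tendsto_bumpSeq_rOut hg z

theorem abs_fderiv_mollify_le (β : ContDiffBump (0 : ℝ × E3)) {ψ : ℝ × E3 → ℝ} {K : ℝ≥0}
    (hψ : LipschitzWith K ψ) (z v : ℝ × E3) : |fderiv ℝ (mollify β ψ) z v| ≤ K * ‖v‖ := by
  rw [fderiv_mollify β hψ]
  exact abs_mollify_le β (fun w => norm_lineDeriv_le_of_lipschitz ℝ hψ) z

theorem ae_tendsto_fderiv_mollify {ψ : ℝ × E3 → ℝ} {K : ℝ≥0}
    (hψ : LipschitzWith K ψ) (v : ℝ × E3) :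
    ∀ᵐ z, Tendsto (fun n => fderiv ℝ (mollify (bumpSeq n) ψ) z v) atTop (𝓝 (fderiv ℝ ψ z v)) := by
  filter_upwards [ae_tendsto_mollify (hψ.locallyIntegrable_lineDeriv (μ := volume) v),
    hψ.ae_differentiableAt] with z hz hd
  simp only [fderiv_mollify _ hψ]
  rwa [hd.lineDeriv_eq_fderiv] at hz

theorem isTest_mollify {T b : ℝ} {ψ : ℝ × E3 → ℝ} (β : ContDiffBump (0 : ℝ × E3))
    (hψ : Continuous ψ) (hper : ∀ t x i, ψ (t, x + unitVec i) = ψ (t, x))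
    (hb : ∀ t x, b ≤ t → ψ (t, x) = 0) (hβ : β.rOut < T - b) : IsTest T (mollify β ψ) where
  smooth := contDiff_mollify β hψ.locallyIntegrable
  periodic := mollify_periodic β hper
  support := by
    refine ⟨b + β.rOut, by linarith, fun t x ht => mollify_eq_zero β fun w hw => ?_⟩
    refine hb w.1 w.2 ?_
    have : dist w.1 t < β.rOut := (le_max_left _ _).trans_lt hw
    rw [Real.dist_eq] at this
    linarith [(abs_lt.1 this).1]

theorem isInteriorTest_mollify {T a b : ℝ} {ψ : ℝ × E3 → ℝ} (β : ContDiffBump (0 : ℝ × E3))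
    (hψ : Continuous ψ) (hper : ∀ t x i, ψ (t, x + unitVec i) = ψ (t, x))
    (hb : ∀ t x, b ≤ t → ψ (t, x) = 0) (hβ : β.rOut < T - b)
    (ha : ∀ t x, t ≤ a → ψ (t, x) = 0) (hβ' : β.rOut < a) : IsInteriorTest T (mollify β ψ) where
  toIsTest := isTest_mollify β hψ hper hb hβ
  support_left := by
    refine ⟨a - β.rOut, by linarith, fun t x ht => mollify_eq_zero β fun w hw => ?_⟩
    refine ha w.1 w.2 ?_
    have : dist w.1 t < β.rOut := (le_max_left _ _).trans_lt hw
    rw [Real.dist_eq] at this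
    linarith [(abs_lt.1 this).2]

/-! ### Extension of weak formulations to Lipschitz test functions -/

/-- The left-hand side of a scalar balance law `∂_t f + ∂_α g_α = h` with initial value `f₀`,
tested with `φ`. -/
def weakForm (T : ℝ) (f : ℝ × E3 → ℝ) (g : Fin 3 → ℝ × E3 → ℝ) (h : ℝ × E3 → ℝ) (f₀ : E3 → ℝ)
    (φ : ℝ × E3 → ℝ) : ℝ :=
  (∫ z, (dt φ z * f z + ∑ α, dx α φ z * g α z + φ z * h z) ∂(volQ T)) + ∫ x, φ (0, x) * f₀ x ∂volX

theorem norm_dt_dir : ‖((1, 0) : ℝ × E3)‖ = 1 := by simp [Prod.norm_mk]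

theorem norm_dx_dir (α : Fin 3) : ‖((0, unitVec α) : ℝ × E3)‖ = 1 := by simp [Prod.norm_mk]

theorem IsLipTest.bound {T : ℝ} {ψ : ℝ × E3 → ℝ} (hψ : IsLipTest T ψ) :
    ∃ C, ∀ z : ℝ × E3, 0 ≤ z.1 → |ψ z| ≤ C := by
  obtain ⟨K, hK⟩ := hψ.lipschitz
  obtain ⟨b, hb, h0⟩ := hψ.support
  refine ⟨K * |b|, fun z hz => ?_⟩
  rcases le_total b z.1 with h | h
  · rw [h0 z.1 z.2 h]; simp; positivity
  · have h1 := hK.dist_le_mul z (b, z.2)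
    rw [h0 b z.2 le_rfl, Real.dist_eq, sub_zero] at h1
    refine h1.trans ?_
    gcongr
    rw [Prod.dist_eq, dist_self, max_eq_left dist_nonneg, Real.dist_eq]
    rw [abs_of_nonpos (by linarith), abs_of_nonneg (by linarith)]
    linarith

theorem ae_volQ_of_ae {T : ℝ} {P : ℝ × E3 → Prop} (h : ∀ᵐ z, P z) : ∀ᵐ z ∂(volQ T), P z :=
  ae_restrict_of_ae h

theorem measurableSet_cell : MeasurableSet cell := by
  have : cell = ⋂ i : Fin 3, (fun x : E3 => x i) ⁻¹' Ico 0 1 := by ext; simp [cell]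
  rw [this]
  exact MeasurableSet.iInter fun i => (by fun_prop : Measurable fun x : E3 => x i) measurableSet_Ico

theorem measurableSet_cylinder (T : ℝ) : MeasurableSet (cylinder T) :=
  measurableSet_Icc.prod measurableSet_cell

theorem isBounded_cell : Bornology.IsBounded cell := by
  refine (Metric.isBounded_closedBall (x := (0 : E3)) (r := √3)).subset fun x hx => ?_
  rw [mem_closedBall_zero_iff, EuclideanSpace.norm_eq]
  apply Real.sqrt_le_sqrt
  calc ∑ i, ‖x i‖ ^ 2 ≤ ∑ _i : Fin 3, (1 : ℝ) := by
        gcongr with i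
        have := hx i
        rw [Real.norm_of_nonneg this.1]
        nlinarith [this.1, this.2]
    _ = 3 := by simp

instance : IsFiniteMeasure volX := ⟨by
  rw [Measure.restrict_apply_univ]; exact isBounded_cell.measure_lt_top⟩

instance (T : ℝ) : IsFiniteMeasure (volQ T) := ⟨by
  rw [Measure.restrict_apply_univ]
  exact ((Metric.isBounded_Icc 0 T).prod isBounded_cell).measure_lt_top⟩

theorem ae_mem_cylinder (T : ℝ) : ∀ᵐ z ∂(volQ T), z ∈ cylinder T :=
  ae_restrict_mem (measurableSet_cylinder T)

/-- Weak formulations pass to the limit along mollified test functions. -/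
theorem tendsto_weakForm_mollify {T : ℝ} {f : ℝ × E3 → ℝ} {g : Fin 3 → ℝ × E3 → ℝ}
    {h : ℝ × E3 → ℝ} {f₀ : E3 → ℝ} (hf : Integrable f (volQ T))
    (hg : ∀ α, Integrable (g α) (volQ T))
    (hh : Integrable h (volQ T)) (hf₀ : Integrable f₀ volX) {ψ : ℝ × E3 → ℝ}
    (hψ : IsLipTest T ψ) :
    Tendsto (fun n => weakForm T f g h f₀ (mollify (bumpSeq n) ψ)) atTop
      (𝓝 (weakForm T f g h f₀ ψ)) := by
  obtain ⟨K, hK⟩ := hψ.lipschitz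
  have hcont := fun n => (contDiff_mollify (bumpSeq n) hK.continuous.locallyIntegrable)
  obtain ⟨C, hC⟩ := hψ.bound
  -- The mollified functions are bounded on the cylinder, by closeness to the Lipschitz function.
  have hbd : ∀ n, ∀ z : ℝ × E3, 0 ≤ z.1 → |mollify (bumpSeq n) ψ z| ≤ C + K := by
    intro n z hz
    have h1 : dist (mollify (bumpSeq n) ψ z) (ψ z) ≤ K := by
      refine ContDiffBump.dist_normed_convolution_le hK.continuous.aestronglyMeasurable
        fun w hw => ?_
      refine (hK.dist_le_mul w z).trans (mul_le_of_le_one_right K.2 (hw.le.trans ?_))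
      show (1 : ℝ) / (n + 1) ≤ 1
      rw [div_le_one (by positivity)]
      linarith [(Nat.cast_nonneg n : (0 : ℝ) ≤ n)]
    rw [Real.dist_eq] at h1
    have h2 := hC z hz
    have h3 := abs_add_le (mollify (bumpSeq n) ψ z - ψ z) (ψ z)
    rw [sub_add_cancel] at h3
    linarith
  refine Tendsto.add ?_ ?_
  · refine tendsto_integral_of_dominated_convergence
      (fun z => K * |f z| + ∑ α, K * |g α z| + (C + K) * |h z|) (fun n => ?_) ?_ (fun n => ?_) ?_
    · have hfd : Continuous (fderiv ℝ (mollify (bumpSeq n) ψ)) :=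
        (hcont n).continuous_fderiv (by simp)
      have hd : ∀ v, AEStronglyMeasurable (fun z => fderiv ℝ (mollify (bumpSeq n) ψ) z v)
          (volQ T) := fun v => (hfd.clm_apply continuous_const).aestronglyMeasurable
      refine ((((hd _).mul hf.1)).add (Finset.aestronglyMeasurable_fun_sum _
        fun α _ => (hd _).mul (hg α).1)).add ((hcont n).continuous.aestronglyMeasurable.mul hh.1)
    · exact ((hf.abs.const_mul _).add (integrable_finsetSum _
        fun α _ => (hg α).abs.const_mul _)).add (hh.abs.const_mul _)
    · filter_upwards [ae_mem_cylinder T] with z hz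
      rw [Real.norm_eq_abs]
      refine (abs_add_le _ _).trans (add_le_add ((abs_add_le _ _).trans (add_le_add ?_
        ((Finset.abs_sum_le_sum_abs _ _).trans (Finset.sum_le_sum fun α _ => ?_)))) ?_)
      · rw [abs_mul]
        gcongr
        have := abs_fderiv_mollify_le (bumpSeq n) hK z (1, 0)
        rwa [norm_dt_dir, mul_one] at this
      · rw [abs_mul]
        gcongr
        have := abs_fderiv_mollify_le (bumpSeq n) hK z (0, unitVec α)
        rwa [norm_dx_dir, mul_one] at this
      · rw [abs_mul]
        gcongr
        exact hbd n z hz.1.1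
    · have h1 := ae_volQ_of_ae (T := T) (ae_tendsto_fderiv_mollify hK (1, 0))
      have h2 : ∀ᵐ z ∂(volQ T), ∀ α, Tendsto (fun n => dx α (mollify (bumpSeq n) ψ) z) atTop
          (𝓝 (dx α ψ z)) :=
        ae_all_iff.2 fun α => ae_volQ_of_ae (ae_tendsto_fderiv_mollify hK (0, unitVec α))
      filter_upwards [h1, h2] with z h1 h2
      exact ((h1.mul_const _).add (tendsto_finsetSum _ fun α _ => (h2 α).mul_const _)).add
        ((tendsto_mollify hK.continuous z).mul_const _)
  · refine tendsto_integral_of_dominated_convergence (fun x => (C + K) * |f₀ x|) (fun n => ?_)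
      (hf₀.abs.const_mul _) (fun n => ?_) ?_
    · exact ((hcont n).continuous.comp (by fun_prop : Continuous fun x : E3 =>
        ((0 : ℝ), x))).aestronglyMeasurable.mul hf₀.1
    · refine ae_of_all _ fun x => ?_
      rw [norm_mul, Real.norm_eq_abs, Real.norm_eq_abs]
      gcongr
      exact hbd n _ le_rfl
    · exact ae_of_all _ fun x => (tendsto_mollify hK.continuous _).mul_const _

/-- A weak formulation that holds for smooth test functions holds for Lipschitz ones. -/
theorem weakForm_eq_zero {T : ℝ} {f : ℝ × E3 → ℝ} {g : Fin 3 → ℝ × E3 → ℝ}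
    {h : ℝ × E3 → ℝ} {f₀ : E3 → ℝ} (hf : Integrable f (volQ T))
    (hg : ∀ α, Integrable (g α) (volQ T))
    (hh : Integrable h (volQ T)) (hf₀ : Integrable f₀ volX)
    (H : ∀ φ, IsTest T φ → weakForm T f g h f₀ φ = 0) {ψ : ℝ × E3 → ℝ} (hψ : IsLipTest T ψ) :
    weakForm T f g h f₀ ψ = 0 := by
  refine tendsto_nhds_unique (tendsto_weakForm_mollify hf hg hh hf₀ hψ) ?_
  obtain ⟨K, hK⟩ := hψ.lipschitz
  obtain ⟨b, hb, h0⟩ := hψ.support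
  refine tendsto_const_nhds.congr' ?_
  filter_upwards [tendsto_bumpSeq_rOut.eventually_lt_const (sub_pos.2 hb)] with n hn
  exact (H _ (isTest_mollify _ hK.continuous hψ.periodic h0 hn)).symm

/-- A weak formulation that holds for smooth test functions in the interior holds for Lipschitz
ones. -/
theorem weakForm_eq_zero_of_interior {T : ℝ} {f : ℝ × E3 → ℝ} {g : Fin 3 → ℝ × E3 → ℝ}
    {h : ℝ × E3 → ℝ} {f₀ : E3 → ℝ} (hf : Integrable f (volQ T))
    (hg : ∀ α, Integrable (g α) (volQ T))
    (hh : Integrable h (volQ T)) (hf₀ : Integrable f₀ volX)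
    (H : ∀ φ, IsInteriorTest T φ → weakForm T f g h f₀ φ = 0) {ψ : ℝ × E3 → ℝ}
    (hψ : IsLipTest T ψ) {a : ℝ} (ha : 0 < a) (hψa : ∀ t x, t ≤ a → ψ (t, x) = 0) :
    weakForm T f g h f₀ ψ = 0 := by
  refine tendsto_nhds_unique (tendsto_weakForm_mollify hf hg hh hf₀ hψ) ?_
  obtain ⟨K, hK⟩ := hψ.lipschitz
  obtain ⟨b, hb, h0⟩ := hψ.support
  refine tendsto_const_nhds.congr' ?_
  filter_upwards [tendsto_bumpSeq_rOut.eventually_lt_const (sub_pos.2 hb),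
    tendsto_bumpSeq_rOut.eventually_lt_const ha] with n hn hn'
  exact (H _ (isInteriorTest_mollify _ hK.continuous hψ.periodic h0 hn hψa hn')).symm

/-! ### Integration by parts on the cylinder -/

theorem volQ_eq_prod (T : ℝ) : volQ T = (volume.restrict (Icc 0 T)).prod volX :=
  (Measure.prod_restrict _ _).symm

/-- A periodic `C¹` function on the torus has derivatives with vanishing integral. -/
theorem integral_cell_fderiv_eq_zero {u : E3 → ℝ} (hu : ContDiff ℝ 1 u)
    (hper : ∀ x i, u (x + unitVec i) = u x) (α : Fin 3) :
    ∫ x, fderiv ℝ u x (unitVec α) ∂volX = 0 := by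
  have hpre : (WithLp.toLp 2 : (Fin 3 → ℝ) → E3) ⁻¹' cell = pi univ fun _ => Ico (0 : ℝ) 1 := by
    ext x; simp [cell]
  have hmp := PiLp.volume_preserving_toLp (Fin 3)
  have hme : MeasurableEmbedding (WithLp.toLp 2 : (Fin 3 → ℝ) → E3) :=
    (MeasurableEquiv.toLp 2 (Fin 3 → ℝ)).measurableEmbedding
  rw [← hmp.setIntegral_preimage_emb hme, hpre, volume_pi,
    setIntegral_congr_set (Measure.univ_pi_Ico_ae_eq_Icc (f := fun _ => (0 : ℝ))
      (g := fun _ => (1 : ℝ))), ← volume_pi]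
  set L : (Fin 3 → ℝ) →L[ℝ] E3 := (EuclideanSpace.equiv (Fin 3) ℝ).symm.toContinuousLinearMap
  have hL : ∀ x, L x = WithLp.toLp 2 x := fun x => rfl
  have hLs : ∀ i, L (Pi.single i 1) = unitVec i := fun i => by rw [hL]; simp
  have hd : ∀ x, HasFDerivAt (fun x => u (L x)) ((fderiv ℝ u (L x)).comp L) x := fun x =>
    ((hu.differentiable one_ne_zero (L x)).hasFDerivAt).comp x L.hasFDerivAt
  have hcont : Continuous fun x => fderiv ℝ u (L x) (unitVec α) :=
    ((hu.continuous_fderiv one_ne_zero).comp L.continuous).clm_apply continuous_const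
  have hsum : ∀ x, (∑ i, (if i = α then (fderiv ℝ u (L x)).comp L else 0) (Pi.single i 1)) =
      fderiv ℝ u (L x) (unitVec α) := by
    intro x
    rw [Finset.sum_eq_single α]
    · simp [hLs]
    · intro i _ hi; simp [hi]
    · simp
  have key := integral_divergence_of_hasFDerivAt_off_countable' (n := 2) (a := 0) (b := 1)
    (zero_le_one) (fun i x => if i = α then u (L x) else 0)
    (fun i x => if i = α then (fderiv ℝ u (L x)).comp L else 0) ∅ countable_empty
    (fun i => by
      split_ifs
      · exact (hu.continuous.comp L.continuous).continuousOn
      · exact continuousOn_const)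
    (fun x _ i => by
      split_ifs
      · exact hd x
      · exact hasFDerivAt_const _ _)
    (by
      simp only [hsum]
      exact hcont.continuousOn.integrableOn_compact isCompact_Icc)
  simp only [hsum] at key
  refine Eq.trans key ?_
  refine Finset.sum_eq_zero fun i _ => sub_eq_zero.2 ?_
  refine setIntegral_congr_fun measurableSet_Icc fun x _ => ?_
  by_cases hi : i = α
  · have hins : (i.insertNth ((1 : Fin 3 → ℝ) i) x : Fin 3 → ℝ) =
        i.insertNth ((0 : Fin 3 → ℝ) i) x + Pi.single i 1 := by
      ext j
      refine Fin.succAboveCases i ?_ (fun k => ?_) j <;> simp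
    simp only [hi, if_true] at hins ⊢
    rw [hins, map_add, hLs, hper]
  · simp [hi]

theorem integrable_volQ_of_continuous {V : Type*} [NormedAddCommGroup V] {f : ℝ × E3 → V}
    (hf : Continuous f) (T : ℝ) : Integrable f (volQ T) :=
  ((hf.continuousOn.integrableOn_compact
    (((Metric.isBounded_Icc 0 T).prod isBounded_cell).closure.isCompact_closure)).mono_set
    (subset_closure.trans subset_closure))

theorem integrable_volX_of_continuous {V : Type*} [NormedAddCommGroup V] {f : E3 → V}
    (hf : Continuous f) : Integrable f volX :=
  (hf.continuousOn.integrableOn_compact isBounded_cell.isCompact_closure).mono_set subset_closure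

theorem IsTest.integral_dx {T : ℝ} {φ : ℝ × E3 → ℝ} (hφ : IsTest T φ) (α : Fin 3) :
    ∫ z, dx α φ z ∂(volQ T) = 0 := by
  have hcont : Continuous (dx α φ) :=
    (hφ.smooth.continuous_fderiv (by simp)).clm_apply continuous_const
  have hint := integrable_volQ_of_continuous hcont T
  rw [volQ_eq_prod] at hint ⊢
  rw [integral_prod _ hint]
  refine integral_eq_zero_of_ae (ae_of_all _ fun t => ?_)
  have hd : ∀ x, dx α φ (t, x) = fderiv ℝ (fun x => φ (t, x)) x (unitVec α) := by
    intro x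
    have h1 : HasFDerivAt φ (fderiv ℝ φ (t, x)) (t, x) :=
      (hφ.smooth.differentiable (by simp) _).hasFDerivAt
    have h2 := h1.comp x (hasFDerivAt_prodMk_right t x)
    rw [show fderiv ℝ (fun x => φ (t, x)) x = _ from h2.fderiv]
    simp [dx]
  simp only [hd]
  exact integral_cell_fderiv_eq_zero ((hφ.smooth.comp (by fun_prop)).of_le (by simp))
    (fun x i => hφ.periodic t x i) α

theorem IsTest.integral_dt {T : ℝ} (hT : 0 < T) {φ : ℝ × E3 → ℝ} (hφ : IsTest T φ) :
    ∫ z, dt φ z ∂(volQ T) = -∫ x, φ (0, x) ∂volX := by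
  have hcont : Continuous (dt φ) :=
    (hφ.smooth.continuous_fderiv (by simp)).clm_apply continuous_const
  have hint := integrable_volQ_of_continuous hcont T
  rw [volQ_eq_prod] at hint ⊢
  rw [integral_prod_symm _ hint, ← integral_neg]
  refine integral_congr_ae (ae_of_all _ fun x => ?_)
  have hd : ∀ t, HasDerivAt (fun t => φ (t, x)) (dt φ (t, x)) t := by
    intro t
    have h1 : HasFDerivAt φ (fderiv ℝ φ (t, x)) (t, x) :=
      (hφ.smooth.differentiable (by simp) _).hasFDerivAt
    exact h1.comp_hasDerivAt t ((hasDerivAt_id t).prodMk (hasDerivAt_const t x))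
  obtain ⟨b, hb, h0⟩ := hφ.support
  show ∫ t in Icc 0 T, dt φ (t, x) = -φ (0, x)
  rw [integral_Icc_eq_integral_Ioc, ← intervalIntegral.integral_of_le hT.le,
    intervalIntegral.integral_eq_sub_of_hasDerivAt (fun t _ => hd t)
      ((hcont.comp (by fun_prop)).intervalIntegrable _ _), h0 T x hb.le]
  simp

theorem IsLipTest.integral_dx {T : ℝ} {ψ : ℝ × E3 → ℝ} (hψ : IsLipTest T ψ) (α : Fin 3) :
    ∫ z, dx α ψ z ∂(volQ T) = 0 := by
  have h := weakForm_eq_zero (T := T) (f := 0) (g := fun β _ => if β = α then 1 else 0) (h := 0)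
    (f₀ := 0) (integrable_zero _ _ _) (fun _ => integrable_const _) (integrable_zero _ _ _)
    (integrable_zero _ _ _) (fun φ hφ => by simpa [weakForm] using hφ.integral_dx α) hψ
  simpa [weakForm] using h

theorem IsLipTest.integral_dt {T : ℝ} (hT : 0 < T) {ψ : ℝ × E3 → ℝ} (hψ : IsLipTest T ψ) :
    ∫ z, dt ψ z ∂(volQ T) = -∫ x, ψ (0, x) ∂volX := by
  have h := weakForm_eq_zero (T := T) (f := 1) (g := 0) (h := 0)
    (f₀ := 1) (integrable_const _) (fun _ => integrable_zero _ _ _) (integrable_zero _ _ _)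
    (integrable_const _) (fun φ hφ => by simp [weakForm, hφ.integral_dt hT]) hψ
  simp only [weakForm, Pi.one_apply, Pi.zero_apply, mul_one, mul_zero, Finset.sum_const_zero,
    add_zero] at h
  linarith

/-! ### Lipschitz coefficients -/

/-- Projection of space-time onto `[0, T] × ℝ³`. -/
def clamp (T : ℝ) (z : ℝ × E3) : ℝ × E3 := (max 0 (min z.1 T), z.2)

theorem lipschitzWith_clamp (T : ℝ) : LipschitzWith 1 (clamp T) := by
  have h1 : LipschitzWith 1 (fun z : ℝ × E3 => max 0 (min z.1 T)) :=
    (LipschitzWith.prod_fst.min_const T).const_max 0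
  have h2 := h1.prodMk LipschitzWith.prod_snd
  rwa [max_self] at h2

theorem clamp_eq_self {T : ℝ} {z : ℝ × E3} (hz : z.1 ∈ Icc 0 T) : clamp T z = z := by
  simp [clamp, hz.1, hz.2]

theorem clamp_fst_mem {T : ℝ} (hT : 0 ≤ T) (z : ℝ × E3) : (clamp T z).1 ∈ Icc 0 T :=
  ⟨le_max_left _ _, max_le hT (min_le_right _ _)⟩

theorem clamp_eventuallyEq {T : ℝ} {z : ℝ × E3} (hz : z.1 ∈ Ioo 0 T) :
    ∀ᶠ w in 𝓝 z, clamp T w = w := by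
  have : ∀ᶠ w : ℝ × E3 in 𝓝 z, w.1 ∈ Ioo 0 T :=
    continuous_fst.continuousAt.eventually (isOpen_Ioo.mem_nhds hz)
  filter_upwards [this] with w hw using clamp_eq_self (Ioo_subset_Icc_self hw)

theorem ae_mem_Ioo (T : ℝ) : ∀ᵐ z ∂(volQ T), z.1 ∈ Ioo 0 T := by
  rw [volQ_eq_prod]
  have h : ∀ᵐ t ∂(volume.restrict (Icc 0 T)), t ∈ Ioo 0 T := by
    rw [← restrict_Ioo_eq_restrict_Icc]
    exact ae_restrict_mem measurableSet_Ioo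
  exact Measure.quasiMeasurePreserving_fst.ae h

/-- Bounded Lipschitz functions on space-time that are periodic in space. -/
structure IsCoeff (f : ℝ × E3 → ℝ) : Prop where
  lipschitz : ∃ K, LipschitzWith K f
  bound : ∃ C, 0 ≤ C ∧ ∀ z, |f z| ≤ C
  periodic : ∀ t x i, f (t, x + unitVec i) = f (t, x)

namespace IsCoeff
variable {f g : ℝ × E3 → ℝ}

theorem continuous (hf : IsCoeff f) : Continuous f := by
  obtain ⟨K, hK⟩ := hf.lipschitz
  exact hK.continuous

theorem const (c : ℝ) : IsCoeff fun _ => c :=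
  ⟨⟨0, LipschitzWith.const c⟩, ⟨|c|, abs_nonneg c, fun _ => le_rfl⟩, fun _ _ _ => rfl⟩

theorem add (hf : IsCoeff f) (hg : IsCoeff g) : IsCoeff fun z => f z + g z := by
  obtain ⟨K, hK⟩ := hf.lipschitz
  obtain ⟨L, hL⟩ := hg.lipschitz
  obtain ⟨C, hC0, hC⟩ := hf.bound
  obtain ⟨D, hD0, hD⟩ := hg.bound
  refine ⟨⟨K + L, hK.add hL⟩, ⟨C + D, by positivity, fun z => ?_⟩, fun t x i => ?_⟩
  · exact (abs_add_le _ _).trans (add_le_add (hC z) (hD z))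
  · rw [hf.periodic, hg.periodic]

theorem mul (hf : IsCoeff f) (hg : IsCoeff g) : IsCoeff fun z => f z * g z := by
  obtain ⟨K, hK⟩ := hf.lipschitz
  obtain ⟨L, hL⟩ := hg.lipschitz
  obtain ⟨C, hC0, hC⟩ := hf.bound
  obtain ⟨D, hD0, hD⟩ := hg.bound
  refine ⟨⟨⟨C * L + D * K, by positivity⟩, LipschitzWith.of_dist_le_mul fun z w => ?_⟩,
    ⟨C * D, by positivity, fun z => ?_⟩, fun t x i => ?_⟩
  · have h1 := hK.dist_le_mul z w
    have h2 := hL.dist_le_mul z w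
    rw [Real.dist_eq] at h1 h2 ⊢
    have h3 : f z * g z - f w * g w = f z * (g z - g w) + g w * (f z - f w) := by ring
    rw [h3]
    refine (abs_add_le _ _).trans ?_
    rw [abs_mul, abs_mul]
    calc _ ≤ C * (L * dist z w) + D * (K * dist z w) := by
          gcongr
          · exact hC z
          · exact hD w
      _ = (C * L + D * K) * dist z w := by ring
  · rw [abs_mul]
    exact mul_le_mul (hC z) (hD z) (abs_nonneg _) hC0
  · rw [hf.periodic, hg.periodic]

theorem neg (hf : IsCoeff f) : IsCoeff fun z => -f z := by
  simpa using (const (-1)).mul hf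

theorem sub (hf : IsCoeff f) (hg : IsCoeff g) : IsCoeff fun z => f z - g z := by
  simpa [sub_eq_add_neg] using hf.add hg.neg

theorem sum {ι : Type*} (s : Finset ι) {f : ι → ℝ × E3 → ℝ} (hf : ∀ i ∈ s, IsCoeff (f i)) :
    IsCoeff fun z => ∑ i ∈ s, f i z := by
  classical
  induction s using Finset.induction_on with
  | empty => simpa using const 0
  | insert a s ha ih =>
    simp only [Finset.sum_insert ha]
    exact (hf a (Finset.mem_insert_self _ _)).add
      (ih fun i hi => hf i (Finset.mem_insert_of_mem hi))

theorem isLipTest {T : ℝ} (hf : IsCoeff f) (h : ∃ b < T, ∀ t x, b ≤ t → f (t, x) = 0) :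
    IsLipTest T f := ⟨hf.lipschitz, hf.periodic, h⟩

theorem ae_differentiableAt (hf : IsCoeff f) : ∀ᵐ z, DifferentiableAt ℝ f z := by
  obtain ⟨K, hK⟩ := hf.lipschitz
  exact hK.ae_differentiableAt

theorem exists_abs_fderiv_le (hf : IsCoeff f) : ∃ C, 0 ≤ C ∧ ∀ z, ‖fderiv ℝ f z‖ ≤ C := by
  obtain ⟨K, hK⟩ := hf.lipschitz
  exact ⟨K, K.2, fun z => norm_fderiv_le_of_lipschitz ℝ hK⟩

theorem measurable_fderiv (v : ℝ × E3) : Measurable fun z => fderiv ℝ f z v :=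
  measurable_fderiv_apply_const ℝ f v

theorem integrable_fderiv (hf : IsCoeff f) (T : ℝ) (v : ℝ × E3) :
    Integrable (fun z => fderiv ℝ f z v) (volQ T) := by
  obtain ⟨C, hC0, hC⟩ := hf.exists_abs_fderiv_le
  refine Integrable.of_bound (measurable_fderiv v).aestronglyMeasurable (C * ‖v‖)
    (ae_of_all _ fun z => ?_)
  exact ((fderiv ℝ f z).le_opNorm v).trans (by gcongr; exact hC z)

end IsCoeff

theorem exists_mem_cell_of_periodic {V : Type*} {u : E3 → V}
    (hu : ∀ x i, u (x + unitVec i) = u x) (x : E3) : ∃ y ∈ cell, u x = u y := by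
  have hp : ∀ i, Function.Periodic u (unitVec i) := fun i x => hu x i
  refine ⟨x - ⌊x 0⌋ • unitVec 0 - ⌊x 1⌋ • unitVec 1 - ⌊x 2⌋ • unitVec 2, fun i => ?_, ?_⟩
  · have h : (x - ⌊x 0⌋ • unitVec 0 - ⌊x 1⌋ • unitVec 1 - ⌊x 2⌋ • unitVec 2 : E3) i =
        Int.fract (x i) := by
      fin_cases i <;> simp
    rw [h]
    exact ⟨Int.fract_nonneg _, Int.fract_lt_one _⟩
  · rw [(hp 2).sub_zsmul_eq, (hp 1).sub_zsmul_eq, (hp 0).sub_zsmul_eq]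

theorem exists_bound_of_periodic {V : Type*} [NormedAddCommGroup V] {u : ℝ × E3 → V}
    (hu : Continuous u) (hper : ∀ t x i, u (t, x + unitVec i) = u (t, x)) (T : ℝ) :
    ∃ C, 0 ≤ C ∧ ∀ z : ℝ × E3, z.1 ∈ Icc 0 T → ‖u z‖ ≤ C := by
  obtain ⟨C, hC⟩ := ((isCompact_Icc (a := (0 : ℝ)) (b := T)).prod
    isBounded_cell.isCompact_closure).exists_bound_of_continuousOn hu.continuousOn
  refine ⟨max C 0, le_max_right _ _, fun z hz => ?_⟩
  obtain ⟨y, hy, h⟩ := exists_mem_cell_of_periodic (u := fun x => u (z.1, x)) (hper z.1) z.2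
  have h' : u z = u (z.1, y) := h
  rw [h']
  exact (hC (z.1, y) ⟨hz, subset_closure hy⟩).trans (le_max_left _ _)

theorem fderiv_periodic {V : Type*} [NormedAddCommGroup V] [NormedSpace ℝ V] {u : ℝ × E3 → V}
    (hper : ∀ t x i, u (t, x + unitVec i) = u (t, x)) (t : ℝ) (x : E3) (i : Fin 3) :
    fderiv ℝ u (t, x + unitVec i) = fderiv ℝ u (t, x) := by
  have h : (fun z => u (z + (0, unitVec i))) = u := by
    ext ⟨s, y⟩; simpa using hper s y i
  conv_rhs => rw [← h]
  rw [fderiv_comp_add_right]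
  simp

/-- A smooth periodic function on space-time becomes an admissible coefficient when it is frozen in
time outside `[0, T]`. -/
theorem isCoeff_clamp {T : ℝ} (hT : 0 ≤ T) {u : ℝ × E3 → ℝ} (hu : ContDiff ℝ 1 u)
    (hper : ∀ t x i, u (t, x + unitVec i) = u (t, x)) : IsCoeff fun z => u (clamp T z) := by
  obtain ⟨C, hC0, hC⟩ := exists_bound_of_periodic hu.continuous hper T
  obtain ⟨D, hD0, hD⟩ := exists_bound_of_periodic (hu.continuous_fderiv one_ne_zero)
    (fderiv_periodic hper) T
  refine ⟨⟨⟨D, hD0⟩, ?_⟩, ⟨C, hC0, fun z => hC _ (clamp_fst_mem hT z)⟩, fun t x i => ?_⟩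
  · have hconv : Convex ℝ (Icc (0 : ℝ) T ×ˢ (univ : Set E3)) := (convex_Icc 0 T).prod convex_univ
    have h : LipschitzOnWith ⟨D, hD0⟩ u (Icc (0 : ℝ) T ×ˢ univ) :=
      hconv.lipschitzOnWith_of_nnnorm_fderiv_le
        (fun z _ => hu.differentiable one_ne_zero z) (fun z hz => hD z hz.1)
    refine LipschitzWith.of_dist_le_mul fun z w => ?_
    refine (h.dist_le_mul _ ⟨clamp_fst_mem hT z, mem_univ _⟩ _
      ⟨clamp_fst_mem hT w, mem_univ _⟩).trans ?_
    gcongr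
    simpa using (lipschitzWith_clamp T).dist_le_mul z w
  · exact hper _ x i

theorem IsTest.isCoeff {T : ℝ} (hT : 0 ≤ T) {φ : ℝ × E3 → ℝ} (hφ : IsTest T φ) :
    IsCoeff fun z => φ (clamp T z) := isCoeff_clamp hT (hφ.smooth.of_le (by simp)) hφ.periodic

/-- The product of a smooth test function and a Lipschitz coefficient. -/
theorem IsTest.isLipTest_mul {T : ℝ} (hT : 0 ≤ T) {φ f : ℝ × E3 → ℝ} (hφ : IsTest T φ)
    (hf : IsCoeff f) : IsLipTest T fun z => φ (clamp T z) * f z := by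
  refine ((hφ.isCoeff hT).mul hf).isLipTest ?_
  obtain ⟨b, hb, h0⟩ := hφ.support
  refine ⟨b, hb, fun t x ht => ?_⟩
  simp only [clamp]
  rw [h0 _ _ ((le_min ht hb.le).trans (le_max_right _ _)), zero_mul]

theorem fderiv_clamp_mul {T : ℝ} {φ f : ℝ × E3 → ℝ} (hφ : ContDiff ℝ ∞ φ) {z : ℝ × E3}
    (hz : z.1 ∈ Ioo 0 T) (hf : DifferentiableAt ℝ f z) (v : ℝ × E3) :
    fderiv ℝ (fun z => φ (clamp T z) * f z) z v = fderiv ℝ φ z v * f z + φ z * fderiv ℝ f z v := by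
  have h : (fun z => φ (clamp T z) * f z) =ᶠ[𝓝 z] fun z => φ z * f z := by
    filter_upwards [clamp_eventuallyEq hz] with w hw
    rw [hw]
  rw [h.fderiv_eq, fderiv_fun_mul (hφ.differentiable (by simp) z) hf]
  simp; ring

theorem IsTest.integral_dx_mul {T : ℝ} (hT : 0 ≤ T) {φ f : ℝ × E3 → ℝ} (hφ : IsTest T φ)
    (hf : IsCoeff f) (α : Fin 3) :
    ∫ z, (dx α φ z * f z + φ z * dx α f z) ∂(volQ T) = 0 := by
  rw [← (hφ.isLipTest_mul hT hf).integral_dx α]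
  refine integral_congr_ae ?_
  filter_upwards [ae_mem_Ioo T, ae_volQ_of_ae hf.ae_differentiableAt] with z hz hd
  exact (fderiv_clamp_mul hφ.smooth hz hd _).symm

theorem clamp_zero {T : ℝ} (hT : 0 ≤ T) (x : E3) : clamp T (0, x) = (0, x) :=
  clamp_eq_self (z := (0, x)) ⟨le_rfl, hT⟩

theorem IsTest.integral_dt_mul {T : ℝ} (hT : 0 < T) {φ f : ℝ × E3 → ℝ} (hφ : IsTest T φ)
    (hf : IsCoeff f) :
    ∫ z, (dt φ z * f z + φ z * dt f z) ∂(volQ T) = -∫ x, φ (0, x) * f (0, x) ∂volX := by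
  have h := (hφ.isLipTest_mul hT.le hf).integral_dt hT
  simp only [clamp_zero hT.le] at h
  rw [← h]
  refine integral_congr_ae ?_
  filter_upwards [ae_mem_Ioo T, ae_volQ_of_ae hf.ae_differentiableAt] with z hz hd
  exact (fderiv_clamp_mul hφ.smooth hz hd _).symm

theorem weakForm_clamp_mul {T : ℝ} (hT : 0 ≤ T) {φ f : ℝ × E3 → ℝ} (hφ : ContDiff ℝ ∞ φ)
    (hf : IsCoeff f) (a : ℝ × E3 → ℝ) (g : Fin 3 → ℝ × E3 → ℝ) (h : ℝ × E3 → ℝ) (a₀ : E3 → ℝ) :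
    weakForm T a g h a₀ (fun z => φ (clamp T z) * f z) =
      (∫ z, ((dt φ z * f z + φ z * dt f z) * a z +
        ∑ α, (dx α φ z * f z + φ z * dx α f z) * g α z + φ z * f z * h z) ∂(volQ T)) +
        ∫ x, φ (0, x) * f (0, x) * a₀ x ∂volX := by
  simp only [weakForm, clamp_zero hT]
  congr 1
  refine integral_congr_ae ?_
  filter_upwards [ae_mem_Ioo T, ae_volQ_of_ae hf.ae_differentiableAt] with z hz hd
  simp only [dt, dx, fderiv_clamp_mul hφ hz hd, clamp_eq_self (Ioo_subset_Icc_self hz)]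

/-- A weak formulation can be tested with products of smooth test functions and Lipschitz
coefficients. -/
theorem IsTest.weakForm_mul {T : ℝ} (hT : 0 ≤ T) {a : ℝ × E3 → ℝ} {g : Fin 3 → ℝ × E3 → ℝ}
    {h : ℝ × E3 → ℝ} {a₀ : E3 → ℝ} (ha : Integrable a (volQ T))
    (hg : ∀ α, Integrable (g α) (volQ T))
    (hh : Integrable h (volQ T)) (ha₀ : Integrable a₀ volX)
    (H : ∀ φ, IsTest T φ → weakForm T a g h a₀ φ = 0) {φ f : ℝ × E3 → ℝ} (hφ : IsTest T φ)
    (hf : IsCoeff f) :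
    (∫ z, ((dt φ z * f z + φ z * dt f z) * a z +
        ∑ α, (dx α φ z * f z + φ z * dx α f z) * g α z + φ z * f z * h z) ∂(volQ T)) +
        ∫ x, φ (0, x) * f (0, x) * a₀ x ∂volX = 0 := by
  rw [← weakForm_clamp_mul hT hφ.smooth hf]
  exact weakForm_eq_zero ha hg hh ha₀ H (hφ.isLipTest_mul hT hf)

/-! ### Extension of the Lipschitz solution in time and chain rules -/

/-- The differential form of the equations for a Lipschitz solution that has been extended to all
times; the equations are written in terms of the derivative of the state. -/
structure IsStrongSolution (e : Ext × ℝ → ℝ) (r : ℝ × E3 → ℝ) (T M : ℝ)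
    (W : ℝ × E3 → State) : Prop where
  lipschitz : ∃ K, LipschitzWith K W
  periodic : ∀ t x i, W (t, x + unitVec i) = W (t, x)
  mem_Gam : ∀ z, W z ∈ Gam M
  eq_F : ∀ᵐ z ∂(volQ T), ∀ i α, (fderiv ℝ W z (1, 0)).1 (i, α) =
    (fderiv ℝ W z (0, unitVec α)).2.1 i
  eq_entropy : ∀ᵐ z ∂(volQ T), (fderiv ℝ W z (1, 0)).2.2 = r z / theta e (ext (W z))
  eq_velocity : ∀ᵐ z ∂(volQ T), ∀ i, (fderiv ℝ W z (1, 0)).2.1 i =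
    ∑ α, dx α (fun y => fderivWithin ℝ e dom (ext (W y)) (dPhi (W y).1 i α, 0)) z

theorem fderiv_comp_clm {V V' : Type*} [NormedAddCommGroup V] [NormedSpace ℝ V]
    [NormedAddCommGroup V'] [NormedSpace ℝ V'] {W : ℝ × E3 → V} {z : ℝ × E3}
    (hW : DifferentiableAt ℝ W z) (L : V →L[ℝ] V') (v : ℝ × E3) :
    fderiv ℝ (fun y => L (W y)) z v = L (fderiv ℝ W z v) := by
  rw [show fderiv ℝ (fun y => L (W y)) z = _ from
    (L.hasFDerivAt.comp z hW.hasFDerivAt).fderiv]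
  rfl

/-- Projection of a state to an entry of the deformation gradient. -/
def projF (k : Fin 3 × Fin 3) : State →L[ℝ] ℝ :=
  (EuclideanSpace.proj k : Mat3 →L[ℝ] ℝ).comp (ContinuousLinearMap.fst ℝ Mat3 (E3 × ℝ))

/-- Projection of a state to a component of the velocity. -/
def projV (i : Fin 3) : State →L[ℝ] ℝ :=
  (EuclideanSpace.proj i : E3 →L[ℝ] ℝ).comp
    ((ContinuousLinearMap.fst ℝ E3 ℝ).comp (ContinuousLinearMap.snd ℝ Mat3 (E3 × ℝ)))

/-- Projection of a state to the entropy. -/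
def projEta : State →L[ℝ] ℝ :=
  (ContinuousLinearMap.snd ℝ E3 ℝ).comp (ContinuousLinearMap.snd ℝ Mat3 (E3 × ℝ))

/-- A Lipschitz solution, frozen at its initial and final values outside `[0, T]`, is globally
Lipschitz and satisfies the equations in differential form on the cylinder. -/
theorem IsLipschitzSolution.isStrongSolution {e : Ext × ℝ → ℝ} {r : ℝ × E3 → ℝ} {T M : ℝ}
    (hT : 0 ≤ T) {Ubar : ℝ × E3 → State} (h : IsLipschitzSolution e r T M Ubar) :
    IsStrongSolution e r T M fun z => Ubar (clamp T z) := by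
  obtain ⟨K, hK⟩ := h.lipschitz
  have hlip : LipschitzWith K fun z => Ubar (clamp T z) := by
    refine LipschitzWith.of_dist_le_mul fun z w => ?_
    refine (hK.dist_le_mul _ ⟨clamp_fst_mem hT z, mem_univ _⟩ _
      ⟨clamp_fst_mem hT w, mem_univ _⟩).trans ?_
    gcongr
    simpa using (lipschitzWith_clamp T).dist_le_mul z w
  have hdiff := ae_volQ_of_ae (T := T) hlip.ae_differentiableAt
  -- In the interior, the extended function has the same derivatives.
  have hcongr : ∀ {V : Type} [NormedAddCommGroup V] [NormedSpace ℝ V] (f : State → V)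
      {z : ℝ × E3}, z.1 ∈ Ioo 0 T →
      fderiv ℝ (fun y => f (Ubar y)) z = fderiv ℝ (fun y => f (Ubar (clamp T y))) z := by
    intro V _ _ f z hz
    refine Filter.EventuallyEq.fderiv_eq ?_
    filter_upwards [clamp_eventuallyEq hz] with w hw
    rw [hw]
  refine ⟨⟨K, hlip⟩, fun t x i => ?_, fun z => h.mem_Gam _ (clamp_fst_mem hT z) _, ?_, ?_, ?_⟩
  · exact h.periodic _ (clamp_fst_mem hT (t, x)) x i
  · filter_upwards [hdiff, ae_mem_Ioo T, h.eq_Phi] with z hd hz hΦ i α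
    set π : Ext →L[ℝ] ℝ := (EuclideanSpace.proj (i, α) : Mat3 →L[ℝ] ℝ).comp
      (ContinuousLinearMap.fst ℝ Mat3 (Mat3 × ℝ)) with hπ
    have hF : DifferentiableAt ℝ (fun y => (Ubar (clamp T y)).1) z := hd.fst
    have h1 := congrArg π hΦ
    rw [dt, hcongr (fun U => Phi U.1) hz, ← fderiv_comp_clm
      (W := fun y => Phi (Ubar (clamp T y)).1) ((differentiable_Phi _).comp z hF) π, map_sum] at h1
    refine ((fderiv_comp_clm hd (projF (i, α)) (1, 0)).symm.trans h1).trans ?_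
    have h2 : ∀ j β, π (dx β (fun y => (Ubar y).2.1 j • dPhi (Ubar y).1 j β) z) =
        if (i, α) = (j, β) then (fderiv ℝ (fun y => Ubar (clamp T y)) z (0, unitVec β)).2.1 j
          else 0 := by
      intro j β
      have hv : DifferentiableAt ℝ (fun y => (Ubar (clamp T y)).2.1 j) z :=
        (projV j).differentiableAt.comp z hd
      rw [dx, hcongr (fun U => U.2.1 j • dPhi U.1 j β) hz, ← fderiv_comp_clm
        (W := fun y => (Ubar (clamp T y)).2.1 j • dPhi (Ubar (clamp T y)).1 j β) (hv.smul
        (((contDiff_dPhi j β (n := 1)).differentiable one_ne_zero _).comp z hF)) π]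
      have h3 : (fun y => π ((Ubar (clamp T y)).2.1 j • dPhi (Ubar (clamp T y)).1 j β)) =
          fun y => ((if (i, α) = (j, β) then projV j else 0 : State →L[ℝ] ℝ))
            (Ubar (clamp T y)) := by
        ext y
        have h4 : π (dPhi (Ubar (clamp T y)).1 j β) = if (i, α) = (j, β) then 1 else 0 := by
          rw [dPhi_eq]
          simp [hπ]
        rw [map_smul, h4]
        split_ifs <;> simp [projV]
      rw [h3, fderiv_comp_clm hd]
      split_ifs <;> simp [projV]
    simp only [map_sum, h2]
    rw [Finset.sum_eq_single i, Finset.sum_eq_single α]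
    · simp
    · intro β _ hβ
      rw [if_neg (fun h => hβ (Prod.ext_iff.1 h).2.symm)]
    · simp
    · intro j _ hj
      refine Finset.sum_eq_zero fun β _ => ?_
      rw [if_neg (fun h => hj (Prod.ext_iff.1 h).1.symm)]
    · simp
  · filter_upwards [hdiff, ae_mem_Ioo T, h.eq_entropy] with z hd hz hη
    rw [dt, hcongr (fun U => U.2.2) hz] at hη
    have h1 := fderiv_comp_clm hd projEta (1, 0)
    rw [clamp_eq_self (Ioo_subset_Icc_self hz)]
    exact h1.symm.trans hη
  · filter_upwards [hdiff, ae_mem_Ioo T, ae_all_iff.2 h.eq_velocity] with z hd hz hv i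
    have h1 := fderiv_comp_clm hd (projV i) (1, 0)
    have h2 := hv i
    rw [dt, hcongr (fun U => U.2.1 i) hz] at h2
    refine h1.symm.trans (h2.trans (Finset.sum_congr rfl fun α _ => ?_))
    rw [dx, hcongr (fun U => stress e U.1 U.2.2 i α) hz]
    rfl

namespace IsStrongSolution
variable {e : Ext × ℝ → ℝ} {r : ℝ × E3 → ℝ} {T M : ℝ} {W : ℝ × E3 → State}

theorem isCoeff_clm (h : IsStrongSolution e r T M W) (L : State →L[ℝ] ℝ) :
    IsCoeff fun z => L (W z) := by
  obtain ⟨K, hK⟩ := h.lipschitz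
  refine ⟨⟨_, L.lipschitz.comp hK⟩, ⟨‖L‖ * |M|, by positivity, fun z => ?_⟩,
    fun t x i => by rw [h.periodic]⟩
  refine (L.le_opNorm _).trans ?_
  gcongr
  have hm := h.mem_Gam z
  exact (max_le hm.1 (max_le hm.2.1 hm.2.2.1)).trans (le_abs_self M)

theorem isCoeff_F (h : IsStrongSolution e r T M W) (k : Fin 3 × Fin 3) :
    IsCoeff fun z => (W z).1 k := h.isCoeff_clm (projF k)

theorem isCoeff_v (h : IsStrongSolution e r T M W) (i : Fin 3) :
    IsCoeff fun z => (W z).2.1 i := h.isCoeff_clm (projV i)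

theorem exists_lipschitz_ext (h : IsStrongSolution e r T M W) :
    ∃ K, LipschitzWith K fun z => ext (W z) := by
  obtain ⟨K, hK⟩ := h.lipschitz
  have hΦ : ∃ L, LipschitzOnWith L Phi (Metric.closedBall 0 M) := by
    obtain ⟨C, hC⟩ := (isCompact_closedBall (0 : Mat3) M).exists_bound_of_continuousOn
      ((contDiff_Phi (n := 1)).continuous_fderiv one_ne_zero).continuousOn
    refine ⟨⟨max C 0, le_max_right _ _⟩, (convex_closedBall 0 M).lipschitzOnWith_of_nnnorm_fderiv_le
      (fun F _ => differentiable_Phi F) (fun F hF => (hC F hF).trans (le_max_left _ _))⟩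
  obtain ⟨L, hL⟩ := hΦ
  have h1 : LipschitzWith (L * K) fun z => Phi (W z).1 := by
    refine LipschitzWith.of_dist_le_mul fun z w => ?_
    refine (hL.dist_le_mul _ (by simpa using (h.mem_Gam z).1) _
      (by simpa using (h.mem_Gam w).1)).trans ?_
    rw [NNReal.coe_mul, mul_assoc]
    gcongr
    exact (le_max_left _ _).trans (hK.dist_le_mul z w)
  exact ⟨_, h1.prodMk (projEta.lipschitz.comp hK)⟩

theorem isCoeff_comp_ext (h : IsStrongSolution e r T M W) {f : Ext × ℝ → ℝ}
    (hf : ContDiffOn ℝ 1 f dom) : IsCoeff fun z => f (ext (W z)) := by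
  obtain ⟨R, hR⟩ := exists_ext_mem_domBall M
  obtain ⟨K, hK⟩ := h.exists_lipschitz_ext
  obtain ⟨C, hC0, hC⟩ := exists_bound_on_domBall hf.continuousOn R
  obtain ⟨L, hL0, hL⟩ := exists_lipschitz_on_domBall hf R
  refine ⟨⟨L.toNNReal * K, LipschitzWith.of_dist_le_mul fun z w => ?_⟩,
    ⟨C, hC0, fun z => hC _ (hR _ (h.mem_Gam z))⟩, fun t x i => by rw [h.periodic]⟩
  rw [NNReal.coe_mul, Real.coe_toNNReal _ hL0, mul_assoc, dist_eq_norm]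
  refine (hL _ (hR _ (h.mem_Gam w)) _ (hR _ (h.mem_Gam z))).trans ?_
  rw [← dist_eq_norm]
  exact mul_le_mul_of_nonneg_left (hK.dist_le_mul z w) hL0

theorem ae_differentiableAt (h : IsStrongSolution e r T M W) :
    ∀ᵐ z ∂(volQ T), DifferentiableAt ℝ W z := by
  obtain ⟨K, hK⟩ := h.lipschitz
  exact ae_volQ_of_ae hK.ae_differentiableAt

theorem exists_norm_fderiv_le (h : IsStrongSolution e r T M W) :
    ∃ K, 0 ≤ K ∧ ∀ z, ‖fderiv ℝ W z‖ ≤ K := by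
  obtain ⟨K, hK⟩ := h.lipschitz
  exact ⟨K, K.2, fun z => norm_fderiv_le_of_lipschitz ℝ hK⟩

end IsStrongSolution

/-- The derivative of `ext`, applied to a direction. -/
def dExt (U H : State) : Ext × ℝ := (fderiv ℝ Phi U.1 H.1, H.2.2)

section
variable {W : ℝ × E3 → State} {z : ℝ × E3}

theorem hasFDerivAt_ext_comp (hW : DifferentiableAt ℝ W z) :
    ∃ A : ℝ × E3 →L[ℝ] Ext × ℝ, HasFDerivAt (fun y => ext (W y)) A z ∧
      ∀ v, A v = dExt (W z) (fderiv ℝ W z v) := by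
  have h0 : HasFDerivAt Phi (fderiv ℝ Phi (W z).1) ((fun y => (W y).1) z) :=
    (differentiable_Phi (W z).1).hasFDerivAt
  have h1 := h0.comp z hW.hasFDerivAt.fst
  exact ⟨_, h1.prodMk hW.hasFDerivAt.snd.snd, fun v => rfl⟩

theorem fderiv_comp_ext {V : Type*} [NormedAddCommGroup V] [NormedSpace ℝ V]
    {f : Ext × ℝ → V} (hW : DifferentiableAt ℝ W z) (hdom : ∀ y, ext (W y) ∈ dom)
    (hf : DifferentiableWithinAt ℝ f dom (ext (W z))) :
    DifferentiableAt ℝ (fun y => f (ext (W y))) z ∧ ∀ v, fderiv ℝ (fun y => f (ext (W y))) z v =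
      fderivWithin ℝ f dom (ext (W z)) (dExt (W z) (fderiv ℝ W z v)) := by
  obtain ⟨A, hA, hAv⟩ := hasFDerivAt_ext_comp hW
  have h1 : HasFDerivAt (fun y => f (ext (W y))) _ z :=
    hf.hasFDerivWithinAt.comp_hasFDerivAt z hA (Eventually.of_forall hdom)
  refine ⟨h1.differentiableAt, fun v => ?_⟩
  rw [h1.fderiv, ContinuousLinearMap.comp_apply, hAv]

theorem fderiv_dPhi_comp (hW : DifferentiableAt ℝ W z) (i α : Fin 3) :
    DifferentiableAt ℝ (fun y => dPhi (W y).1 i α) z ∧ ∀ v,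
      fderiv ℝ (fun y => dPhi (W y).1 i α) z v =
        (0, cofPolar (fderiv ℝ W z v).1 (unitMat i α),
          cofPolar (W z).1 (fderiv ℝ W z v).1 (i, α)) := by
  have hd : Differentiable ℝ fun F => dPhi F i α :=
    (contDiff_dPhi i α (n := 1)).differentiable one_ne_zero
  have h0 : HasFDerivAt (fun F => dPhi F i α) (fderiv ℝ (fun F => dPhi F i α) (W z).1)
      ((fun y => (W y).1) z) := (hd (W z).1).hasFDerivAt
  have h1 := h0.comp z hW.hasFDerivAt.fst
  refine ⟨h1.differentiableAt, fun v => ?_⟩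
  rw [show fderiv ℝ (fun y => dPhi (W y).1 i α) z = _ from h1.fderiv]
  show fderiv ℝ (fun F => dPhi F i α) (W z).1 (fderiv ℝ W z v).1 = _
  generalize (fderiv ℝ W z v).1 = G
  generalize (W z).1 = F
  -- The array `∂Φ/∂F` is quadratic, so its derivative along a line can be read off.
  have h2 : HasDerivAt (fun t : ℝ => dPhi (F + t • G) i α)
      (fderiv ℝ (fun F => dPhi F i α) F G) 0 := by
    have h0 : HasFDerivAt (fun F => dPhi F i α) (fderiv ℝ (fun F => dPhi F i α) F)
        (F + (0 : ℝ) • G) := by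
      simpa using (hd F).hasFDerivAt
    have h2 : HasDerivAt (fun t : ℝ => F + t • G) G 0 := by
      simpa using ((hasDerivAt_id (0 : ℝ)).smul_const G).const_add F
    exact h0.comp_hasDerivAt 0 h2
  have h3 : HasDerivAt (fun t : ℝ => dPhi (F + t • G) i α)
      (0, cofPolar G (unitMat i α), cofPolar F G (i, α)) 0 := by
    have e : (fun t : ℝ => dPhi (F + t • G) i α) = fun t => (unitMat i α,
        cofPolar F (unitMat i α) + t • cofPolar G (unitMat i α),
        cof F (i, α) + t * cofPolar F G (i, α) + t ^ 2 * cof G (i, α)) := by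
      funext t
      rw [dPhi_eq, cof_add, cof_smul, cofPolar_smul_right, cofPolar_add_left,
        cofPolar_comm (t • G), cofPolar_smul_right, cofPolar_comm _ G]
      simp
    rw [e]
    have hid := hasDerivAt_id (0 : ℝ)
    have hp2 : HasDerivAt (fun t : ℝ => t ^ 2) 0 0 := by simpa using hasDerivAt_pow 2 (0 : ℝ)
    refine (hasDerivAt_const _ _).prodMk (HasDerivAt.prodMk ?_ ?_)
    · simpa using (hid.smul_const (cofPolar G (unitMat i α))).const_add
        (cofPolar F (unitMat i α))
    · simpa using ((hid.mul_const (cofPolar F G (i, α))).const_add (cof F (i, α))).fun_add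
        (hp2.mul_const (cof G (i, α)))
  exact h2.unique h3

end

/-! ### Curl-free fields -/

section
variable {T : ℝ} {φ : ℝ × E3 → ℝ}

theorem fderiv_fderiv_apply_comm (hφ : ContDiff ℝ ∞ φ) (z v w : ℝ × E3) :
    fderiv ℝ (fun y => fderiv ℝ φ y v) z w = fderiv ℝ (fun y => fderiv ℝ φ y w) z v := by
  have hd : DifferentiableAt ℝ (fderiv ℝ φ) z :=
    (hφ.fderiv_right (m := 1) (by norm_cast)).differentiable one_ne_zero z
  have h : ∀ v w, fderiv ℝ (fun y => fderiv ℝ φ y v) z w = fderiv ℝ (fderiv ℝ φ) z w v := by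
    intro v w
    rw [fderiv_clm_apply hd (differentiableAt_const v)]
    simp
  rw [h, h]
  exact (hφ.contDiffAt.isSymmSndFDerivAt (by simp; norm_cast)) w v

theorem IsTest.fderiv_apply (hφ : IsTest T φ) (v : ℝ × E3) :
    IsTest T fun z => fderiv ℝ φ z v where
  smooth := (hφ.smooth.fderiv_right (m := ∞) (by norm_cast)).clm_apply contDiff_const
  periodic := fun t x i => by rw [fderiv_periodic hφ.periodic]
  support := by
    obtain ⟨b, hb, h0⟩ := hφ.support
    refine ⟨(b + T) / 2, by linarith, fun t x ht => ?_⟩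
    have : φ =ᶠ[𝓝 (t, x)] fun _ => 0 := by
      have h1 : ∀ᶠ w : ℝ × E3 in 𝓝 (t, x), b < w.1 :=
        continuous_fst.continuousAt.eventually (lt_mem_nhds (by show b < t; linarith))
      filter_upwards [h1] with w hw using h0 w.1 w.2 hw.le
    rw [this.fderiv_eq]
    simp

theorem IsInteriorTest.fderiv_apply (hφ : IsInteriorTest T φ) (v : ℝ × E3) :
    IsInteriorTest T fun z => fderiv ℝ φ z v where
  toIsTest := hφ.toIsTest.fderiv_apply v
  support_left := by
    obtain ⟨a, ha, h0⟩ := hφ.support_left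
    refine ⟨a / 2, by linarith, fun t x ht => ?_⟩
    have : φ =ᶠ[𝓝 (t, x)] fun _ => 0 := by
      have h1 : ∀ᶠ w : ℝ × E3 in 𝓝 (t, x), w.1 < a :=
        continuous_fst.continuousAt.eventually (gt_mem_nhds (by show t < a; linarith))
      filter_upwards [h1] with w hw using h0 w.1 w.2 hw.le
    rw [this.fderiv_eq]
    simp

theorem IsTest.exists_bound (hφ : IsTest T φ) :
    ∃ C, 0 ≤ C ∧ ∀ z ∈ cylinder T, |φ z| ≤ C := by
  obtain ⟨C, hC0, hC⟩ := exists_bound_of_periodic hφ.smooth.continuous hφ.periodic T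
  exact ⟨C, hC0, fun z hz => hC z hz.1⟩

theorem IsTest.continuous (hφ : IsTest T φ) : Continuous φ := hφ.smooth.continuous

/-- Products of integrable functions with test functions are integrable. -/
theorem IsTest.integrable_mul (hφ : IsTest T φ) {a : ℝ × E3 → ℝ} (ha : Integrable a (volQ T)) :
    Integrable (fun z => φ z * a z) (volQ T) := by
  obtain ⟨C, hC0, hC⟩ := hφ.exists_bound
  refine ha.bdd_mul hφ.continuous.aestronglyMeasurable (c := C) ?_
  filter_upwards [ae_mem_cylinder T] with z hz using hC z hz

theorem IsCoeff.integrable_mul {f : ℝ × E3 → ℝ} (hf : IsCoeff f) {a : ℝ × E3 → ℝ}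
    (ha : Integrable a (volQ T)) : Integrable (fun z => f z * a z) (volQ T) := by
  obtain ⟨C, hC0, hC⟩ := hf.bound
  exact ha.bdd_mul hf.continuous.aestronglyMeasurable (c := C) (ae_of_all _ hC)

theorem IsCoeff.integrable_fderiv_mul {f : ℝ × E3 → ℝ} (hf : IsCoeff f) (v : ℝ × E3)
    {a : ℝ × E3 → ℝ} (ha : Integrable a (volQ T)) :
    Integrable (fun z => fderiv ℝ f z v * a z) (volQ T) := by
  obtain ⟨C, hC0, hC⟩ := hf.exists_abs_fderiv_le
  refine ha.bdd_mul (IsCoeff.measurable_fderiv v).aestronglyMeasurable (c := C * ‖v‖)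
    (ae_of_all _ fun z => ?_)
  exact ((fderiv ℝ f z).le_opNorm v).trans (by gcongr; exact hC z)

theorem IsCoeff.integrable {f : ℝ × E3 → ℝ} (hf : IsCoeff f) : Integrable f (volQ T) :=
  integrable_volQ_of_continuous hf.continuous T

/-- A smooth cutoff in time turns a test function into an interior one. -/
theorem IsTest.isInteriorTest_cutoff (hφ : IsTest T φ) (n : ℕ) :
    IsInteriorTest T fun z => φ z * Real.smoothTransition ((n + 1) * z.1 - 1) where
  smooth := hφ.smooth.mul (Real.smoothTransition.contDiff.comp (by fun_prop))
  periodic := fun t x i => by rw [hφ.periodic]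
  support := by
    obtain ⟨b, hb, h0⟩ := hφ.support
    exact ⟨b, hb, fun t x ht => by rw [h0 t x ht, zero_mul]⟩
  support_left := by
    refine ⟨1 / (n + 1), by positivity, fun t x ht => ?_⟩
    rw [le_div_iff₀ (by positivity)] at ht
    rw [Real.smoothTransition.zero_of_nonpos (by linarith), mul_zero]

end

/-- A field `(… a, b …)` with `a` in the slot `α` and `b` in the slot `β` whose curl vanishes
in the interior, tested with smooth functions, may be tested with products of smooth functions on
`[0, T)` and Lipschitz coefficients. -/
theorem weak_curl_free {T : ℝ} (hT : 0 < T) {a b : ℝ × E3 → ℝ} {α β : Fin 3} (hαβ : α ≠ β)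
    (ha : Integrable a (volQ T)) (hb : Integrable b (volQ T))
    (H : ∀ φ, IsInteriorTest T φ → ∫ z, (dx β φ z * a z - dx α φ z * b z) ∂(volQ T) = 0)
    {φ f : ℝ × E3 → ℝ} (hφ : IsTest T φ) (hf : IsCoeff f) :
    ∫ z, ((dx β φ z * f z + φ z * dx β f z) * a z - (dx α φ z * f z + φ z * dx α f z) * b z)
      ∂(volQ T) = 0 := by
  set g : Fin 3 → ℝ × E3 → ℝ := fun γ z => if γ = β then a z else if γ = α then -b z else 0
  have hsum : ∀ (d : Fin 3 → ℝ) z, ∑ γ, d γ * g γ z = d β * a z - d α * b z := by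
    intro d z
    have h1 : ∀ γ, d γ * g γ z = (if γ = β then d β * a z else 0) +
        (if γ = α then -(d α * b z) else 0) := by
      intro γ
      by_cases h1 : γ = β
      · have h2 : γ ≠ α := fun h => hαβ (h.symm.trans h1)
        simp [g, h1, Ne.symm hαβ]
      · by_cases h2 : γ = α <;> simp [g, h1, h2, hαβ]
    simp only [h1, Finset.sum_add_distrib, Finset.sum_ite_eq', Finset.mem_univ, if_true]
    ring
  have hg : ∀ γ, Integrable (g γ) (volQ T) := by
    intro γ
    by_cases h1 : γ = β
    · simpa [g, h1] using ha
    · by_cases h2 : γ = α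
      · simpa [g, h1, h2, hαβ] using hb.neg
      · simp [g, h1, h2]
  -- A cutoff near `t = 0` makes the test function interior; then the cutoff tends to `1`.
  have key : ∀ n : ℕ, ∫ z, Real.smoothTransition ((n + 1) * z.1 - 1) *
      ((dx β φ z * f z + φ z * dx β f z) * a z - (dx α φ z * f z + φ z * dx α f z) * b z)
      ∂(volQ T) = 0 := by
    intro n
    have hn := hφ.isInteriorTest_cutoff n
    obtain ⟨c, hc, h0⟩ := hn.support_left
    have h := weakForm_eq_zero_of_interior (T := T) (f := 0) (g := g) (h := 0) (f₀ := 0)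
      (integrable_zero _ _ _) hg (integrable_zero _ _ _) (integrable_zero _ _ _)
      (fun φ hφ => by simpa [weakForm, hsum] using H φ hφ) (hn.toIsTest.isLipTest_mul hT.le hf)
      hc (fun t x ht => by
        simp only [clamp]
        rw [h0 _ _ (max_le hc.le ((min_le_left _ _).trans ht)), zero_mul])
    rw [weakForm_clamp_mul hT.le hn.smooth hf] at h
    simp only [Pi.zero_apply, mul_zero, integral_zero, add_zero, zero_add, hsum] at h
    rw [← h]
    refine integral_congr_ae (ae_of_all _ fun z => ?_)
    have hd : ∀ γ, dx γ (fun z => φ z * Real.smoothTransition ((n + 1) * z.1 - 1)) z =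
        Real.smoothTransition ((n + 1) * z.1 - 1) * dx γ φ z := by
      intro γ
      have h1 : HasFDerivAt (fun z : ℝ × E3 => Real.smoothTransition ((n + 1) * z.1 - 1)) _ z :=
        ((Real.smoothTransition.contDiff (n := 1)).differentiable one_ne_zero
          _).hasFDerivAt.comp z (((hasFDerivAt_fst (p := z)).const_mul ((n : ℝ) + 1)).sub_const 1)
      have h2 := (hφ.smooth.differentiable (by simp) z).hasFDerivAt.mul h1
      rw [dx, show fderiv ℝ (fun z => φ z * Real.smoothTransition ((n + 1) * z.1 - 1)) z = _ from
        h2.fderiv]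
      simp [dx]
    simp only [hd]
    ring
  have hint : ∀ (γ : Fin 3) (c : ℝ × E3 → ℝ), Integrable c (volQ T) →
      Integrable (fun z => (dx γ φ z * f z + φ z * dx γ f z) * c z) (volQ T) := by
    intro γ c hc
    have h1 := ((hφ.fderiv_apply (0, unitVec γ)).integrable_mul (hf.integrable_mul hc)).add
      (hφ.integrable_mul (hf.integrable_fderiv_mul (0, unitVec γ) hc))
    refine h1.congr (ae_of_all _ fun z => ?_)
    simp only [dx, Pi.add_apply]
    ring
  have hI := (hint β a ha).sub (hint α b hb)
  have hlim := tendsto_integral_of_dominated_convergence (μ := volQ T)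
    (F := fun (n : ℕ) z => Real.smoothTransition ((n + 1) * z.1 - 1) *
      ((dx β φ z * f z + φ z * dx β f z) * a z - (dx α φ z * f z + φ z * dx α f z) * b z))
    (f := fun z =>
      ((dx β φ z * f z + φ z * dx β f z) * a z - (dx α φ z * f z + φ z * dx α f z) * b z))
    (fun z => |(dx β φ z * f z + φ z * dx β f z) * a z - (dx α φ z * f z + φ z * dx α f z) * b z|)
    (fun n => ?_) hI.abs (fun n => ae_of_all _ fun z => ?_) ?_
  · simp only [key] at hlim
    exact tendsto_nhds_unique hlim tendsto_const_nhds
  · exact ((Real.smoothTransition.continuous.comp (by fun_prop)).aestronglyMeasurable).mul hI.1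
  · rw [norm_mul, Real.norm_of_nonneg (Real.smoothTransition.nonneg _), Real.norm_eq_abs]
    exact mul_le_of_le_one_left (abs_nonneg _) (Real.smoothTransition.le_one _)
  · filter_upwards [ae_mem_Ioo T] with z hz
    refine tendsto_const_nhds.congr' ?_
    obtain ⟨N, hN⟩ := exists_nat_ge (2 / z.1)
    filter_upwards [eventually_ge_atTop N] with n hn
    have h1 : 2 / z.1 ≤ n := hN.trans (by exact_mod_cast hn)
    rw [div_le_iff₀ hz.1] at h1
    rw [Real.smoothTransition.one_of_one_le (by nlinarith [hz.1]), one_mul]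

/-- The deformation gradient of a motion is curl-free in the sense of distributions. -/
theorem curl_free_of_motion {T : ℝ} {y a b : ℝ × E3 → ℝ} {α β : Fin 3}
    (ha : ∀ φ, IsInteriorTest T φ →
      ∫ z, y z * dx α φ z ∂(volQ T) = -∫ z, a z * φ z ∂(volQ T))
    (hb : ∀ φ, IsInteriorTest T φ →
      ∫ z, y z * dx β φ z ∂(volQ T) = -∫ z, b z * φ z ∂(volQ T))
    (hai : Integrable a (volQ T)) (hbi : Integrable b (volQ T))
    {φ : ℝ × E3 → ℝ} (hφ : IsInteriorTest T φ) :
    ∫ z, (dx β φ z * a z - dx α φ z * b z) ∂(volQ T) = 0 := by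
  have h1 := ha _ (hφ.fderiv_apply (0, unitVec β))
  have h2 := hb _ (hφ.fderiv_apply (0, unitVec α))
  simp only [dx] at h1 h2 ⊢
  simp only [fderiv_fderiv_apply_comm hφ.smooth _ (0, unitVec β) (0, unitVec α)] at h1
  rw [h1] at h2
  rw [integral_sub ((hφ.toIsTest.fderiv_apply _).integrable_mul hai)
    ((hφ.toIsTest.fderiv_apply _).integrable_mul hbi)]
  simp only [mul_comm (a _), mul_comm (b _)] at h2
  linarith

/-- A property that holds almost everywhere before any time `b < T` holds almost everywhere. -/
theorem ae_of_forall_lt {T : ℝ} (hT : 0 < T) {P : ℝ × E3 → Prop}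
    (h : ∀ b, 0 < b → b < T → ∀ᵐ z ∂(volQ T), z.1 < b → P z) : ∀ᵐ z ∂(volQ T), P z := by
  have h1 : ∀ n : ℕ, ∀ᵐ z ∂(volQ T), z.1 < T * (1 - 1 / (n + 2)) → P z := by
    intro n
    have h2 : (1 : ℝ) / (n + 2) < 1 := by
      rw [div_lt_one (by positivity)]; linarith [(n.cast_nonneg : (0 : ℝ) ≤ n)]
    have h3 : (0 : ℝ) < 1 / (n + 2) := by positivity
    exact h _ (mul_pos hT (by linarith)) (by nlinarith)
  filter_upwards [ae_all_iff.2 h1, ae_mem_Ioo T] with z hz hzT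
  obtain ⟨n, hn⟩ := exists_nat_gt (T / (T - z.1))
  refine hz n ?_
  have h4 : 0 < T - z.1 := by linarith [hzT.2]
  rw [div_lt_iff₀ h4] at hn
  have h5 : T * (1 / (n + 2)) < T - z.1 := by
    rw [mul_one_div, div_lt_iff₀ (by positivity)]
    nlinarith
  linarith

/-- A bounded periodic field whose time derivative vanishes weakly, including at the initial time,
is zero. The test function is a primitive in time of the field's own mollification, multiplied by a
weight that vanishes outside `(0, b)`. -/
theorem ae_eq_zero_of_integral_dt_mul_eq_zero {T : ℝ} (hT : 0 < T) {c : ℝ × E3 → ℝ}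
    (hc : Measurable c) {C : ℝ} (hC : ∀ z, |c z| ≤ C)
    (hper : ∀ t x i, c (t, x + unitVec i) = c (t, x))
    (H : ∀ φ, IsTest T φ → ∫ z, dt φ z * c z ∂(volQ T) = 0) : ∀ᵐ z ∂(volQ T), c z = 0 := by
  have hci : ∀ μ : Measure (ℝ × E3), IsFiniteMeasure μ → Integrable c μ := fun μ _ =>
    Integrable.of_bound hc.aestronglyMeasurable C (ae_of_all _ hC)
  have hcl : LocallyIntegrable c := by
    have : MemLp c ⊤ (volume : Measure (ℝ × E3)) :=
      memLp_top_of_bound hc.aestronglyMeasurable C (ae_of_all _ hC)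
    exact this.locallyIntegrable le_top
  have Hlip : ∀ ψ, IsLipTest T ψ → ∫ z, dt ψ z * c z ∂(volQ T) = 0 := by
    intro ψ hψ
    have h := weakForm_eq_zero (T := T) (f := c) (g := 0) (h := 0) (f₀ := 0)
      (hci _ inferInstance) (fun _ => integrable_zero _ _ _) (integrable_zero _ _ _)
      (integrable_zero _ _ _) (fun φ hφ => by simpa [weakForm] using H φ hφ) hψ
    simpa [weakForm] using h
  refine ae_of_forall_lt hT ?_
  intro b hb0 hbT
  -- With `∂_t ψ = w c_n`, where `c_n` are mollifications of `c`, the limit gives `∫ w c² = 0`.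
  set w : ℝ × E3 → ℝ := fun z => max 0 (min z.1 (b - z.1)) with hw
  have hw0 : ∀ z, 0 ≤ w z := fun z => le_max_left _ _
  have hwc : IsCoeff w := by
    refine ⟨⟨1, ?_⟩, ⟨b, hb0.le, fun z => ?_⟩, fun t x i => rfl⟩
    · have h1 : LipschitzWith 1 fun z : ℝ × E3 => min z.1 (b - z.1) := by
        have h2 : LipschitzWith 1 fun z : ℝ × E3 => b - z.1 := by
          have := (LipschitzWith.const (α := ℝ × E3) b).sub LipschitzWith.prod_fst
          rwa [zero_add] at this
        simpa using LipschitzWith.prod_fst.min h2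
      exact h1.const_max 0
    · rw [abs_of_nonneg (hw0 z)]
      refine max_le hb0.le ?_
      rcases le_total z.1 b with h | h
      · exact (min_le_left _ _).trans h
      · exact (min_le_right _ _).trans (by linarith)
  have key : ∀ n, ∫ z, w z * mollify (bumpSeq n) c z * c z ∂(volQ T) = 0 := by
    intro n
    set χ : ℝ × E3 → ℝ := fun z => w z * mollify (bumpSeq n) c (clamp T z) with hχ
    have hχc : IsCoeff χ := hwc.mul (isCoeff_clamp hT.le
      ((contDiff_mollify (bumpSeq n) hcl).of_le (by simp)) (mollify_periodic _ hper))
    have hχ0 : ∀ t x, b ≤ t → χ (t, x) = 0 := by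
      intro t x ht
      have : w (t, x) = 0 := max_eq_left ((min_le_right _ _).trans (by show b - t ≤ 0; linarith))
      simp only [hχ, this, zero_mul]
    obtain ⟨K, hK⟩ := hχc.lipschitz
    obtain ⟨D, hD0, hD⟩ := hχc.bound
    have hχi : ∀ x s t, IntervalIntegrable (fun s => χ (s, x)) volume s t := fun x s t =>
      (hχc.continuous.comp (by fun_prop)).intervalIntegrable s t
    set ψ : ℝ × E3 → ℝ := fun z => -∫ s in (clamp T z).1..T, χ (s, z.2) with hψ
    have hψl : IsLipTest T ψ := by
      refine ⟨⟨D.toNNReal + K * T.toNNReal, LipschitzWith.of_dist_le_mul fun z z' => ?_⟩,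
        fun t x i => ?_, ⟨b, hbT, fun t x ht => ?_⟩⟩
      · have e1 : ψ z - ψ z' = (∫ s in (clamp T z').1..T, (χ (s, z'.2) - χ (s, z.2))) -
            ∫ s in (clamp T z).1..(clamp T z').1, χ (s, z.2) := by
          have h1 := intervalIntegral.integral_add_adjacent_intervals
            (hχi z.2 (clamp T z).1 (clamp T z').1) (hχi z.2 _ T)
          rw [intervalIntegral.integral_sub (hχi _ _ _) (hχi _ _ _)]
          simp only [hψ]
          linarith
        rw [Real.dist_eq, e1]
        have b1 := intervalIntegral.norm_integral_le_of_norm_le_const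
          (a := (clamp T z').1) (b := T) (f := fun s => χ (s, z'.2) - χ (s, z.2))
          (C := K * dist z z') (fun s _ => by
            have := hK.dist_le_mul (s, z'.2) (s, z.2)
            rw [dist_eq_norm] at this
            refine this.trans ?_
            gcongr
            rw [Prod.dist_eq, dist_self, max_eq_right dist_nonneg, dist_comm]
            exact le_max_right _ _)
        have b2 := intervalIntegral.norm_integral_le_of_norm_le_const
          (a := (clamp T z).1) (b := (clamp T z').1) (f := fun s => χ (s, z.2))
          (C := D) (fun s _ => hD _)
        have b3 : |T - (clamp T z').1| ≤ T := by
          have := clamp_fst_mem hT.le z'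
          rw [abs_of_nonneg (by linarith [this.2])]; linarith [this.1]
        have b4 : |(clamp T z').1 - (clamp T z).1| ≤ dist z z' := by
          have := (lipschitzWith_clamp T).dist_le_mul z' z
          rw [NNReal.coe_one, one_mul, dist_comm z' z] at this
          exact (le_max_left _ _).trans this
        refine (abs_sub _ _).trans ((add_le_add b1 b2).trans ?_)
        rw [NNReal.coe_add, NNReal.coe_mul, Real.coe_toNNReal _ hD0, Real.coe_toNNReal _ hT.le]
        have hd : 0 ≤ dist z z' := dist_nonneg
        calc _ ≤ K * dist z z' * T + D * dist z z' := by gcongr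
          _ = _ := by ring
      · simp only [hψ]
        congr 1
        exact intervalIntegral.integral_congr fun s _ => hχc.periodic s x i
      · simp only [hψ]
        rw [neg_eq_zero]
        refine intervalIntegral.integral_zero_ae (ae_of_all _ fun s hs => hχ0 s x ?_)
        have h1 : b ≤ (clamp T (t, x)).1 := (le_min ht hbT.le).trans (le_max_right _ _)
        rw [uIoc_of_le (clamp_fst_mem hT.le _).2] at hs
        exact h1.trans hs.1.le
    have h := Hlip ψ hψl
    obtain ⟨L, hL⟩ := hψl.lipschitz
    rw [← h]
    refine integral_congr_ae ?_
    filter_upwards [ae_mem_Ioo T, ae_volQ_of_ae hL.ae_differentiableAt] with z hz hd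
    congr 1
    have h1 : HasDerivAt (fun t => ψ (t, z.2)) (dt ψ z) z.1 :=
      HasFDerivAt.comp_hasDerivAt (f := fun t => (t, z.2)) z.1 hd.hasFDerivAt
        ((hasDerivAt_id z.1).prodMk (hasDerivAt_const z.1 z.2))
    have h2 : HasDerivAt (fun t => ψ (t, z.2)) (χ z) z.1 := by
      have hcs : Continuous fun s => χ (s, z.2) := hχc.continuous.comp (by fun_prop)
      have h3 := (intervalIntegral.integral_hasDerivAt_left (hχi z.2 z.1 T)
        (hcs.stronglyMeasurableAtFilter _ _) hcs.continuousAt).neg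
      rw [neg_neg] at h3
      refine h3.congr_of_eventuallyEq ?_
      filter_upwards [isOpen_Ioo.mem_nhds hz] with t ht
      simp only [hψ, Pi.neg_apply]
      rw [clamp_eq_self (z := (t, z.2)) (Ioo_subset_Icc_self ht)]
    rw [h1.unique h2, hχ]
    simp only [clamp_eq_self (Ioo_subset_Icc_self hz)]
  have hlim := tendsto_integral_of_dominated_convergence (μ := volQ T)
    (F := fun n z => w z * mollify (bumpSeq n) c z * c z) (f := fun z => w z * c z * c z)
    (fun z => b * C * C) (fun n => ?_) (integrable_const _) (fun n => ae_of_all _ fun z => ?_) ?_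
  · simp only [key] at hlim
    have h0 := tendsto_nhds_unique hlim tendsto_const_nhds
    have hint : Integrable (fun z => w z * c z * c z) (volQ T) := by
      have := hwc.integrable_mul ((hci (volQ T) inferInstance).mul_bdd (c := C)
        hc.aestronglyMeasurable (ae_of_all _ hC))
      simpa only [mul_assoc] using this
    have h1 := (integral_eq_zero_iff_of_nonneg (fun z => by
      show 0 ≤ w z * c z * c z
      rw [mul_assoc]; exact mul_nonneg (hw0 z) (mul_self_nonneg _)) hint).1 h0
    filter_upwards [h1, ae_mem_Ioo T] with z hz hzT hzb
    have h2 : 0 < w z := lt_max_of_lt_right (lt_min hzT.1 (by linarith))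
    simpa [mul_assoc, h2.ne'] using hz
  · exact (hwc.continuous.aestronglyMeasurable.mul
      (contDiff_mollify _ hcl).continuous.aestronglyMeasurable).mul hc.aestronglyMeasurable
  · obtain ⟨D, hD0, hD⟩ := hwc.bound
    have hC0 : 0 ≤ C := (abs_nonneg _).trans (hC z)
    have hwb : |w z| ≤ b := by
      rw [abs_of_nonneg (hw0 z)]
      refine max_le hb0.le ?_
      rcases le_total z.1 b with h | h
      · exact (min_le_left _ _).trans h
      · exact (min_le_right _ _).trans (by linarith)
    rw [norm_mul, norm_mul]
    gcongr
    · exact hwb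
    · exact abs_mollify_le _ hC z
    · exact hC z
  · filter_upwards [ae_volQ_of_ae (ae_tendsto_mollify hcl)] with z hz
    exact (hz.const_mul (w z)).mul_const _

/-- A row `a` of an integrable matrix field that is curl-free in the sense of distributions. -/
structure IsWeakCurlFree (T : ℝ) (a : Fin 3 → ℝ × E3 → ℝ) : Prop where
  integrable : ∀ α, Integrable (a α) (volQ T)
  curl_free : ∀ α β, α ≠ β → ∀ φ, IsInteriorTest T φ →
    ∫ z, (dx β φ z * a α z - dx α φ z * a β z) ∂(volQ T) = 0

/-- The curl of the deformation gradient of the strong solution vanishes: by the weak equation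
`∂_t F = ∇v`, which `F` and the strong solution share together with their initial values, the curl
of the difference is constant in time and vanishes initially. -/
theorem IsStrongSolution.curl_free {e : Ext × ℝ → ℝ} {r : ℝ × E3 → ℝ} {T M : ℝ}
    {W : ℝ × E3 → State} (hT : 0 < T) (h : IsStrongSolution e r T M W) {k α β : Fin 3}
    (hαβ : α ≠ β) {a : Fin 3 → ℝ × E3 → ℝ} {u : ℝ × E3 → ℝ} (ha : IsWeakCurlFree T a)
    (H : ∀ α, ∀ φ, IsTest T φ → (∫ z, dt φ z * a α z ∂(volQ T)) +
      ∫ x, φ (0, x) * (W (0, x)).1 (k, α) ∂volX = ∫ z, dx α φ z * u z ∂(volQ T)) :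
    ∀ᵐ z ∂(volQ T), dx β (fun y => (W y).1 (k, α)) z = dx α (fun y => (W y).1 (k, β)) z := by
  have hF := fun α => h.isCoeff_F (k, α)
  have hv := h.isCoeff_v k
  -- The strong solution satisfies the same weak equation.
  have H' : ∀ α, ∀ φ, IsTest T φ → (∫ z, dt φ z * (W z).1 (k, α) ∂(volQ T)) +
      ∫ x, φ (0, x) * (W (0, x)).1 (k, α) ∂volX = ∫ z, dx α φ z * (W z).2.1 k ∂(volQ T) := by
    intro α φ hφ
    have h1 := hφ.integral_dt_mul hT (hF α)
    have h2 := hφ.integral_dx_mul hT.le hv α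
    have i1 := (hφ.fderiv_apply (1, 0)).integrable_mul (hF α).integrable
    have i2 := hφ.integrable_mul ((hF α).integrable_fderiv T (1, 0))
    have i3 := (hφ.fderiv_apply (0, unitVec α)).integrable_mul hv.integrable
    have i4 := hφ.integrable_mul (hv.integrable_fderiv T (0, unitVec α))
    simp only [dt, dx] at h1 h2 ⊢
    rw [integral_add i1 i2] at h1
    rw [integral_add i3 i4] at h2
    have h3 : ∫ z, φ z * fderiv ℝ (fun z => (W z).1 (k, α)) z (1, 0) ∂(volQ T) =
        ∫ z, φ z * fderiv ℝ (fun z => (W z).2.1 k) z (0, unitVec α) ∂(volQ T) := by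
      refine integral_congr_ae ?_
      filter_upwards [h.eq_F, h.ae_differentiableAt] with z hz hd
      have e1 := fderiv_comp_clm hd (projF (k, α)) (1, 0)
      have e2 := fderiv_comp_clm hd (projV k) (0, unitVec α)
      exact congrArg _ (e1.trans ((hz k α).trans e2.symm))
    linarith
  have hcoeff : ∀ α v, Measurable fun z => fderiv ℝ (fun y => (W y).1 (k, α)) z v :=
    fun α v => IsCoeff.measurable_fderiv v
  obtain ⟨C, hC0, hC⟩ := (hF α).exists_abs_fderiv_le
  obtain ⟨D, hD0, hD⟩ := (hF β).exists_abs_fderiv_le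
  have key := ae_eq_zero_of_integral_dt_mul_eq_zero hT
    (c := fun z => dx β (fun y => (W y).1 (k, α)) z - dx α (fun y => (W y).1 (k, β)) z)
    ((hcoeff _ _).sub (hcoeff _ _)) (C := C + D) (fun z => ?_) (fun t x i => ?_) (fun φ hφ => ?_)
  · filter_upwards [key] with z hz using sub_eq_zero.1 hz
  · refine (abs_sub _ _).trans (add_le_add ?_ ?_)
    · have := (fderiv ℝ (fun y => (W y).1 (k, α)) z).le_opNorm (0, unitVec β)
      rw [norm_dx_dir, mul_one] at this
      exact this.trans (hC z)
    · have := (fderiv ℝ (fun y => (W y).1 (k, β)) z).le_opNorm (0, unitVec α)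
      rw [norm_dx_dir, mul_one] at this
      exact this.trans (hD z)
  · simp only [dx]
    rw [fderiv_periodic (hF α).periodic, fderiv_periodic (hF β).periodic]
  · have hφt := hφ.fderiv_apply (1, 0)
    have hφα := hφ.fderiv_apply (0, unitVec α)
    have hφβ := hφ.fderiv_apply (0, unitVec β)
    have a1 := H α _ hφβ
    have a2 := H β _ hφα
    have b1 := H' α _ hφβ
    have b2 := H' β _ hφα
    have c1 := weak_curl_free hT hαβ (ha.integrable α) (ha.integrable β)
      (ha.curl_free α β hαβ) hφt (IsCoeff.const 1)
    have d1 := hφt.integral_dx_mul hT.le (hF α) β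
    have d2 := hφt.integral_dx_mul hT.le (hF β) α
    simp only [dt, dx] at a1 a2 b1 b2 c1 d1 d2 ⊢
    simp only [fderiv_fderiv_apply_comm hφ.smooth _ (0, unitVec _) (1, 0)] at a1 a2 b1 b2
    simp only [fderiv_fderiv_apply_comm hφ.smooth _ (0, unitVec β) (0, unitVec α)] at a1 b1
    have hz1 : ∀ z v, fderiv ℝ (fun _ : ℝ × E3 => (1 : ℝ)) z v = 0 := by simp
    simp only [hz1, mul_one, mul_zero, add_zero] at c1
    rw [integral_sub ((hφt.fderiv_apply _).integrable_mul (ha.integrable α))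
      ((hφt.fderiv_apply _).integrable_mul (ha.integrable β))] at c1
    rw [integral_add ((hφt.fderiv_apply _).integrable_mul (hF α).integrable)
      (hφt.integrable_mul ((hF α).integrable_fderiv T _))] at d1
    rw [integral_add ((hφt.fderiv_apply _).integrable_mul (hF β).integrable)
      (hφt.integrable_mul ((hF β).integrable_fderiv T _))] at d2
    simp only [mul_sub]
    rw [integral_sub (hφt.integrable_mul ((hF α).integrable_fderiv T _))
      (hφt.integrable_mul ((hF β).integrable_fderiv T _))]
    linarith

/-- A coefficient row that is curl-free almost everywhere is weakly curl-free. -/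
theorem isWeakCurlFree_of_ae {T : ℝ} (hT : 0 < T) {f : Fin 3 → ℝ × E3 → ℝ}
    (hf : ∀ α, IsCoeff (f α))
    (hcurl : ∀ᵐ z ∂(volQ T), ∀ α β, dx β (f α) z = dx α (f β) z) : IsWeakCurlFree T f where
  integrable := fun α => (hf α).integrable
  curl_free := by
    intro α β hαβ φ hφ
    have hφ := hφ.toIsTest
    have d1 := hφ.integral_dx_mul hT.le (hf α) β
    have d2 := hφ.integral_dx_mul hT.le (hf β) α
    simp only [dx] at hcurl d1 d2 ⊢
    rw [integral_add ((hφ.fderiv_apply _).integrable_mul (hf α).integrable)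
      (hφ.integrable_mul ((hf α).integrable_fderiv T _))] at d1
    rw [integral_add ((hφ.fderiv_apply _).integrable_mul (hf β).integrable)
      (hφ.integrable_mul ((hf β).integrable_fderiv T _))] at d2
    rw [integral_sub ((hφ.fderiv_apply _).integrable_mul (hf α).integrable)
      ((hφ.fderiv_apply _).integrable_mul (hf β).integrable)]
    have h3 : ∫ z, φ z * fderiv ℝ (f α) z (0, unitVec β) ∂(volQ T) =
        ∫ z, φ z * fderiv ℝ (f β) z (0, unitVec α) ∂(volQ T) := by
      refine integral_congr_ae ?_
      filter_upwards [hcurl] with z hz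
      rw [hz]
    linarith

theorem IsWeakCurlFree.sub_smul {T : ℝ} {a b : Fin 3 → ℝ × E3 → ℝ} (ha : IsWeakCurlFree T a)
    (hb : IsWeakCurlFree T b) (c : ℝ) : IsWeakCurlFree T fun α z => a α z - c * b α z where
  integrable := fun α => (ha.integrable α).sub ((hb.integrable α).const_mul c)
  curl_free := by
    intro α β hαβ φ hφ
    have h1 := ha.curl_free α β hαβ φ hφ
    have h2 := hb.curl_free α β hαβ φ hφ
    have hd := fun v => hφ.toIsTest.fderiv_apply v
    have e : ∀ z, dx β φ z * (a α z - c * b α z) - dx α φ z * (a β z - c * b β z) =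
        (dx β φ z * a α z - dx α φ z * a β z) - c * (dx β φ z * b α z - dx α φ z * b β z) :=
      fun z => by ring
    simp only [e]
    rw [integral_sub, integral_const_mul, h1, h2]
    · simp
    · exact ((hd _).integrable_mul (ha.integrable α)).sub ((hd _).integrable_mul (ha.integrable β))
    · exact (((hd _).integrable_mul (hb.integrable α)).sub
        ((hd _).integrable_mul (hb.integrable β))).const_mul c

/-! ### Null Lagrangians tested with functions of time -/

theorem IsTimeTest.isTest {T : ℝ} {φ : ℝ → ℝ} (hφ : IsTimeTest T φ) :
    IsTest T fun z => φ z.1 where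
  smooth := hφ.smooth.comp contDiff_fst
  periodic := fun _ _ _ => rfl
  support := by
    obtain ⟨b, hb, h0⟩ := hφ.support
    exact ⟨b, hb, fun t _ ht => h0 t ht⟩

theorem fderiv_comp_fst {φ : ℝ → ℝ} (hφ : ContDiff ℝ ∞ φ) (z v : ℝ × E3) :
    fderiv ℝ (fun z : ℝ × E3 => φ z.1) z v = deriv φ z.1 * v.1 := by
  have h1 := (hφ.differentiable (by simp) z.1).hasDerivAt.comp_hasFDerivAt z
    (hasFDerivAt_fst (𝕜 := ℝ) (p := z))
  rw [show fderiv ℝ (fun z : ℝ × E3 => φ z.1) z = _ from h1.fderiv]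
  simp

theorem IsTimeTest.dx_eq_zero {T : ℝ} {φ : ℝ → ℝ} (hφ : IsTimeTest T φ) (α : Fin 3)
    (z : ℝ × E3) : dx α (fun z => φ z.1) z = 0 := by
  rw [dx, fderiv_comp_fst hφ.smooth]; simp

theorem IsTimeTest.dt_eq {T : ℝ} {φ : ℝ → ℝ} (hφ : IsTimeTest T φ)
    (z : ℝ × E3) : dt (fun z => φ z.1) z = deriv φ z.1 := by
  rw [dt, fderiv_comp_fst hφ.smooth]; simp

section
variable {T : ℝ} {φ : ℝ → ℝ} {s : ℝ × E3 → ℝ}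

theorem IsTimeTest.integral_mul_dx (hT : 0 < T) (hφ : IsTimeTest T φ) (hs : IsCoeff s)
    (α : Fin 3) : ∫ z, φ z.1 * dx α s z ∂(volQ T) = 0 := by
  simpa [hφ.dx_eq_zero] using hφ.isTest.integral_dx_mul hT.le hs α

/-- Weak Piola identity for `∂ cof / ∂F`. -/
theorem IsTimeTest.integral_curl (hT : 0 < T) (hφ : IsTimeTest T φ) (hs : IsCoeff s)
    {a : Fin 3 → ℝ × E3 → ℝ} (ha : IsWeakCurlFree T a) {α β : Fin 3} (hαβ : α ≠ β) :
    ∫ z, φ z.1 * (dx β s z * a α z - dx α s z * a β z) ∂(volQ T) = 0 := by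
  have h := weak_curl_free hT hαβ (ha.integrable α) (ha.integrable β)
    (ha.curl_free α β hαβ) hφ.isTest hs
  rw [← h]
  refine integral_congr_ae (ae_of_all _ fun z => ?_)
  simp only [hφ.dx_eq_zero]
  ring

/-- Weak Piola identity for the polarized cofactor, `∂_α s (f × a)_α = curl (s f) · a`, where `f`
is a curl-free Lipschitz row. -/
theorem IsTimeTest.integral_curl_polar (hT : 0 < T) (hφ : IsTimeTest T φ) (hs : IsCoeff s)
    {f a : Fin 3 → ℝ × E3 → ℝ} (hf : ∀ α, IsCoeff (f α))
    (hcurl : ∀ᵐ z ∂(volQ T), ∀ α β, dx β (f α) z = dx α (f β) z) (ha : IsWeakCurlFree T a) :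
    ∫ z, φ z.1 * ∑ α, dx α s z * (f (α + 1) z * a (α + 2) z - f (α + 2) z * a (α + 1) z)
      ∂(volQ T) = 0 := by
  have h : ∀ β : Fin 3, ∫ z, φ z.1 * (dx (β + 2) (fun z => s z * f β z) z * a (β + 1) z -
      dx (β + 1) (fun z => s z * f β z) z * a (β + 2) z) ∂(volQ T) = 0 := fun β =>
    hφ.integral_curl hT (hs.mul (hf β)) ha (by fin_cases β <;> decide)
  have hint : ∀ β : Fin 3, Integrable (fun z => φ z.1 *
      (dx (β + 2) (fun z => s z * f β z) z * a (β + 1) z -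
      dx (β + 1) (fun z => s z * f β z) z * a (β + 2) z)) (volQ T) := fun β =>
    hφ.isTest.integrable_mul (((hs.mul (hf β)).integrable_fderiv_mul _ (ha.integrable _)).sub
      ((hs.mul (hf β)).integrable_fderiv_mul _ (ha.integrable _)))
  have hsum := Finset.sum_eq_zero (s := Finset.univ) fun β _ => h β
  rw [← integral_finsetSum _ fun β _ => hint β] at hsum
  rw [← hsum]
  refine integral_congr_ae ?_
  filter_upwards [hcurl, ae_volQ_of_ae hs.ae_differentiableAt,
    ae_all_iff.2 fun β => ae_volQ_of_ae (T := T) (hf β).ae_differentiableAt] with z hc hds hdf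
  have hp : ∀ β γ, dx γ (fun z => s z * f β z) z = dx γ s z * f β z + s z * dx γ (f β) z := by
    intro β γ
    rw [dx, fderiv_fun_mul hds (hdf β)]
    simp [dx]; ring
  simp only [hp, Fin.sum_univ_three, Fin.isValue, zero_add, Fin.reduceAdd]
  rw [hc 1 0, hc 2 0, hc 2 1]
  ring

end

/-! ### Integrability with respect to the Young measure -/

/-- Jensen's inequality for the square, with an integrable majorant. -/
theorem sq_norm_integral_le {X V : Type*} [MeasurableSpace X] [NormedAddCommGroup V]
    [NormedSpace ℝ V] {P : Measure X} [IsProbabilityMeasure P] {f : X → V} {g : X → ℝ}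
    (hf : Integrable f P) (hg : Integrable g P) (h : ∀ᵐ x ∂P, ‖f x‖ ^ 2 ≤ g x) :
    ‖∫ x, f x ∂P‖ ^ 2 ≤ ∫ x, g x ∂P := by
  set b := ∫ x, ‖f x‖ ∂P with hb
  have h1 : ‖∫ x, f x ∂P‖ ≤ b := norm_integral_le_integral_norm f
  have h2 : ∫ x, (2 * b * ‖f x‖ - b ^ 2) ∂P ≤ ∫ x, g x ∂P := by
    refine integral_mono_ae ((hf.norm.const_mul _).sub (integrable_const _)) hg ?_
    filter_upwards [h] with x hx
    show 2 * b * ‖f x‖ - b ^ 2 ≤ g x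
    nlinarith [sq_nonneg (‖f x‖ - b)]
  rw [integral_sub (hf.norm.const_mul _) (integrable_const _), integral_const_mul, ← hb] at h2
  simp only [integral_const, probReal_univ, smul_eq_mul, one_mul] at h2
  nlinarith [norm_nonneg (∫ x, f x ∂P)]

/-- States with non-negative entropy. -/
def posStates : Set State := {U | 0 ≤ U.2.2}

/-- Projection onto the states with non-negative entropy. -/
def toPos (U : State) : State := (U.1, U.2.1, max U.2.2 0)

theorem toPos_mem (U : State) : toPos U ∈ posStates :=
  show 0 ≤ max U.2.2 0 from le_max_right _ _

theorem toPos_eq {U : State} (h : U ∈ posStates) : toPos U = U := by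
  have h' : 0 ≤ U.2.2 := h
  simp [toPos, h']

theorem continuous_toPos : Continuous toPos := by unfold toPos; fun_prop

section
variable {e : Ext × ℝ → ℝ} {p q ρ l : ℝ}

theorem ConstitutiveAssumptions.continuous_moment (he : ConstitutiveAssumptions e p q ρ l) :
    Continuous (moment p q ρ l) := by
  have h1 := he.four_le_p
  have h2 := he.two_le_q
  have h3 := he.one_lt_ρ
  have h4 := he.one_lt_l
  have hc := continuous_ext
  unfold moment weight
  refine (by fun_prop : Continuous fun U : State => ‖U.2.1‖ ^ 2).add ?_
  refine ((Continuous.add ?_ ?_).add ?_).add ?_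
  · exact (hc.fst.fst.norm).rpow_const fun _ => Or.inr (by linarith)
  · exact (hc.fst.snd.fst.norm).rpow_const fun _ => Or.inr (by linarith)
  · exact (hc.fst.snd.snd.abs).rpow_const fun _ => Or.inr (by linarith)
  · exact (hc.snd.abs).rpow_const fun _ => Or.inr (by linarith)

/-- Functions of the state that are continuous for non-negative entropy and bounded by the moment
are integrable with respect to the Young measure. -/
structure IsAdmissible (p q ρ l : ℝ) {V : Type*} [NormedAddCommGroup V] (f : State → V) : Prop where
  continuousOn : ContinuousOn f posStates
  bound : ∃ C, 0 ≤ C ∧ ∀ U ∈ posStates, ‖f U‖ ≤ C * (1 + moment p q ρ l U)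

theorem IsAdmissible.continuous_comp_toPos {V : Type*} [NormedAddCommGroup V] {f : State → V}
    (hf : IsAdmissible p q ρ l f) : Continuous fun U => f (toPos U) :=
  hf.continuousOn.comp_continuous continuous_toPos toPos_mem

section
variable {Ω : Type*} [MeasurableSpace Ω] {P : Measure Ω} [IsFiniteMeasure P] {κ : Kernel Ω State}
  [IsMarkovKernel κ] {V : Type*} [NormedAddCommGroup V] [NormedSpace ℝ V]
  [FiniteDimensional ℝ V] {f : State → V}

theorem IsAdmissible.integrable_compProd (he : ConstitutiveAssumptions e p q ρ l)
    (hf : IsAdmissible p q ρ l f) (hpos : ∀ᵐ z ∂P, ∀ᵐ lam ∂(κ z), 0 ≤ lam.2.2)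
    (hmom : ∫⁻ z, ∫⁻ lam, ENNReal.ofReal (moment p q ρ l lam) ∂(κ z) ∂P < ⊤) :
    Integrable (fun x : Ω × State => f (toPos x.2)) (P.compProd κ) := by
  obtain ⟨C, hC0, hC⟩ := hf.bound
  have hm := he.continuous_moment
  have hmi : Integrable (fun x : Ω × State => moment p q ρ l x.2) (P.compProd κ) := by
    refine ⟨(hm.measurable.comp measurable_snd).aestronglyMeasurable, ?_⟩
    rw [hasFiniteIntegral_iff_ofReal (ae_of_all _ fun x => moment_nonneg _ _ _ _ _),
      Measure.lintegral_compProd (by fun_prop)]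
    exact hmom
  have hae : ∀ᵐ x ∂(P.compProd κ), toPos x.2 = x.2 := by
    refine Measure.ae_compProd_of_ae_ae ?_ ?_
    · exact measurableSet_eq_fun (continuous_toPos.measurable.comp measurable_snd) measurable_snd
    · filter_upwards [hpos] with z hz
      filter_upwards [hz] with lam hlam using toPos_eq hlam
  have : ProperSpace V := FiniteDimensional.proper_real V
  have hmeas : AEStronglyMeasurable (fun x : Ω × State => f (toPos x.2)) (P.compProd κ) :=
    (hf.continuous_comp_toPos.stronglyMeasurable.comp_measurable
      measurable_snd).aestronglyMeasurable
  refine (((integrable_const 1).add hmi).const_mul C).mono' hmeas ?_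
  filter_upwards [hae] with x hx
  have := hC _ (toPos_mem x.2)
  rw [hx] at this ⊢
  exact this

theorem IsAdmissible.ae_integrable (he : ConstitutiveAssumptions e p q ρ l)
    (hf : IsAdmissible p q ρ l f) (hpos : ∀ᵐ z ∂P, ∀ᵐ lam ∂(κ z), 0 ≤ lam.2.2)
    (hmom : ∫⁻ z, ∫⁻ lam, ENNReal.ofReal (moment p q ρ l lam) ∂(κ z) ∂P < ⊤) :
    ∀ᵐ z ∂P, Integrable f (κ z) := by
  have h := (hf.integrable_compProd he hpos hmom)
  filter_upwards [((Measure.integrable_compProd_iff h.1).1 h).1, hpos] with z hz hp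
  refine hz.congr ?_
  filter_upwards [hp] with lam hlam
  rw [toPos_eq hlam]

theorem IsAdmissible.integrable_integral (he : ConstitutiveAssumptions e p q ρ l)
    (hf : IsAdmissible p q ρ l f) (hpos : ∀ᵐ z ∂P, ∀ᵐ lam ∂(κ z), 0 ≤ lam.2.2)
    (hmom : ∫⁻ z, ∫⁻ lam, ENNReal.ofReal (moment p q ρ l lam) ∂(κ z) ∂P < ⊤) :
    Integrable (fun z => ∫ lam, f lam ∂(κ z)) P := by
  refine (Integrable.integral_compProd (hf.integrable_compProd he hpos hmom)).congr ?_
  filter_upwards [hpos] with z hp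
  refine integral_congr_ae ?_
  filter_upwards [hp] with lam hlam
  simp only [toPos_eq hlam]

end

theorem moment_ge_weight (U : State) : weight p q ρ l (ext U) ≤ moment p q ρ l U := by
  unfold moment; linarith [sq_nonneg ‖U.2.1‖]

theorem moment_ge_sq (U : State) : ‖U.2.1‖ ^ 2 ≤ moment p q ρ l U := by
  unfold moment; linarith [weight_nonneg p q ρ l (ext U)]

theorem continuousOn_comp_ext {V : Type*} [NormedAddCommGroup V] {f : Ext × ℝ → V}
    (hf : ContinuousOn f dom) : ContinuousOn (fun U => f (ext U)) posStates :=
  hf.comp continuous_ext.continuousOn fun _ hU => hU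

theorem ConstitutiveAssumptions.admissible_energy (he : ConstitutiveAssumptions e p q ρ l) :
    IsAdmissible p q ρ l (energy e) where
  continuousOn := (by fun_prop : Continuous fun U : State => (1 / 2) * ‖U.2.1‖ ^ 2).continuousOn.add
    (continuousOn_comp_ext he.smooth.continuousOn)
  bound := by
    obtain ⟨C, hC0, hC⟩ := he.exists_abs_energy_le
    refine ⟨1 + C, by positivity, fun U hU => ?_⟩
    have h1 := hC _ (ext_mem_dom hU)
    have h2 := moment_ge_weight (p := p) (q := q) (ρ := ρ) (l := l) U
    have h3 := moment_ge_sq (p := p) (q := q) (ρ := ρ) (l := l) U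
    have h4 : |energy e U| ≤ 1 / 2 * ‖U.2.1‖ ^ 2 + |e (ext U)| := by
      refine (abs_add_le _ _).trans_eq ?_
      rw [abs_of_nonneg (by positivity)]; rfl
    have h5 := mul_le_mul_of_nonneg_left h2 hC0
    have h6 := sq_nonneg ‖U.2.1‖
    rw [Real.norm_eq_abs]
    nlinarith

theorem ConstitutiveAssumptions.admissible_ext (he : ConstitutiveAssumptions e p q ρ l) :
    IsAdmissible p q ρ l ext where
  continuousOn := continuous_ext.continuousOn
  bound := ⟨1, zero_le_one, fun U _ => by
    have := he.norm_le (ext U)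
    have := moment_ge_weight (p := p) (q := q) (ρ := ρ) (l := l) U
    linarith⟩

theorem ConstitutiveAssumptions.norm_state_le (he : ConstitutiveAssumptions e p q ρ l)
    (U : State) : ‖U‖ ≤ 1 * (1 + moment p q ρ l U) := by
  have h1 := he.norm_le (ext U)
  have h2 := moment_ge_weight (p := p) (q := q) (ρ := ρ) (l := l) U
  have h3 := moment_ge_sq (p := p) (q := q) (ρ := ρ) (l := l) U
  have h4 : ‖U.1‖ ≤ ‖ext U‖ := (norm_fst_le (ext U).1).trans (norm_fst_le _)
  have h5 : ‖U.2.2‖ ≤ ‖ext U‖ := norm_snd_le (ext U)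
  have h6 : ‖U.2.1‖ ≤ 1 + ‖U.2.1‖ ^ 2 := by nlinarith [sq_nonneg (‖U.2.1‖ - 1)]
  refine max_le (by linarith) (max_le (by linarith) (by linarith))

theorem ConstitutiveAssumptions.admissible_id (he : ConstitutiveAssumptions e p q ρ l) :
    IsAdmissible p q ρ l (fun U : State => U) where
  continuousOn := continuousOn_id
  bound := ⟨1, zero_le_one, fun U _ => he.norm_state_le U⟩

theorem admissible_sq_v : IsAdmissible p q ρ l fun U : State => ‖U.2.1‖ ^ 2 where
  continuousOn := by fun_prop
  bound := ⟨1, zero_le_one, fun U _ => by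
    have := moment_ge_sq (p := p) (q := q) (ρ := ρ) (l := l) U
    rw [Real.norm_of_nonneg (sq_nonneg _)]; linarith⟩

theorem ConstitutiveAssumptions.admissible_sq_F (he : ConstitutiveAssumptions e p q ρ l) :
    IsAdmissible p q ρ l fun U : State => ‖U.1‖ ^ 2 where
  continuousOn := by fun_prop
  bound := ⟨1, zero_le_one, fun U _ => by
    have h1 := moment_ge_weight (p := p) (q := q) (ρ := ρ) (l := l) U
    have h2 := rpow_le_one_add_rpow (norm_nonneg U.1) (a := 2) (b := p) (by norm_num)
      (by linarith [he.four_le_p])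
    have k2 := Real.rpow_nonneg (norm_nonneg (cof U.1)) q
    have k3 := Real.rpow_nonneg (abs_nonneg ((toMatrix U.1).det)) ρ
    have k4 := Real.rpow_nonneg (abs_nonneg (U.2.2)) l
    simp only [weight, ext, Phi] at h1
    rw [Real.rpow_two] at h2
    rw [Real.norm_of_nonneg (sq_nonneg _)]; linarith⟩

theorem ConstitutiveAssumptions.admissible_sq_cof (he : ConstitutiveAssumptions e p q ρ l) :
    IsAdmissible p q ρ l fun U : State => ‖cof U.1‖ ^ 2 where
  continuousOn := by
    have := continuous_cof
    exact (by fun_prop : Continuous fun U : State => ‖cof U.1‖ ^ 2).continuousOn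
  bound := ⟨1, zero_le_one, fun U _ => by
    have h1 := moment_ge_weight (p := p) (q := q) (ρ := ρ) (l := l) U
    have h2 := rpow_le_one_add_rpow (norm_nonneg (cof U.1)) (a := 2) (b := q) (by norm_num)
      he.two_le_q
    have k2 := Real.rpow_nonneg (norm_nonneg U.1) p
    have k3 := Real.rpow_nonneg (abs_nonneg ((toMatrix U.1).det)) ρ
    have k4 := Real.rpow_nonneg (abs_nonneg (U.2.2)) l
    simp only [weight, ext, Phi] at h1
    rw [Real.rpow_two] at h2
    rw [Real.norm_of_nonneg (sq_nonneg _)]; linarith⟩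

theorem ConstitutiveAssumptions.admissible_stress (he : ConstitutiveAssumptions e p q ρ l)
    (i α : Fin 3) : IsAdmissible p q ρ l fun U : State => stress e U.1 U.2.2 i α where
  continuousOn := (continuousOn_comp_ext he.continuousOn_grad).clm_apply
    ((((continuous_dPhi i α).comp continuous_fst).prodMk continuous_const).continuousOn)
  bound := by
    obtain ⟨C, hC0, hC⟩ := he.exists_stress_le
    refine ⟨C, hC0, fun U hU => (hC U hU i α).trans ?_⟩
    gcongr
    exact moment_ge_weight U

theorem ConstitutiveAssumptions.admissible_inv_theta (he : ConstitutiveAssumptions e p q ρ l) :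
    IsAdmissible p q ρ l fun U : State => 1 / theta e (ext U) where
  continuousOn := by
    obtain ⟨δ, hδ, hθ⟩ := he.temperature_pos
    exact continuousOn_const.div (continuousOn_comp_ext he.continuousOn_theta)
      fun U hU => (hδ.trans_le (hθ _ (ext_mem_dom hU))).ne'
  bound := by
    obtain ⟨δ, hδ, hθ⟩ := he.temperature_pos
    refine ⟨1 / δ, by positivity, fun U hU => ?_⟩
    have h1 := hθ _ (ext_mem_dom hU)
    rw [Real.norm_of_nonneg (one_div_nonneg.2 (hδ.le.trans h1))]
    have h2 := moment_nonneg p q ρ l U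
    calc 1 / theta e (ext U) ≤ 1 / δ * 1 := by
          rw [mul_one]; exact one_div_le_one_div_of_le hδ h1
      _ ≤ _ := by gcongr; linarith

end

/-! ### The pointwise estimate of the error terms -/

/-- The gradient of the energy at a state. -/
abbrev grad (e : Ext × ℝ → ℝ) (V : State) : Ext × ℝ →L[ℝ] ℝ := fderivWithin ℝ e dom (ext V)

/-- The Hessian of the energy at a state. -/
abbrev hess (e : Ext × ℝ → ℝ) (V : State) : Ext × ℝ →L[ℝ] Ext × ℝ →L[ℝ] ℝ :=
  fderivWithin ℝ (fderivWithin ℝ e dom) dom (ext V)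

/-- The equations of thermoelasticity with heat supply `s` at a single point, for the value `V` and
the derivative `D` of a solution there. -/
structure SolvesAt (e : Ext × ℝ → ℝ) (s : ℝ) (V : State) (D : ℝ × E3 →L[ℝ] State) : Prop where
  eq_F : ∀ i α, (D (1, 0)).1 (i, α) = (D (0, unitVec α)).2.1 i
  eq_entropy : (D (1, 0)).2.2 = s / theta e (ext V)
  eq_velocity : ∀ i, (D (1, 0)).2.1 i =
    ∑ α, hess e V (dExt V (D (0, unitVec α))) (dPhi V.1 i α, 0)

/-- The error terms that are nonlinear in the state. -/
def production (e : Ext × ℝ → ℝ) (s : ℝ) (V : State) (D : ℝ × E3 →L[ℝ] State) (lam : State) : ℝ :=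
  s * (1 - theta e (ext V) * (1 / theta e (ext lam))) -
    hess e V (dExt V (D (1, 0))) (ext lam - ext V) +
    ∑ i, ∑ α, (D (0, unitVec α)).2.1 i *
      (stress e lam.1 lam.2.2 i α - grad e V (dPhi lam.1 i α, 0))

/-- `∂Φ/∂F_{iα}(F)` up to the quadratic error `cof (F - G)` in the last component. -/
def nullTensor (F G : Mat3) (i α : Fin 3) : Ext := dPhi F i α - (0, 0, cof (F - G) (i, α))

/-- The null Lagrangian `∂_α (v_i ∂e/∂ξ^B) T^B_{iα}`, with `T` the tensor `nullTensor`. -/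
def nullForm (e : Ext × ℝ → ℝ) (V : State) (D : ℝ × E3 →L[ℝ] State) (F : Mat3) : ℝ :=
  ∑ i, ∑ α, ((D (0, unitVec α)).2.1 i * grad e V (nullTensor F V.1 i α, 0) +
    V.2.1 i * hess e V (dExt V (D (0, unitVec α))) (nullTensor F V.1 i α, 0))

/-- The right-hand side of the relative energy inequality, where `U`, `τ` and `S` stand for the
averages of the state, of `1 / θ` and of the stress. -/
def meanProduction (e : Ext × ℝ → ℝ) (s : ℝ) (V : State) (D : ℝ × E3 →L[ℝ] State) (U : State)
    (τ : ℝ) (S : Fin 3 → Fin 3 → ℝ) : ℝ :=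
  s * (1 - theta e (ext V) * τ) - hess e V (dExt V (D (1, 0))) (ext U - ext V) -
    (∑ i, (D (1, 0)).2.1 i * (U.2.1 i - V.2.1 i)) +
    (∑ i, ∑ α, (hess e V (dExt V (D (0, unitVec α))) (U.2.1 i • dPhi U.1 i α, 0) +
      (D (0, unitVec α)).2.1 i * S i α)) - nullForm e V D U.1

section
variable {e : Ext × ℝ → ℝ} {p q ρ l s : ℝ} {V : State} {D : ℝ × E3 →L[ℝ] State}

theorem SolvesAt.dExt_eq (h : SolvesAt e s V D) : dExt V (D (1, 0)) =
    (∑ i, ∑ α, (D (0, unitVec α)).2.1 i • ((dPhi V.1 i α, 0) : Ext × ℝ)) +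
      (s / theta e (ext V)) • ((0, 1) : Ext × ℝ) := by
  rw [dExt, fderiv_Phi_eq_sum, h.eq_entropy]
  simp only [h.eq_F]
  ext1
  · simp [Prod.fst_sum]
  · simp [Prod.snd_sum]

theorem SolvesAt.production_eq (he : ConstitutiveAssumptions e p q ρ l) (h : SolvesAt e s V D)
    (hV : 0 ≤ V.2.2) {lam : State} (hlam : 0 ≤ lam.2.2) :
    production e s V D lam =
      s / theta e (ext V) * (grad e lam - grad e V - hess e V (ext lam - ext V)) (0, 1) +
      s * ((theta e (ext lam) - theta e (ext V)) *
        (1 / theta e (ext lam) - 1 / theta e (ext V))) +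
      ∑ i, ∑ α, (D (0, unitVec α)).2.1 i *
        ((grad e lam - grad e V - hess e V (ext lam - ext V)) (dPhi V.1 i α, 0) +
          (grad e lam - grad e V) (dPhi lam.1 i α - dPhi V.1 i α, 0)) := by
  obtain ⟨δ, hδ, hθ⟩ := he.temperature_pos
  have t1 := (hδ.trans_le (hθ _ (ext_mem_dom hV))).ne'
  have t2 := (hδ.trans_le (hθ _ (ext_mem_dom hlam))).ne'
  have key : hess e V (dExt V (D (1, 0))) (ext lam - ext V) =
      (∑ i, ∑ α, (D (0, unitVec α)).2.1 i * hess e V (ext lam - ext V) (dPhi V.1 i α, 0)) +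
        s / theta e (ext V) * hess e V (ext lam - ext V) (0, 1) := by
    rw [he.hess_symm (ext_mem_dom hV), h.dExt_eq]
    simp only [map_add, map_sum, map_smul, smul_eq_mul]
  have hst : ∀ i α, stress e lam.1 lam.2.2 i α = grad e lam (dPhi lam.1 i α, 0) := fun i α => rfl
  have hsub : ∀ i α, ((dPhi lam.1 i α - dPhi V.1 i α, 0) : Ext × ℝ) =
      (dPhi lam.1 i α, 0) - (dPhi V.1 i α, 0) := fun i α => by simp
  have hsplit : ∀ i α, (D (0, unitVec α)).2.1 i *
        ((grad e lam - grad e V - hess e V (ext lam - ext V)) (dPhi V.1 i α, 0) +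
          (grad e lam - grad e V) (dPhi lam.1 i α - dPhi V.1 i α, 0)) =
      (D (0, unitVec α)).2.1 i * (stress e lam.1 lam.2.2 i α - grad e V (dPhi lam.1 i α, 0)) -
        (D (0, unitVec α)).2.1 i * hess e V (ext lam - ext V) (dPhi V.1 i α, 0) := by
    intro i α
    rw [hst, hsub]
    simp only [sub_apply, map_sub]
    ring
  simp only [hsplit, Finset.sum_sub_distrib]
  rw [production, key]
  have e1 : grad e V (0, 1) = theta e (ext V) := rfl
  have e2 : grad e lam (0, 1) = theta e (ext lam) := rfl
  simp only [sub_apply]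
  rw [e1, e2]
  have e3 : s / theta e (ext V) * (theta e (ext lam) - theta e (ext V)) +
      s * ((theta e (ext lam) - theta e (ext V)) * (1 / theta e (ext lam) - 1 / theta e (ext V))) =
      s * (1 - theta e (ext V) * (1 / theta e (ext lam))) := by
    field_simp
    ring
  linear_combination -e3

theorem abs_velocity_le {K : ℝ} (hD : ‖D‖ ≤ K) (i α : Fin 3) :
    |(D (0, unitVec α)).2.1 i| ≤ K := by
  have h1 : ‖((0, unitVec α) : ℝ × E3)‖ ≤ 1 := by simp [Prod.norm_mk]
  have h2 : ‖(D (0, unitVec α)).2.1‖ ≤ ‖D (0, unitVec α)‖ :=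
    (norm_fst_le _).trans (norm_snd_le _)
  have h3 : |(D (0, unitVec α)).2.1 i| ≤ ‖(D (0, unitVec α)).2.1‖ :=
    PiLp.norm_apply_le (D (0, unitVec α)).2.1 i
  exact h3.trans (h2.trans (((D.le_opNorm_of_le h1).trans_eq (mul_one _)).trans hD))

theorem abs_sum_sum_le {f : Fin 3 → Fin 3 → ℝ} {C : ℝ} (h : ∀ i α, |f i α| ≤ C) :
    |∑ i, ∑ α, f i α| ≤ 9 * C := by
  refine (Finset.abs_sum_le_sum_abs _ _).trans ?_
  calc ∑ i, |∑ α, f i α| ≤ ∑ _i : Fin 3, 3 * C := by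
        refine Finset.sum_le_sum fun i _ => (Finset.abs_sum_le_sum_abs _ _).trans ?_
        calc ∑ α, |f i α| ≤ ∑ _α : Fin 3, C := Finset.sum_le_sum fun α _ => h i α
          _ = 3 * C := by simp
    _ = 9 * C := by simp; ring

/-- The nonlinear error terms are controlled by the relative energy. -/
theorem ConstitutiveAssumptions.exists_production_le (he : ConstitutiveAssumptions e p q ρ l)
    (M K B : ℝ) : ∃ C, 0 ≤ C ∧ ∀ s V D, |s| ≤ B → V ∈ Gam M → ‖D‖ ≤ K → SolvesAt e s V D →
      ∀ lam : State, 0 ≤ lam.2.2 → |production e s V D lam| ≤ C * relEnergy e lam V := by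
  obtain ⟨A, hA0, hA⟩ := he.exists_errors_le M
  obtain ⟨δ, hδ, hθ⟩ := he.temperature_pos
  set N : ℝ := 1 + 12 * |M| + 6 * |M| ^ 2 with hN
  refine ⟨|B| / δ * A + |B| * A + 9 * (|K| * (A * N + A)), by positivity,
    fun s V D hs hV hD h lam hlam => ?_⟩
  obtain ⟨a1, a2, a3⟩ := hA lam V hlam hV
  have hrel := he.relEnergy_nonneg hlam hV.2.2.2
  have hs' : |s| ≤ |B| := hs.trans (le_abs_self B)
  have hD' : ‖D‖ ≤ |K| := hD.trans (le_abs_self K)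
  have hT : 0 < theta e (ext V) := hδ.trans_le (hθ _ (ext_mem_dom hV.2.2.2))
  set E := grad e lam - grad e V - hess e V (ext lam - ext V) with hE
  have b1 : |s / theta e (ext V) * E (0, 1)| ≤ |B| / δ * (A * relEnergy e lam V) := by
    rw [abs_mul, abs_div, abs_of_pos hT]
    refine mul_le_mul (div_le_div₀ (abs_nonneg _) hs' hδ (hθ _ (ext_mem_dom hV.2.2.2))) ?_
      (abs_nonneg _) (by positivity)
    have := E.le_opNorm_of_le (x := ((0, 1) : Ext × ℝ)) (c := 1) (by simp [Prod.norm_mk])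
    exact (this.trans_eq (mul_one _)).trans a1
  have b2 : |s * ((theta e (ext lam) - theta e (ext V)) *
      (1 / theta e (ext lam) - 1 / theta e (ext V)))| ≤ |B| * (A * relEnergy e lam V) := by
    rw [abs_mul]
    exact mul_le_mul hs' a2 (abs_nonneg _) (abs_nonneg _)
  have b3 : ∀ i α, |(D (0, unitVec α)).2.1 i * (E (dPhi V.1 i α, 0) +
      (grad e lam - grad e V) (dPhi lam.1 i α - dPhi V.1 i α, 0))| ≤
      |K| * (A * N + A) * relEnergy e lam V := by
    intro i α
    rw [abs_mul, mul_assoc]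
    refine mul_le_mul (abs_velocity_le hD' i α) ?_ (abs_nonneg _) (abs_nonneg _)
    refine (abs_add_le _ _).trans ?_
    have hV1 : ‖V.1‖ ≤ |M| := hV.1.trans (le_abs_self M)
    have n1 : ‖((dPhi V.1 i α, 0) : Ext × ℝ)‖ ≤ N := by
      have := norm_dPhi_le V.1 i α
      rw [Prod.norm_mk, norm_zero, max_eq_left (norm_nonneg _)]
      refine this.trans ?_
      rw [hN]; gcongr
    have n2 := E.le_opNorm_of_le n1
    have n3 : ‖E‖ * N ≤ A * relEnergy e lam V * N :=
      mul_le_mul_of_nonneg_right a1 (by positivity)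
    have n4 := a3 i α
    rw [Real.norm_eq_abs] at n2
    calc _ ≤ A * relEnergy e lam V * N + A * relEnergy e lam V := add_le_add (n2.trans n3) n4
      _ = _ := by ring
  rw [h.production_eq he hV.2.2.2 hlam]
  refine (abs_add_le _ _).trans ?_
  have b4 := abs_sum_sum_le b3
  have b5 := abs_add_le (s / theta e (ext V) * E (0, 1)) (s * ((theta e (ext lam) -
    theta e (ext V)) * (1 / theta e (ext lam) - 1 / theta e (ext V))))
  calc _ ≤ |B| / δ * (A * relEnergy e lam V) + |B| * (A * relEnergy e lam V) +
        9 * (|K| * (A * N + A) * relEnergy e lam V) :=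
        add_le_add (b5.trans (add_le_add b1 b2)) b4
    _ = _ := by ring

/-- Averaging leaves an error that is quadratic in the difference of the averages. -/
theorem SolvesAt.meanProduction_sub (h : SolvesAt e s V D) (U : State) (τ : ℝ)
    (S : Fin 3 → Fin 3 → ℝ) :
    meanProduction e s V D U τ S - (s * (1 - theta e (ext V) * τ) -
      hess e V (dExt V (D (1, 0))) (ext U - ext V) + ∑ i, ∑ α, (D (0, unitVec α)).2.1 i *
        (S i α - grad e V (dPhi U.1 i α, 0))) =
    ∑ i, ∑ α, ((U.2.1 i - V.2.1 i) * hess e V (dExt V (D (0, unitVec α)))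
        (dPhi U.1 i α - dPhi V.1 i α, 0) +
      ((D (0, unitVec α)).2.1 i * grad e V ((0, 0, cof (U.1 - V.1) (i, α)), 0) +
        V.2.1 i * hess e V (dExt V (D (0, unitVec α))) ((0, 0, cof (U.1 - V.1) (i, α)), 0))) := by
  have e1 : ∑ i, (D (1, 0)).2.1 i * (U.2.1 i - V.2.1 i) =
      ∑ i, ∑ α, hess e V (dExt V (D (0, unitVec α))) (dPhi V.1 i α, 0) *
        (U.2.1 i - V.2.1 i) := by
    simp only [h.eq_velocity, Finset.sum_mul]
  have hsub : ∀ a b : Ext, ((a - b, 0) : Ext × ℝ) = (a, 0) - (b, 0) := fun a b => by simp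
  have hsm : ∀ (c : ℝ) (a : Ext), ((c • a, 0) : Ext × ℝ) = c • (a, 0) := fun c a => by simp
  rw [meanProduction, nullForm, e1]
  simp only [nullTensor, hsub, hsm, map_sub, map_smul, smul_eq_mul]
  have : ∀ a b c d f g : ℝ, a - b - c + d - f - (a - b + g) = d - c - f - g := by intros; ring
  rw [this]
  simp only [← Finset.sum_sub_distrib]
  refine Finset.sum_congr rfl fun i _ => Finset.sum_congr rfl fun α _ => ?_
  ring

theorem norm_dExt_le {M K : ℝ} (hV : ‖V.1‖ ≤ |M|) (hD : ‖D‖ ≤ |K|) (α : Fin 3) :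
    ‖dExt V (D (0, unitVec α))‖ ≤ 9 * (|K| * (1 + 12 * |M| + 6 * |M| ^ 2)) + |K| := by
  have h1 : ‖((0, unitVec α) : ℝ × E3)‖ ≤ 1 := by simp [Prod.norm_mk]
  have h2 : ‖D (0, unitVec α)‖ ≤ |K| := ((D.le_opNorm_of_le h1).trans_eq (mul_one _)).trans hD
  have h3 : ‖(D (0, unitVec α)).1‖ ≤ |K| := (norm_fst_le _).trans h2
  have h4 : ‖(D (0, unitVec α)).2.2‖ ≤ |K| := ((norm_snd_le _).trans (norm_snd_le _)).trans h2
  have h5 : ‖fderiv ℝ Phi V.1 (D (0, unitVec α)).1‖ ≤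
      9 * (|K| * (1 + 12 * |M| + 6 * |M| ^ 2)) := by
    rw [fderiv_Phi_eq_sum]
    refine (norm_sum_le _ _).trans ?_
    calc _ ≤ ∑ _i : Fin 3, ∑ _β : Fin 3, |K| * (1 + 12 * |M| + 6 * |M| ^ 2) := by
          refine Finset.sum_le_sum fun i _ => (norm_sum_le _ _).trans
            (Finset.sum_le_sum fun β _ => ?_)
          rw [norm_smul]
          refine mul_le_mul ((PiLp.norm_apply_le _ _).trans h3) ?_ (norm_nonneg _) (abs_nonneg _)
          refine (norm_dPhi_le V.1 i β).trans ?_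
          gcongr
      _ = _ := by simp; ring
  rw [dExt, Prod.norm_mk]
  refine max_le (h5.trans ?_) (h4.trans ?_)
  · linarith [abs_nonneg K]
  · have : 0 ≤ 9 * (|K| * (1 + 12 * |M| + 6 * |M| ^ 2)) := by positivity
    linarith

/-- The error of averaging is bounded by the squared distance of the averages. -/
theorem ConstitutiveAssumptions.exists_meanProduction_sub_le
    (he : ConstitutiveAssumptions e p q ρ l) (M K : ℝ) : ∃ C, 0 ≤ C ∧ ∀ s V D, V ∈ Gam M →
      ‖D‖ ≤ K → SolvesAt e s V D → ∀ (U : State) (τ : ℝ) (S : Fin 3 → Fin 3 → ℝ),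
      meanProduction e s V D U τ S ≤ (s * (1 - theta e (ext V) * τ) -
        hess e V (dExt V (D (1, 0))) (ext U - ext V) + ∑ i, ∑ α, (D (0, unitVec α)).2.1 i *
          (S i α - grad e V (dPhi U.1 i α, 0))) +
        C * (‖U.2.1 - V.2.1‖ ^ 2 + ‖ext U - ext V‖ ^ 2) := by
  obtain ⟨R, hR⟩ := exists_ext_mem_domBall M
  obtain ⟨G, hG0, hG⟩ := exists_bound_on_domBall he.continuousOn_grad R
  obtain ⟨H, hH0, hH⟩ := exists_bound_on_domBall (f := fderivWithin ℝ (fderivWithin ℝ e dom) dom)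
    (he.contDiffOn_grad.continuousOn_fderivWithin uniqueDiffOn_dom (by norm_num)) R
  set N : ℝ := 9 * (|K| * (1 + 12 * |M| + 6 * |M| ^ 2)) + |K| with hN
  have hN0 : 0 ≤ N := by positivity
  refine ⟨9 * (6 * (H * N) + 6 * (|K| * G + |M| * (H * N))), by positivity,
    fun s V D hV hD h U τ S => ?_⟩
  have hV1 : ‖V.1‖ ≤ |M| := hV.1.trans (le_abs_self M)
  have hD' : ‖D‖ ≤ |K| := hD.trans (le_abs_self K)
  set a := ‖U.2.1 - V.2.1‖ with ha
  set b := ‖ext U - ext V‖ with hb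
  have ha0 : 0 ≤ a := norm_nonneg _
  have hb0 : 0 ≤ b := norm_nonneg _
  have hHn : ∀ α, ‖hess e V (dExt V (D (0, unitVec α)))‖ ≤ H * N := fun α =>
    (ContinuousLinearMap.le_opNorm _ _).trans (mul_le_mul (hH _ (hR V hV))
      (norm_dExt_le hV1 hD' α) (norm_nonneg _) hH0)
  have hcof : ∀ i α, ‖(((0, 0, cof (U.1 - V.1) (i, α)), 0) : Ext × ℝ)‖ ≤ 6 * b ^ 2 := by
    intro i α
    have h1 : ‖U.1 - V.1‖ ≤ b := (norm_fst_le (ext U - ext V).1).trans (norm_fst_le _)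
    have h2 := (PiLp.norm_apply_le (cof (U.1 - V.1)) (i, α)).trans (norm_cof_le _)
    simp only [Prod.norm_mk, norm_zero]
    have h3 : 6 * ‖U.1 - V.1‖ ^ 2 ≤ 6 * b ^ 2 := by gcongr
    have h4 : 0 ≤ 6 * b ^ 2 := by positivity
    exact max_le (max_le h4 (max_le h4 (h2.trans h3))) h4
  have hterm : ∀ i α, |(U.2.1 i - V.2.1 i) * hess e V (dExt V (D (0, unitVec α)))
        (dPhi U.1 i α - dPhi V.1 i α, 0) +
      ((D (0, unitVec α)).2.1 i * grad e V ((0, 0, cof (U.1 - V.1) (i, α)), 0) +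
        V.2.1 i * hess e V (dExt V (D (0, unitVec α))) ((0, 0, cof (U.1 - V.1) (i, α)), 0))| ≤
      (6 * (H * N) + 6 * (|K| * G + |M| * (H * N))) * (a ^ 2 + b ^ 2) := by
    intro i α
    have t1 : |U.2.1 i - V.2.1 i| ≤ a := PiLp.norm_apply_le (U.2.1 - V.2.1) i
    have t2 : |hess e V (dExt V (D (0, unitVec α))) (dPhi U.1 i α - dPhi V.1 i α, 0)| ≤
        H * N * (12 * b) := by
      refine (ContinuousLinearMap.le_opNorm_of_le _ (c := 12 * b) ?_).trans
        (mul_le_mul_of_nonneg_right (hHn α) (by positivity))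
      rw [Prod.norm_mk, norm_zero, max_eq_left (norm_nonneg _)]
      exact norm_dPhi_sub_le U V i α
    have t3 : |grad e V ((0, 0, cof (U.1 - V.1) (i, α)), 0)| ≤ G * (6 * b ^ 2) :=
      (ContinuousLinearMap.le_opNorm_of_le _ (hcof i α)).trans
        (mul_le_mul_of_nonneg_right (hG _ (hR V hV)) (by positivity))
    have t4 : |hess e V (dExt V (D (0, unitVec α))) ((0, 0, cof (U.1 - V.1) (i, α)), 0)| ≤
        H * N * (6 * b ^ 2) :=
      (ContinuousLinearMap.le_opNorm_of_le _ (hcof i α)).trans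
        (mul_le_mul_of_nonneg_right (hHn α) (by positivity))
    have t5 := abs_velocity_le hD' i α
    have t6 : |V.2.1 i| ≤ |M| :=
      (PiLp.norm_apply_le V.2.1 i).trans (hV.2.1.trans (le_abs_self M))
    have u1 := mul_le_mul t1 t2 (abs_nonneg _) ha0
    have u2 := mul_le_mul t5 t3 (abs_nonneg _) (abs_nonneg K)
    have u3 := mul_le_mul t6 t4 (abs_nonneg _) (abs_nonneg M)
    rw [← abs_mul] at u1 u2 u3
    refine (abs_add_le _ _).trans ((add_le_add u1 ((abs_add_le _ _).trans (add_le_add u2 u3))).trans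
      ?_)
    have hHN : 0 ≤ H * N := by positivity
    have hQ : 0 ≤ |K| * G + |M| * (H * N) := by positivity
    have w1 : H * N * (2 * (a * b)) ≤ H * N * (a ^ 2 + b ^ 2) :=
      mul_le_mul_of_nonneg_left (by nlinarith [sq_nonneg (a - b)]) hHN
    have w2 : (|K| * G + |M| * (H * N)) * b ^ 2 ≤ (|K| * G + |M| * (H * N)) * (a ^ 2 + b ^ 2) :=
      mul_le_mul_of_nonneg_left (by nlinarith [sq_nonneg a]) hQ
    linarith
  have := (le_abs_self _).trans (abs_sum_sum_le hterm)
  rw [← h.meanProduction_sub U τ S] at this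
  linarith

end

/-! ### Averaging over the Young measure -/

/-- A probability measure on the states of non-negative entropy whose average `U` commutes with
the null Lagrangians and which has the moments that occur in the relative energy inequality. -/
structure IsAveraging (e : Ext × ℝ → ℝ) (μ : Measure State) (U : State) : Prop where
  pos : ∀ᵐ lam ∂μ, 0 ≤ lam.2.2
  integrable_energy : Integrable (energy e) μ
  integrable_id : Integrable (fun lam : State => lam) μ
  integrable_Phi : Integrable (fun lam : State => Phi lam.1) μ
  integrable_inv_theta : Integrable (fun lam => 1 / theta e (ext lam)) μ
  integrable_stress : ∀ i α, Integrable (fun lam => stress e lam.1 lam.2.2 i α) μ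
  average : U = ∫ lam, lam ∂μ
  average_Phi : ∫ lam, Phi lam.1 ∂μ = Phi U.1

/-- The average of the relative energy, in terms of the average `U` of the state and the average
`m` of the energy. -/
def meanRelEnergy (e : Ext × ℝ → ℝ) (V U : State) (m : ℝ) : ℝ :=
  m - energy e V - grad e V (ext U - ext V) - ∑ i, V.2.1 i * (U.2.1 i - V.2.1 i)

/-- For a Dirac measure the mean relative energy is the relative energy. -/
theorem relEnergy_eq (e : Ext × ℝ → ℝ) (U V : State) :
    relEnergy e U V = meanRelEnergy e V U (energy e U) := by
  have h1 : ∀ v : E3, ‖v‖ ^ 2 = ∑ i, v i ^ 2 := fun v => EuclideanSpace.real_norm_sq_eq v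
  have h2 : ∑ i, (U.2.1 - V.2.1) i ^ 2 = ∑ i, (U.2.1 i - V.2.1 i) ^ 2 := rfl
  have e1 : ∀ W : State, e (Phi W.1, W.2.2) = e (ext W) := fun W => rfl
  rw [relEnergy, meanRelEnergy, energy, energy, h1, h1, h1, h2, e1, e1]
  simp only [Fin.sum_univ_three]
  ring

/-- `∂Φ/∂F_{iα}` is an affine function of `Φ`. -/
theorem exists_dPhi_eq_clm (i α : Fin 3) :
    ∃ A : Ext →L[ℝ] Ext, ∀ F, dPhi F i α = (unitMat i α, 0, 0) + A (Phi F) := by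
  let A : Ext →ₗ[ℝ] Ext :=
    { toFun := fun x => (0, cofPolar x.1 (unitMat i α), x.2.1 (i, α))
      map_add' := fun x y => by simp [cofPolar_add_left]
      map_smul' := fun c x => by
        simp [cofPolar_comm _ (unitMat i α), cofPolar_smul_right] }
  refine ⟨A.toContinuousLinearMap, fun F => ?_⟩
  rw [dPhi_eq]
  simp [A, Phi]

namespace IsAveraging
variable {e : Ext × ℝ → ℝ} {μ : Measure State} {U : State}

theorem integrable_ext (h : IsAveraging e μ U) : Integrable ext μ :=
  h.integrable_Phi.prodMk h.integrable_id.snd.snd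

theorem integrable_dPhi [IsFiniteMeasure μ] (h : IsAveraging e μ U) (i α : Fin 3) :
    Integrable (fun lam : State => dPhi lam.1 i α) μ := by
  obtain ⟨A, hA⟩ := exists_dPhi_eq_clm i α
  simp only [hA]
  exact (integrable_const _).add (A.integrable_comp h.integrable_Phi)

theorem integral_ext (h : IsAveraging e μ U) : ∫ lam, ext lam ∂μ = ext U := by
  have h1 : U.2.2 = ∫ lam, lam.2.2 ∂μ := by
    rw [h.average]
    exact (((ContinuousLinearMap.snd ℝ E3 ℝ).comp
      (ContinuousLinearMap.snd ℝ Mat3 (E3 × ℝ))).integral_comp_comm h.integrable_id).symm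
  have h2 := integral_pair h.integrable_Phi h.integrable_id.snd.snd
  rw [h.average_Phi, ← h1] at h2
  exact h2

theorem integral_velocity (h : IsAveraging e μ U) : ∫ lam, lam.2.1 ∂μ = U.2.1 := by
  rw [h.average]
  exact ((ContinuousLinearMap.fst ℝ E3 ℝ).comp
    (ContinuousLinearMap.snd ℝ Mat3 (E3 × ℝ))).integral_comp_comm h.integrable_id

theorem integral_velocity_apply (h : IsAveraging e μ U) (i : Fin 3) :
    ∫ lam, lam.2.1 i ∂μ = U.2.1 i := by
  rw [← h.integral_velocity]
  exact (EuclideanSpace.proj (𝕜 := ℝ) i).integral_comp_comm h.integrable_id.snd.fst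

theorem integral_dPhi [IsProbabilityMeasure μ] (h : IsAveraging e μ U) (i α : Fin 3) :
    ∫ lam, dPhi lam.1 i α ∂μ = dPhi U.1 i α := by
  obtain ⟨A, hA⟩ := exists_dPhi_eq_clm i α
  simp only [hA]
  rw [integral_add (integrable_const _) (A.integrable_comp h.integrable_Phi),
    A.integral_comp_comm h.integrable_Phi, h.average_Phi]
  simp

theorem integrable_velocity_apply (h : IsAveraging e μ U) (i : Fin 3) :
    Integrable (fun lam : State => lam.2.1 i) μ :=
  (EuclideanSpace.proj (𝕜 := ℝ) i).integrable_comp h.integrable_id.snd.fst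

variable [IsProbabilityMeasure μ]

theorem integrable_ext_sub (h : IsAveraging e μ U) (V : State) :
    Integrable (fun lam => ext lam - ext V) μ := h.integrable_ext.sub (integrable_const _)

theorem integral_ext_sub (h : IsAveraging e μ U) (V : State) :
    ∫ lam, (ext lam - ext V) ∂μ = ext U - ext V := by
  rw [integral_sub h.integrable_ext (integrable_const _), h.integral_ext]; simp

theorem integrable_relEnergy (h : IsAveraging e μ U) (V : State) :
    Integrable (fun lam => relEnergy e lam V) μ := by
  simp only [relEnergy_eq, meanRelEnergy]
  exact ((h.integrable_energy.sub (integrable_const _)).sub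
    ((grad e V).integrable_comp (h.integrable_ext_sub V))).sub
    (integrable_finsetSum _ fun i _ =>
      ((h.integrable_velocity_apply i).sub (integrable_const _)).const_mul _)

theorem integral_relEnergy (h : IsAveraging e μ U) (V : State) :
    ∫ lam, relEnergy e lam V ∂μ = meanRelEnergy e V U (∫ lam, energy e lam ∂μ) := by
  have hv := fun i => (h.integrable_velocity_apply i).sub (integrable_const (μ := μ) (V.2.1 i))
  simp only [relEnergy_eq, meanRelEnergy]
  rw [integral_sub, integral_sub, integral_sub h.integrable_energy (integrable_const _),
    integral_finsetSum, (grad e V).integral_comp_comm (h.integrable_ext_sub V),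
    h.integral_ext_sub]
  · have : ∀ i, ∫ lam, V.2.1 i * (lam.2.1 i - V.2.1 i) ∂μ = V.2.1 i * (U.2.1 i - V.2.1 i) := by
      intro i
      rw [integral_const_mul, integral_sub (h.integrable_velocity_apply i) (integrable_const _),
        h.integral_velocity_apply]
      simp
    simp [this]
  · exact fun i _ => (hv i).const_mul _
  · exact h.integrable_energy.sub (integrable_const _)
  · exact (grad e V).integrable_comp (h.integrable_ext_sub V)
  · exact (h.integrable_energy.sub (integrable_const _)).sub
      ((grad e V).integrable_comp (h.integrable_ext_sub V))
  · exact integrable_finsetSum _ fun i _ => (hv i).const_mul _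

/-- The nonlinear error terms are averaged by replacing `ext λ`, `1 / θ`, the stress and the null
Lagrangians by their averages; `average_Phi` is used for the null Lagrangians. -/
theorem integral_production (h : IsAveraging e μ U) (s : ℝ) (V : State)
    (D : ℝ × E3 →L[ℝ] State) : Integrable (production e s V D) μ ∧
    ∫ lam, production e s V D lam ∂μ =
      s * (1 - theta e (ext V) * ∫ lam, 1 / theta e (ext lam) ∂μ) -
        hess e V (dExt V (D (1, 0))) (ext U - ext V) + ∑ i, ∑ α, (D (0, unitVec α)).2.1 i *
          (∫ lam, stress e lam.1 lam.2.2 i α ∂μ - grad e V (dPhi U.1 i α, 0)) := by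
  set L := hess e V (dExt V (D (1, 0)))
  let G : Ext →L[ℝ] ℝ := (grad e V).comp (ContinuousLinearMap.inl ℝ Ext ℝ)
  have i1 : Integrable (fun lam => s * (1 - theta e (ext V) * (1 / theta e (ext lam)))) μ :=
    ((integrable_const 1).sub (h.integrable_inv_theta.const_mul _)).const_mul s
  have i2 : Integrable (fun lam => L (ext lam - ext V)) μ := L.integrable_comp
    (h.integrable_ext_sub V)
  have i3 : ∀ i α, Integrable (fun lam : State => grad e V (dPhi lam.1 i α, 0)) μ := fun i α =>
    G.integrable_comp (h.integrable_dPhi i α)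
  have i4 : ∀ i α, Integrable (fun lam : State => (D (0, unitVec α)).2.1 i *
      (stress e lam.1 lam.2.2 i α - grad e V (dPhi lam.1 i α, 0))) μ := fun i α =>
    ((h.integrable_stress i α).sub (i3 i α)).const_mul _
  have i5 : Integrable (fun lam : State => ∑ i, ∑ α, (D (0, unitVec α)).2.1 i *
      (stress e lam.1 lam.2.2 i α - grad e V (dPhi lam.1 i α, 0))) μ :=
    integrable_finsetSum _ fun i _ => integrable_finsetSum _ fun α _ => i4 i α
  refine ⟨(i1.sub i2).add i5, ?_⟩
  simp only [production]
  have e3 : ∀ i α, ∫ lam : State, grad e V (dPhi lam.1 i α, 0) ∂μ = grad e V (dPhi U.1 i α, 0) := by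
    intro i α
    rw [← h.integral_dPhi i α]
    exact G.integral_comp_comm (h.integrable_dPhi i α)
  refine (integral_add (i1.sub i2) i5).trans ?_
  rw [integral_sub' i1 i2, L.integral_comp_comm
    (h.integrable_ext_sub V), h.integral_ext_sub, integral_const_mul,
    integral_sub (integrable_const _) (h.integrable_inv_theta.const_mul _), integral_const_mul,
    integral_finsetSum _ fun i _ => integrable_finsetSum _ fun α _ => i4 i α]
  congr 1
  · simp
  · refine Finset.sum_congr rfl fun i _ => ?_
    rw [integral_finsetSum _ fun α _ => i4 i α]
    refine Finset.sum_congr rfl fun α _ => ?_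
    rw [integral_const_mul, integral_sub (h.integrable_stress i α) (i3 i α), e3]

end IsAveraging

/-- The right-hand side of the relative energy inequality is bounded by the relative energy. -/
theorem ConstitutiveAssumptions.exists_meanProduction_le {e : Ext × ℝ → ℝ} {p q ρ l : ℝ}
    (he : ConstitutiveAssumptions e p q ρ l) (M K B : ℝ) : ∃ C, 0 ≤ C ∧ ∀ s V D, |s| ≤ B →
      V ∈ Gam M → ‖D‖ ≤ K → SolvesAt e s V D → ∀ (μ : Measure State) [IsProbabilityMeasure μ] U,
      IsAveraging e μ U →
      meanProduction e s V D U (∫ lam, 1 / theta e (ext lam) ∂μ)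
        (fun i α => ∫ lam, stress e lam.1 lam.2.2 i α ∂μ) ≤
        C * meanRelEnergy e V U (∫ lam, energy e lam ∂μ) := by
  obtain ⟨C₁, hC₁, h₁⟩ := he.exists_production_le M K B
  obtain ⟨C₂, hC₂, h₂⟩ := he.exists_meanProduction_sub_le M K
  obtain ⟨C₃, hC₃, h₃⟩ := he.exists_sq_le_relEnergy
  refine ⟨C₁ + C₂ * (C₃ + C₃), by positivity, fun s V D hs hV hD h μ _ U hμ => ?_⟩
  obtain ⟨hi, heq⟩ := hμ.integral_production s V D
  have hrel := hμ.integrable_relEnergy V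
  have k1 := h₂ s V D hV hD h U (∫ lam, 1 / theta e (ext lam) ∂μ)
    (fun i α => ∫ lam, stress e lam.1 lam.2.2 i α ∂μ)
  have k2 : ∫ lam, production e s V D lam ∂μ ≤ C₁ * ∫ lam, relEnergy e lam V ∂μ := by
    rw [← integral_const_mul]
    refine integral_mono_ae hi (hrel.const_mul _) ?_
    filter_upwards [hμ.pos] with lam hlam
    exact (le_abs_self _).trans (h₁ s V D hs hV hD h lam hlam)
  have k3 : ‖U.2.1 - V.2.1‖ ^ 2 ≤ C₃ * ∫ lam, relEnergy e lam V ∂μ := by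
    have := sq_norm_integral_le (hμ.integrable_id.snd.fst.sub (integrable_const V.2.1))
      (hrel.const_mul C₃) (by
        filter_upwards [hμ.pos] with lam hlam using (h₃ lam V hlam hV.2.2.2).1)
    rw [integral_sub' hμ.integrable_id.snd.fst (integrable_const _), hμ.integral_velocity,
      integral_const_mul] at this
    simpa using this
  have k4 : ‖ext U - ext V‖ ^ 2 ≤ C₃ * ∫ lam, relEnergy e lam V ∂μ := by
    have := sq_norm_integral_le (hμ.integrable_ext_sub V) (hrel.const_mul C₃) (by
        filter_upwards [hμ.pos] with lam hlam using (h₃ lam V hlam hV.2.2.2).2)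
    rwa [hμ.integral_ext_sub, integral_const_mul] at this
  rw [heq] at k2
  rw [← hμ.integral_relEnergy]
  have k5 := mul_le_mul_of_nonneg_left (add_le_add k3 k4) hC₂
  linarith

/-! ### Derivatives along the strong solution, and the null Lagrangian -/

section
variable {e : Ext × ℝ → ℝ} {p q ρ l : ℝ} {r : ℝ × E3 → ℝ} {T M : ℝ} {W : ℝ × E3 → State}

theorem fderiv_grad_comp (he : ConstitutiveAssumptions e p q ρ l) {z : ℝ × E3}
    (hW : DifferentiableAt ℝ W z) (hdom : ∀ y, ext (W y) ∈ dom) :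
    DifferentiableAt ℝ (fun y => grad e (W y)) z ∧
      (∀ v, fderiv ℝ (fun y => grad e (W y)) z v = hess e (W z) (dExt (W z) (fderiv ℝ W z v))) ∧
      ∀ v h, fderiv ℝ (fun y => grad e (W y) h) z v =
        hess e (W z) (dExt (W z) (fderiv ℝ W z v)) h := by
  obtain ⟨h1, h2⟩ := fderiv_comp_ext hW hdom
    (he.contDiffOn_grad.differentiableOn (by norm_num) _ (hdom z))
  refine ⟨h1, h2, fun v h => ?_⟩
  refine (fderiv_comp_clm h1 (ContinuousLinearMap.apply ℝ ℝ h) v).trans ?_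
  rw [h2 v]
  rfl

theorem IsStrongSolution.ext_mem (h : IsStrongSolution e r T M W) (y : ℝ × E3) :
    ext (W y) ∈ dom := ext_mem_dom (h.mem_Gam y).2.2.2

theorem IsStrongSolution.isCoeff_grad (he : ConstitutiveAssumptions e p q ρ l)
    (h : IsStrongSolution e r T M W) (k : Ext × ℝ) : IsCoeff fun z => grad e (W z) k :=
  h.isCoeff_comp_ext (f := fun x => fderivWithin ℝ e dom x k)
    ((he.contDiffOn_grad.of_le (by norm_num)).clm_apply contDiffOn_const)

/-- By the Piola identity, the equations hold in their pointwise form. -/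
theorem IsStrongSolution.ae_solvesAt (he : ConstitutiveAssumptions e p q ρ l)
    (h : IsStrongSolution e r T M W)
    (hcurl : ∀ᵐ z ∂(volQ T), ∀ k α β,
      dx β (fun y => (W y).1 (k, α)) z = dx α (fun y => (W y).1 (k, β)) z) :
    ∀ᵐ z ∂(volQ T), SolvesAt e (r z) (W z) (fderiv ℝ W z) := by
  filter_upwards [hcurl, h.eq_F, h.eq_entropy, h.eq_velocity, h.ae_differentiableAt]
    with z hc h1 h2 h3 hd
  refine ⟨h1, h2, fun i => ?_⟩
  obtain ⟨g1, g2, -⟩ := fderiv_grad_comp he hd h.ext_mem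
  have hF : ∀ k α v, fderiv ℝ (fun y => (W y).1 (k, α)) z v = (fderiv ℝ W z v).1 (k, α) :=
    fun k α v => fderiv_comp_clm hd (projF (k, α)) v
  have hA : ∀ k α β, (fderiv ℝ W z (0, unitVec α)).1 (k, β) =
      (fderiv ℝ W z (0, unitVec β)).1 (k, α) := fun k α β => by
    rw [← hF, ← hF]; exact hc k β α
  have hα : ∀ α, dx α (fun y => grad e (W y) (dPhi (W y).1 i α, 0)) z =
      hess e (W z) (dExt (W z) (fderiv ℝ W z (0, unitVec α))) (dPhi (W z).1 i α, 0) +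
        grad e (W z) ((0, cofPolar (fderiv ℝ W z (0, unitVec α)).1 (unitMat i α),
          cofPolar (W z).1 (fderiv ℝ W z (0, unitVec α)).1 (i, α)), 0) := by
    intro α
    obtain ⟨d1, d2⟩ := fderiv_dPhi_comp hd i α
    have d3 : HasFDerivAt (fun y => ((dPhi (W y).1 i α, 0) : Ext × ℝ)) _ z :=
      d1.hasFDerivAt.prodMk (hasFDerivAt_const (0 : ℝ) z)
    have d4 := g1.hasFDerivAt.clm_apply d3
    have d5 : fderiv ℝ (fun y => grad e (W y) (dPhi (W y).1 i α, 0)) z (0, unitVec α) =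
        grad e (W z) (fderiv ℝ (fun y => dPhi (W y).1 i α) z (0, unitVec α), 0) +
          fderiv ℝ (fun y => grad e (W y)) z (0, unitVec α) (dPhi (W z).1 i α, 0) := by
      rw [d4.fderiv]; rfl
    rw [dx, d5, g2, d2, add_comm]
  rw [h3 i]
  simp only [hα, Finset.sum_add_distrib]
  rw [← map_sum]
  have hz : ∑ α, (((0, cofPolar (fderiv ℝ W z (0, unitVec α)).1 (unitMat i α),
      cofPolar (W z).1 (fderiv ℝ W z (0, unitVec α)).1 (i, α)), 0) : Ext × ℝ) = 0 := by
    have z1 := sum_cofPolar_unitMat_eq_zero hA i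
    have z2 := sum_cofPolar_apply_eq_zero hA (W z).1 i
    ext1
    · ext1
      · simp [Prod.fst_sum]
      · ext1
        · simpa [Prod.fst_sum, Prod.snd_sum] using z1
        · simpa [Prod.fst_sum, Prod.snd_sum] using z2
    · simp [Prod.snd_sum]
  rw [hz, map_zero, add_zero]

/-- The coefficient `v_i ∂e/∂ξ^B h^B`. -/
theorem IsStrongSolution.isCoeff_velocity_mul_grad (he : ConstitutiveAssumptions e p q ρ l)
    (h : IsStrongSolution e r T M W) (i : Fin 3) (k : Ext) :
    IsCoeff fun z => (W z).2.1 i * grad e (W z) (k, 0) :=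
  (h.isCoeff_v i).mul (h.isCoeff_grad he _)

theorem IsStrongSolution.dx_velocity_mul_grad (he : ConstitutiveAssumptions e p q ρ l)
    (h : IsStrongSolution e r T M W) :
    ∀ᵐ z ∂(volQ T), ∀ i k α, dx α (fun z => (W z).2.1 i * grad e (W z) (k, 0)) z =
      (fderiv ℝ W z (0, unitVec α)).2.1 i * grad e (W z) (k, 0) +
        (W z).2.1 i * hess e (W z) (dExt (W z) (fderiv ℝ W z (0, unitVec α))) (k, 0) := by
  filter_upwards [h.ae_differentiableAt] with z hd i k α
  obtain ⟨g1, -, g2⟩ := fderiv_grad_comp he hd h.ext_mem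
  have hv : HasFDerivAt (fun y => (W y).2.1 i) _ z := (projV i).hasFDerivAt.comp z hd.hasFDerivAt
  have hg : DifferentiableAt ℝ (fun y => grad e (W y) (k, 0)) z :=
    ((ContinuousLinearMap.apply ℝ ℝ ((k, 0) : Ext × ℝ)).differentiableAt.comp z g1 :)
  rw [dx, (hv.fun_mul hg.hasFDerivAt).fderiv]
  simp only [add_apply, smul_apply, smul_eq_mul, g2]
  rw [add_comm, mul_comm (grad e (W z) (k, 0))]
  rfl

theorem sum_mul_cofPolar_unitMat (d : Fin 3 → ℝ) (F : Mat3) (i j γ : Fin 3) :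
    ∑ α, d α * cofPolar F (unitMat i α) (j, γ) =
      (if i = j + 2 then d (γ + 2) * F (j + 1, γ + 1) - d (γ + 1) * F (j + 1, γ + 2) else 0) +
      (if i = j + 1 then d (γ + 1) * F (j + 2, γ + 2) - d (γ + 2) * F (j + 2, γ + 1) else 0) := by
  simp only [cofPolar_apply, unitMat, PiLp.single_apply, Prod.mk.injEq]
  fin_cases i <;> fin_cases j <;> fin_cases γ <;> simp [Fin.sum_univ_three] <;> ring

/-- The part of the matrix of cofactors of `F` that is affine in `F`. -/
theorem nullTensor_eq (F G : Mat3) (i α : Fin 3) : nullTensor F G i α =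
    (unitMat i α, cofPolar F (unitMat i α), cofPolar G (F - (1 / 2 : ℝ) • G) (i, α)) := by
  have h := congrArg (fun A : Mat3 => A (i, α)) (cof_add (F - G) G)
  have h2 := cof_apply G i α
  simp only [sub_add_cancel, PiLp.add_apply] at h
  rw [nullTensor, dPhi_eq, Prod.mk_sub_mk, Prod.mk_sub_mk, sub_zero, sub_zero, h]
  congr 2
  simp only [cofPolar_apply, h2, PiLp.sub_apply, PiLp.smul_apply, smul_eq_mul]
  ring

/-- `nullTensor` splits into a constant part, a part linear in `F`, and a part that is affine in
`F` with coefficients linear in `G`. Each part is divergence free for its own reason. -/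
theorem clm_nullTensor_eq (L : Ext × ℝ →L[ℝ] ℝ) (F G : Mat3) (i α : Fin 3) :
    L (nullTensor F G i α, 0) = L ((unitMat i α, 0, 0), 0) +
      (∑ k : Fin 3 × Fin 3, cofPolar F (unitMat i α) k * L ((0, EuclideanSpace.single k 1, 0), 0)) +
      cofPolar G (F - (1 / 2 : ℝ) • G) (i, α) * L ((0, 0, 1), 0) := by
  have hsum : cofPolar F (unitMat i α) =
      ∑ k, cofPolar F (unitMat i α) k • (EuclideanSpace.single k 1 : Mat3) := by
    ext j; simp [Pi.single_apply]
  let J : Mat3 →L[ℝ] ℝ := L.comp ((ContinuousLinearMap.inl ℝ Ext ℝ).comp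
    ((ContinuousLinearMap.inr ℝ Mat3 (Mat3 × ℝ)).comp (ContinuousLinearMap.inl ℝ Mat3 ℝ)))
  have hJ : ∀ A, L ((0, A, 0), 0) = J A := fun A => rfl
  have hsplit : ((nullTensor F G i α, 0) : Ext × ℝ) = ((unitMat i α, 0, 0), 0) +
      ((0, cofPolar F (unitMat i α), 0), 0) +
      cofPolar G (F - (1 / 2 : ℝ) • G) (i, α) • ((0, 0, 1), 0) := by
    rw [nullTensor_eq]; simp
  rw [hsplit, map_add, map_add, map_smul, smul_eq_mul, hJ]
  conv_lhs => rw [hsum, map_sum]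
  simp only [map_smul, smul_eq_mul, hJ]

section
variable {φ : ℝ → ℝ} {s : ℝ × E3 → ℝ} {F : ℝ × E3 → Mat3}

/-- Weak Piola identity for `∂ cof / ∂F_{iα} (F)`: this tensor is linear in `F`, so that only the
weak curl-freeness of `F` is needed. -/
theorem IsTimeTest.integral_cofPolar_unitMat (hT : 0 < T) (hφ : IsTimeTest T φ) (hs : IsCoeff s)
    (hF : ∀ k, IsWeakCurlFree T fun α z => F z (k, α)) (i : Fin 3) (k : Fin 3 × Fin 3) :
    ∫ z, φ z.1 * ∑ α, dx α s z * cofPolar (F z) (unitMat i α) k ∂(volQ T) = 0 := by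
  obtain ⟨j, γ⟩ := k
  have e1 : γ + 1 ≠ γ + 2 := by fin_cases γ <;> decide
  have e2 : j + 2 ≠ j + 1 := by fin_cases j <;> decide
  simp only [sum_mul_cofPolar_unitMat]
  by_cases h2 : i = j + 2
  · have h1 : i ≠ j + 1 := h2 ▸ e2
    simp only [if_pos h2, if_neg h1, add_zero]
    exact hφ.integral_curl hT hs (hF (j + 1)) e1
  · by_cases h1 : i = j + 1
    · simp only [if_pos h1, if_neg h2, zero_add]
      exact hφ.integral_curl hT hs (hF (j + 2)) e1.symm
    · simp [if_neg h1, if_neg h2]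

/-- Weak Piola identity for the bilinear tensor `cofPolar G (F - G / 2)`, where `G` is Lipschitz
and curl-free almost everywhere and `F` is weakly curl-free. -/
theorem IsTimeTest.integral_cofPolar_mul (hT : 0 < T) (hφ : IsTimeTest T φ) (hs : IsCoeff s)
    {G : ℝ × E3 → Mat3} (hG : ∀ k, IsCoeff fun z => G z k)
    (hcurl : ∀ᵐ z ∂(volQ T), ∀ k α β, dx β (fun y => G y (k, α)) z = dx α (fun y => G y (k, β)) z)
    (hF : ∀ k, IsWeakCurlFree T fun α z => F z (k, α)) (i : Fin 3) :
    ∫ z, φ z.1 * ∑ α, dx α s z * cofPolar (G z) (F z - (1 / 2 : ℝ) • G z) (i, α) ∂(volQ T) =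
      0 := by
  have hc : ∀ k, ∀ᵐ z ∂(volQ T), ∀ α β, dx β (fun y => G y (k, α)) z =
      dx α (fun y => G y (k, β)) z := fun k => by
    filter_upwards [hcurl] with z hz using hz k
  have ha : ∀ k, IsWeakCurlFree T fun α z => F z (k, α) - 1 / 2 * G z (k, α) := fun k =>
    (hF k).sub_smul (isWeakCurlFree_of_ae hT (fun α => hG (k, α)) (hc k)) _
  have h1 := hφ.integral_curl_polar hT hs (fun α => hG (i + 1, α)) (hc _) (ha (i + 2))
  have h2 := hφ.integral_curl_polar hT hs (fun α => hG (i + 2, α)) (hc _) (ha (i + 1))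
  have hint : ∀ j k, Integrable (fun z => φ z.1 * ∑ α, dx α s z * (G z (j, α + 1) *
      (F z (k, α + 2) - 1 / 2 * G z (k, α + 2)) - G z (j, α + 2) *
      (F z (k, α + 1) - 1 / 2 * G z (k, α + 1)))) (volQ T) := fun j k =>
    hφ.isTest.integrable_mul (integrable_finsetSum _ fun α _ => hs.integrable_fderiv_mul _
      (((hG (j, α + 1)).integrable_mul ((ha k).integrable (α + 2))).sub
        ((hG (j, α + 2)).integrable_mul ((ha k).integrable (α + 1)))))
  have h3 := integral_sub (hint (i + 1) (i + 2)) (hint (i + 2) (i + 1))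
  rw [h1, h2, sub_zero] at h3
  rw [← h3]
  refine integral_congr_ae (ae_of_all _ fun z => ?_)
  simp only [← mul_sub, ← Finset.sum_sub_distrib]
  congr 1
  refine Finset.sum_congr rfl fun α _ => ?_
  simp only [cofPolar_apply, PiLp.sub_apply, PiLp.smul_apply, smul_eq_mul]
  ring

end

/-- The null form does not contribute to the relative energy inequality: it is the sum over the
three parts of `nullTensor` of derivatives of the Lipschitz functions `v_i ∂e/∂ξ^B` paired with
weakly divergence-free tensors. -/
theorem IsStrongSolution.integral_nullForm (he : ConstitutiveAssumptions e p q ρ l) (hT : 0 < T)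
    (h : IsStrongSolution e r T M W)
    (hcurl : ∀ᵐ z ∂(volQ T), ∀ k α β,
      dx β (fun y => (W y).1 (k, α)) z = dx α (fun y => (W y).1 (k, β)) z)
    {F : ℝ × E3 → Mat3} (hF : ∀ k, IsWeakCurlFree T fun α z => F z (k, α)) {φ : ℝ → ℝ}
    (hφ : IsTimeTest T φ) :
    Integrable (fun z => nullForm e (W z) (fderiv ℝ W z) (F z)) (volQ T) ∧
      ∫ z, φ z.1 * nullForm e (W z) (fderiv ℝ W z) (F z) ∂(volQ T) = 0 := by
  set s : Fin 3 → Ext → ℝ × E3 → ℝ := fun i k z => (W z).2.1 i * grad e (W z) (k, 0) with hs_def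
  have hs : ∀ i k, IsCoeff (s i k) := fun i k => h.isCoeff_velocity_mul_grad he i k
  set b : Fin 3 × Fin 3 → Ext := fun k => (0, EuclideanSpace.single k 1, 0) with hb
  set N₁ : Fin 3 → Fin 3 → ℝ × E3 → ℝ := fun i α z => dx α (s i (unitMat i α, 0, 0)) z with hN₁
  set N₂ : Fin 3 → Fin 3 × Fin 3 → ℝ × E3 → ℝ := fun i k z =>
    ∑ α, dx α (s i (b k)) z * cofPolar (F z) (unitMat i α) k with hN₂
  set N₃ : Fin 3 → ℝ × E3 → ℝ := fun i z =>
    ∑ α, dx α (s i (0, 0, 1)) z * cofPolar (W z).1 (F z - (1 / 2 : ℝ) • (W z).1) (i, α) with hN₃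
  have heq : ∀ᵐ z ∂(volQ T), nullForm e (W z) (fderiv ℝ W z) (F z) =
      ∑ i, ((∑ α, N₁ i α z) + (∑ k, N₂ i k z) + N₃ i z) := by
    filter_upwards [h.dx_velocity_mul_grad he] with z hz
    rw [nullForm]
    refine Finset.sum_congr rfl fun i _ => ?_
    simp only [hN₁, hN₂, hN₃]
    rw [Finset.sum_comm, ← Finset.sum_add_distrib, ← Finset.sum_add_distrib]
    refine Finset.sum_congr rfl fun α _ => ?_
    simp only [hs_def, hz, clm_nullTensor_eq, hb]
    simp only [mul_add, add_mul, Finset.mul_sum, Finset.sum_add_distrib]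
    have c1 : ∀ x y w : ℝ, x * (y * w) = x * w * y := fun x y w => by ring
    simp only [c1]
    ring
  have hFi : ∀ i α, Integrable (fun z => F z (i, α)) (volQ T) := fun i α => (hF i).integrable α
  have i₁ : ∀ i α, Integrable (N₁ i α) (volQ T) := fun i α => (hs _ _).integrable_fderiv T _
  have i₂ : ∀ i k, Integrable (N₂ i k) (volQ T) := fun i k =>
    integrable_finsetSum _ fun α _ => (hs _ _).integrable_fderiv_mul _ (by
      obtain ⟨j, γ⟩ := k
      simp only [cofPolar_apply]
      exact ((((hFi _ _).mul_const _).add ((hFi _ _).const_mul _)).sub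
        ((hFi _ _).mul_const _)).sub ((hFi _ _).const_mul _))
  have i₃ : ∀ i, Integrable (N₃ i) (volQ T) := fun i =>
    integrable_finsetSum _ fun α _ => (hs _ _).integrable_fderiv_mul _ (by
      have hW := fun k γ => (h.isCoeff_F (k, γ))
      have hD : ∀ k γ, Integrable (fun z => (F z - (1 / 2 : ℝ) • (W z).1) (k, γ)) (volQ T) :=
        fun k γ => (hFi k γ).sub ((hW k γ).integrable.const_mul _)
      have hm : ∀ k γ k' γ', Integrable (fun z => (W z).1 (k, γ) *
          (F z - (1 / 2 : ℝ) • (W z).1) (k', γ')) (volQ T) := fun k γ k' γ' =>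
        (hW k γ).integrable_mul (hD k' γ')
      have hm' : ∀ k γ k' γ', Integrable (fun z => (F z - (1 / 2 : ℝ) • (W z).1) (k', γ') *
          (W z).1 (k, γ)) (volQ T) := fun k γ k' γ' => by
        simpa only [mul_comm] using hm k γ k' γ'
      simp only [cofPolar_apply]
      exact (((hm _ _ _ _).add (hm' _ _ _ _)).sub (hm _ _ _ _)).sub (hm' _ _ _ _))
  have hφi := fun {a : ℝ × E3 → ℝ} (ha : Integrable a (volQ T)) => hφ.isTest.integrable_mul ha
  have itot : Integrable (fun z => ∑ i, ((∑ α, N₁ i α z) + (∑ k, N₂ i k z) + N₃ i z)) (volQ T) :=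
    integrable_finsetSum _ fun i _ => ((integrable_finsetSum _ fun α _ => i₁ i α).add
      (integrable_finsetSum _ fun k _ => i₂ i k)).add (i₃ i)
  refine ⟨itot.congr (heq.mono fun z hz => hz.symm), ?_⟩
  have z₁ : ∀ i α, ∫ z, φ z.1 * N₁ i α z ∂(volQ T) = 0 := fun i α =>
    hφ.integral_mul_dx hT (hs _ _) α
  have z₂ : ∀ i k, ∫ z, φ z.1 * N₂ i k z ∂(volQ T) = 0 := fun i k =>
    hφ.integral_cofPolar_unitMat hT (hs _ _) hF i k
  have z₃ : ∀ i, ∫ z, φ z.1 * N₃ i z ∂(volQ T) = 0 := fun i =>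
    hφ.integral_cofPolar_mul hT (hs _ _) (fun k => h.isCoeff_F k) hcurl hF i
  have h0 : ∫ z, φ z.1 * nullForm e (W z) (fderiv ℝ W z) (F z) ∂(volQ T) =
      ∫ z, ∑ i, ((∑ α, φ z.1 * N₁ i α z) + (∑ k, φ z.1 * N₂ i k z) + φ z.1 * N₃ i z)
        ∂(volQ T) := by
    refine integral_congr_ae ?_
    filter_upwards [heq] with z hz
    rw [hz]
    simp only [Finset.mul_sum, mul_add]
  rw [h0]
  refine (integral_finsetSum _ fun i _ => ((integrable_finsetSum _ fun α _ => hφi (i₁ i α)).add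
    (integrable_finsetSum _ fun k _ => hφi (i₂ i k))).add (hφi (i₃ i))).trans ?_
  refine Finset.sum_eq_zero fun i _ => ?_
  have s1 := integral_add ((integrable_finsetSum Finset.univ fun α _ => hφi (i₁ i α)).add
    (integrable_finsetSum Finset.univ fun k _ => hφi (i₂ i k))) (hφi (i₃ i))
  refine s1.trans ?_
  rw [integral_add' (integrable_finsetSum _ fun α _ => hφi (i₁ i α))
    (integrable_finsetSum _ fun k _ => hφi (i₂ i k)),
    integral_finsetSum _ fun α _ => hφi (i₁ i α), integral_finsetSum _ fun k _ => hφi (i₂ i k)]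
  simp [z₁, z₂, z₃]

end

/-! ### The equations for the averages of the measure-valued solution -/

theorem norm_dPhi_le_cof (F : Mat3) (i α : Fin 3) : ‖dPhi F i α‖ ≤ 1 + 12 * ‖F‖ + ‖cof F‖ := by
  have h1 := norm_cofPolar_unitMat_le F i α
  have h2 := PiLp.norm_apply_le (cof F) (i, α)
  have h3 := norm_nonneg F
  have h4 := norm_nonneg (cof F)
  rw [dPhi_eq, Prod.norm_mk, Prod.norm_mk, norm_unitMat]
  exact max_le (by linarith) (max_le (by linarith) (by linarith))

namespace IsDissipativeMVSolution
variable {e : Ext × ℝ → ℝ} {p q ρ l : ℝ} {r : ℝ × E3 → ℝ} {T : ℝ} {ν₀ : Kernel E3 State}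
  {γ₀ : Measure E3} {ν : Kernel (ℝ × E3) State} {γ : Measure (ℝ × E3)} {U : ℝ × E3 → State}

section
variable [IsMarkovKernel ν]

theorem integrable_integral (hmv : IsDissipativeMVSolution e p q ρ l r T ν₀ γ₀ ν γ U)
    (he : ConstitutiveAssumptions e p q ρ l) {V : Type*} [NormedAddCommGroup V] [NormedSpace ℝ V]
    [FiniteDimensional ℝ V] {f : State → V} (hf : IsAdmissible p q ρ l f) :
    Integrable (fun z => ∫ lam, f lam ∂(ν z)) (volQ T) :=
  hf.integrable_integral he hmv.entropy_nonneg hmv.moments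

theorem ae_integrable (hmv : IsDissipativeMVSolution e p q ρ l r T ν₀ γ₀ ν γ U)
    (he : ConstitutiveAssumptions e p q ρ l) {V : Type*} [NormedAddCommGroup V] [NormedSpace ℝ V]
    [FiniteDimensional ℝ V] {f : State → V} (hf : IsAdmissible p q ρ l f) :
    ∀ᵐ z ∂(volQ T), Integrable f (ν z) :=
  hf.ae_integrable he hmv.entropy_nonneg hmv.moments

/-- The measures `ν z` of a measure-valued solution satisfy all the moment and averaging
conditions of `IsAveraging` almost everywhere. -/
theorem ae_isAveraging (hmv : IsDissipativeMVSolution e p q ρ l r T ν₀ γ₀ ν γ U)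
    (he : ConstitutiveAssumptions e p q ρ l) : ∀ᵐ z ∂(volQ T), IsAveraging e (ν z) (U z) := by
  have hs : ∀ᵐ z ∂(volQ T), ∀ i α, Integrable (fun lam => stress e lam.1 lam.2.2 i α) (ν z) := by
    simp only [ae_all_iff]
    exact fun i α => hmv.ae_integrable he (he.admissible_stress i α)
  filter_upwards [hmv.entropy_nonneg, hmv.ae_integrable he he.admissible_energy,
    hmv.ae_integrable he he.admissible_id, hmv.ae_integrable he he.admissible_ext,
    hmv.ae_integrable he he.admissible_inv_theta, hs, hmv.average, hmv.average_Phi]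
    with z h1 h2 h3 h4 h5 h6 h7 h8
  exact ⟨h1, h2, h3, h4.fst, h5, h6, h7, h8⟩

theorem integrable_U (hmv : IsDissipativeMVSolution e p q ρ l r T ν₀ γ₀ ν γ U)
    (he : ConstitutiveAssumptions e p q ρ l) : Integrable U (volQ T) :=
  (hmv.integrable_integral he he.admissible_id).congr
    (hmv.average.mono fun _ hz => hz.symm)

theorem integrable_ext (hmv : IsDissipativeMVSolution e p q ρ l r T ν₀ γ₀ ν γ U)
    (he : ConstitutiveAssumptions e p q ρ l) : Integrable (fun z => ext (U z)) (volQ T) :=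
  (hmv.integrable_integral he he.admissible_ext).congr
    ((hmv.ae_isAveraging he).mono fun _ hz => hz.integral_ext)

/-- The flux `v_i ∂Φ/∂F_{iα}` of the null Lagrangians is integrable, because `v`, `F` and `cof F`
are square integrable. -/
theorem integrable_flux (hmv : IsDissipativeMVSolution e p q ρ l r T ν₀ γ₀ ν γ U)
    (he : ConstitutiveAssumptions e p q ρ l) (i α : Fin 3) :
    Integrable (fun z => (U z).2.1 i • dPhi (U z).1 i α) (volQ T) := by
  have hU := hmv.integrable_U he
  have i1 := hmv.integrable_integral he (admissible_sq_v (p := p) (q := q) (ρ := ρ) (l := l))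
  have i2 := hmv.integrable_integral he he.admissible_sq_F
  have i3 := hmv.integrable_integral he he.admissible_sq_cof
  have hmeas : AEStronglyMeasurable (fun z => (U z).2.1 i • dPhi (U z).1 i α) (volQ T) :=
    ((EuclideanSpace.proj (𝕜 := ℝ) i).continuous.comp_aestronglyMeasurable
      hU.1.snd.fst).smul ((continuous_dPhi i α).comp_aestronglyMeasurable hU.1.fst)
  refine ((((integrable_const 1).add i1).add (i2.const_mul 144)).add i3).const_mul 3 |>.mono'
    hmeas ?_
  filter_upwards [hmv.ae_isAveraging he, hmv.ae_integrable he
    (admissible_sq_v (p := p) (q := q) (ρ := ρ) (l := l)),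
    hmv.ae_integrable he he.admissible_sq_F, hmv.ae_integrable he he.admissible_sq_cof]
    with z hz k1 k2 k3
  have j1 := sq_norm_integral_le hz.integrable_id.snd.fst k1 (ae_of_all _ fun _ => le_rfl)
  have j2 := sq_norm_integral_le hz.integrable_id.fst k2 (ae_of_all _ fun _ => le_rfl)
  have j3 := sq_norm_integral_le hz.integrable_Phi.snd.fst k3 (ae_of_all _ fun _ => le_rfl)
  have e2 : ∫ lam, lam.1 ∂(ν z) = (U z).1 := by
    rw [hz.average]
    exact (ContinuousLinearMap.fst ℝ Mat3 (E3 × ℝ)).integral_comp_comm hz.integrable_id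
  have e3 : ∫ lam : State, (Phi lam.1).2.1 ∂(ν z) = cof (U z).1 := by
    have := ((ContinuousLinearMap.fst ℝ Mat3 ℝ).comp
      (ContinuousLinearMap.snd ℝ Mat3 (Mat3 × ℝ))).integral_comp_comm hz.integrable_Phi
    rw [hz.average_Phi] at this
    exact this
  rw [hz.integral_velocity] at j1
  rw [e2] at j2
  rw [e3] at j3
  rw [norm_smul]
  have m1 : ‖(U z).2.1 i‖ ≤ ‖(U z).2.1‖ := PiLp.norm_apply_le _ _
  have m2 := mul_le_mul m1 (norm_dPhi_le_cof (U z).1 i α) (norm_nonneg _) (norm_nonneg _)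
  refine m2.trans ?_
  change _ ≤ 3 * (1 + (∫ lam, ‖lam.2.1‖ ^ 2 ∂(ν z)) + 144 * (∫ lam, ‖lam.1‖ ^ 2 ∂(ν z)) +
    ∫ lam, ‖cof lam.1‖ ^ 2 ∂(ν z))
  change _ ≤ ∫ lam, ‖cof lam.1‖ ^ 2 ∂(ν z) at j3
  set a := ‖(U z).2.1‖
  set b := ‖(U z).1‖
  set c := ‖cof (U z).1‖
  nlinarith [sq_nonneg (a - 1), sq_nonneg (a - 12 * b), sq_nonneg (a - c), sq_nonneg a,
    sq_nonneg b, sq_nonneg c]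

end

section
variable {M : ℝ} {W : ℝ × E3 → State}

/-- The equations for the components of `Φ(F)` and for the entropy, combined by a linear
functional `L` into one scalar balance law for `L (Φ(F), η)`. -/
theorem weakForm_ext [IsMarkovKernel ν] (hmv : IsDissipativeMVSolution e p q ρ l r T ν₀ γ₀ ν γ U)
    (he : ConstitutiveAssumptions e p q ρ l) (hW : IsStrongSolution e r T M W)
    (h₀ : ∀ᵐ x ∂volX, ν₀ x = Measure.dirac (W (0, x))) (L : Ext × ℝ →L[ℝ] ℝ)
    (hr : Integrable (fun z => r z * ∫ lam, 1 / theta e (ext lam) ∂(ν z)) (volQ T))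
    {φ : ℝ × E3 → ℝ} (hφ : IsTest T φ) :
    weakForm T (fun z => L (ext (U z))) (fun α z => -∑ i, L ((U z).2.1 i • dPhi (U z).1 i α, 0))
      (fun z => L (0, 1) * (r z * ∫ lam, 1 / theta e (ext lam) ∂(ν z)))
      (fun x => L (ext (W (0, x)))) φ = 0 := by
  let J : Ext →L[ℝ] ℝ := L.comp (ContinuousLinearMap.inl ℝ Ext ℝ)
  have hJ : ∀ ξ, L (ξ, 0) = J ξ := fun ξ => rfl
  have hsplit : ∀ V : State, L (ext V) = J (Phi V.1) + L (0, 1) * V.2.2 := by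
    intro V
    have : ext V = (Phi V.1, 0) + V.2.2 • ((0, 1) : Ext × ℝ) := by simp [ext]
    rw [this, map_add, map_smul, smul_eq_mul, hJ, mul_comm]
  have hint := fun {a : ℝ × E3 → ℝ} (ha : Integrable a (volQ T)) =>
    (hφ.fderiv_apply (1, 0)).integrable_mul ha
  have hintx := fun α {a : ℝ × E3 → ℝ} (ha : Integrable a (volQ T)) =>
    (hφ.fderiv_apply (0, unitVec α)).integrable_mul ha
  have hΦ := J.integrable_comp (hmv.integrable_ext he).fst
  have hη := (hmv.integrable_ext he).snd
  have hfl := fun i α => J.integrable_comp (hmv.integrable_flux he i α)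
  have hc0 : Continuous fun x : E3 => W (0, x) := by
    obtain ⟨K, hK⟩ := hW.lipschitz
    exact hK.continuous.comp (by fun_prop)
  have hφ0 : Continuous fun x : E3 => φ (0, x) := hφ.continuous.comp (by fun_prop)
  -- the equations for the null Lagrangians and for the entropy
  have h1 := congrArg J (hmv.eq_Phi φ hφ)
  have h2 := hmv.eq_entropy φ hφ
  have iΦ : Integrable (fun z => dt φ z • Phi (U z).1) (volQ T) := by
    obtain ⟨C, hC0, hC⟩ := (hφ.fderiv_apply (1, 0)).exists_bound
    refine (hmv.integrable_ext he).fst.bdd_smul C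
      (hφ.fderiv_apply (1, 0)).continuous.aestronglyMeasurable ?_
    filter_upwards [ae_mem_cylinder T] with z hz using hC z hz
  have ifl : ∀ i α, Integrable (fun z => (dx α φ z * (U z).2.1 i) • dPhi (U z).1 i α)
      (volQ T) := by
    intro i α
    obtain ⟨C, hC0, hC⟩ := (hφ.fderiv_apply (0, unitVec α)).exists_bound
    simp only [mul_smul]
    refine (hmv.integrable_flux he i α).bdd_smul C
      (hφ.fderiv_apply (0, unitVec α)).continuous.aestronglyMeasurable ?_
    filter_upwards [ae_mem_cylinder T] with z hz using hC z hz
  have i0 : ∫ x, φ (0, x) • Phi (∫ lam, lam.1 ∂(ν₀ x)) ∂volX =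
      ∫ x, φ (0, x) • Phi (W (0, x)).1 ∂volX := by
    refine integral_congr_ae ?_
    filter_upwards [h₀] with x hx
    simp only [hx, integral_dirac]
  have i0' : ∫ x, φ (0, x) * ∫ lam, lam.2.2 ∂(ν₀ x) ∂volX =
      ∫ x, φ (0, x) * (W (0, x)).2.2 ∂volX := by
    refine integral_congr_ae ?_
    filter_upwards [h₀] with x hx
    simp only [hx, integral_dirac]
  have iΦ₀ : Integrable (fun x => φ (0, x) • Phi (W (0, x)).1) volX :=
    integrable_volX_of_continuous (hφ0.smul (continuous_Phi.comp hc0.fst))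
  rw [i0, map_add, ← J.integral_comp_comm iΦ, ← J.integral_comp_comm iΦ₀,
    ← J.integral_comp_comm (integrable_finsetSum _ fun i _ =>
      integrable_finsetSum _ fun α _ => ifl i α)] at h1
  simp only [map_sum, map_smul, smul_eq_mul] at h1
  have i1 : ∫ z, dt φ z * ∫ lam, lam.2.2 ∂(ν z) ∂(volQ T) = ∫ z, dt φ z * (U z).2.2 ∂(volQ T) := by
    refine integral_congr_ae ?_
    filter_upwards [hmv.ae_isAveraging he] with z hz
    have := ContinuousLinearMap.integral_comp_comm projEta hz.integrable_id
    rw [← hz.average] at this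
    exact congrArg _ this
  have i2 : ∫ z, φ z * ∫ lam, r z / theta e (Phi lam.1, lam.2.2) ∂(ν z) ∂(volQ T) =
      ∫ z, φ z * (r z * ∫ lam, 1 / theta e (ext lam) ∂(ν z)) ∂(volQ T) := by
    refine integral_congr_ae (ae_of_all _ fun z => ?_)
    simp only [← integral_const_mul, mul_one_div]
    rfl
  rw [i0', i1, i2] at h2
  rw [weakForm]
  have e0 : ∀ z, dt φ z * L (ext (U z)) +
      ∑ α, dx α φ z * -∑ i, L ((U z).2.1 i • dPhi (U z).1 i α, 0) +
      φ z * (L (0, 1) * (r z * ∫ lam, 1 / theta e (ext lam) ∂(ν z))) =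
      (dt φ z * J (Phi (U z).1) + L (0, 1) * (dt φ z * (U z).2.2)) -
      (∑ i, ∑ α, dx α φ z * (U z).2.1 i * J (dPhi (U z).1 i α)) +
      L (0, 1) * (φ z * (r z * ∫ lam, 1 / theta e (ext lam) ∂(ν z))) := by
    intro z
    rw [hsplit]
    simp only [hJ, map_smul, smul_eq_mul, Finset.sum_neg_distrib, mul_neg, Finset.mul_sum]
    rw [Finset.sum_comm]
    simp only [mul_assoc]
    ring
  have e1 : ∀ x, φ (0, x) * L (ext (W (0, x))) =
      φ (0, x) * J (Phi (W (0, x)).1) + L (0, 1) * (φ (0, x) * (W (0, x)).2.2) := by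
    intro x; rw [hsplit]; ring
  have ifl' : Integrable (fun z => ∑ i, ∑ α, dx α φ z * (U z).2.1 i * J (dPhi (U z).1 i α))
      (volQ T) := integrable_finsetSum _ fun i _ => integrable_finsetSum _ fun α _ => by
    simpa only [map_smul, smul_eq_mul, mul_assoc, dx] using hintx α (hfl i α)
  simp only [e0, e1]
  have s1 := integral_add (((hint hΦ).add ((hint hη).const_mul (L (0, 1)))).sub ifl')
    ((hφ.integrable_mul hr).const_mul (L (0, 1)))
  have s2 := integral_sub' ((hint hΦ).add ((hint hη).const_mul (L (0, 1)))) ifl'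
  have s3 := integral_add' (hint hΦ) ((hint hη).const_mul (L (0, 1)))
  have s4 := integral_add (μ := volX) (f := fun x => φ (0, x) * J (Phi (W (0, x)).1))
    (g := fun x => L (0, 1) * (φ (0, x) * (W (0, x)).2.2))
    (integrable_volX_of_continuous (hφ0.mul (J.continuous.comp (continuous_Phi.comp hc0.fst))))
    (integrable_volX_of_continuous (continuous_const.mul (hφ0.mul hc0.snd.snd)))
  rw [s4]
  refine (congrArg (· + _) s1).trans ?_
  rw [s2, s3]
  simp only [integral_const_mul]
  change (∫ z, dt φ z * J (Phi (U z).1) ∂(volQ T)) + L (0, 1) * (∫ z, dt φ z * (U z).2.2 ∂(volQ T))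
    - _ + _ + _ = 0
  linear_combination h1 + L (0, 1) * h2

/-- The momentum balance as a scalar balance law for each component of the velocity. -/
theorem weakForm_velocity [IsMarkovKernel ν]
    (hmv : IsDissipativeMVSolution e p q ρ l r T ν₀ γ₀ ν γ U)
    (he : ConstitutiveAssumptions e p q ρ l)
    (h₀ : ∀ᵐ x ∂volX, ν₀ x = Measure.dirac (W (0, x))) (i : Fin 3)
    {φ : ℝ × E3 → ℝ} (hφ : IsTest T φ) :
    weakForm T (fun z => (U z).2.1 i) (fun α z => -∫ lam, stress e lam.1 lam.2.2 i α ∂(ν z))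
      (fun _ => 0) (fun x => (W (0, x)).2.1 i) φ = 0 := by
  have h := hmv.eq_velocity φ hφ i
  have i0 : ∫ x, φ (0, x) * ∫ lam, lam.2.1 i ∂(ν₀ x) ∂volX =
      ∫ x, φ (0, x) * (W (0, x)).2.1 i ∂volX := by
    refine integral_congr_ae ?_
    filter_upwards [h₀] with x hx
    simp only [hx, integral_dirac]
  have i1 : ∫ z, dt φ z * ∫ lam, lam.2.1 i ∂(ν z) ∂(volQ T) =
      ∫ z, dt φ z * (U z).2.1 i ∂(volQ T) := by
    refine integral_congr_ae ?_
    filter_upwards [hmv.ae_isAveraging he] with z hz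
    simp only [hz.integral_velocity_apply]
  rw [i0, i1] at h
  have k1 : Integrable (fun z => dt φ z * (U z).2.1 i) (volQ T) :=
    (hφ.fderiv_apply (1, 0)).integrable_mul
      ((projV i).integrable_comp (hmv.integrable_U he))
  have k2 : Integrable (fun z => ∑ α, dx α φ z * ∫ lam, stress e lam.1 lam.2.2 i α ∂(ν z))
      (volQ T) := integrable_finsetSum _ fun α _ =>
    (hφ.fderiv_apply (0, unitVec α)).integrable_mul
      (hmv.integrable_integral he (he.admissible_stress i α))
  simp only [weakForm, mul_neg, Finset.sum_neg_distrib, mul_zero, add_zero, ← sub_eq_add_neg]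
  rw [integral_sub k1 k2]
  linarith

/-- The rows of the averaged deformation gradient are curl-free, being gradients. -/
theorem isWeakCurlFree [IsMarkovKernel ν]
    (hmv : IsDissipativeMVSolution e p q ρ l r T ν₀ γ₀ ν γ U)
    (he : ConstitutiveAssumptions e p q ρ l) (k : Fin 3) :
    IsWeakCurlFree T fun α z => (U z).1 (k, α) where
  integrable := fun α => (projF (k, α)).integrable_comp (hmv.integrable_U he)
  curl_free := by
    intro α β _ φ hφ
    obtain ⟨y, -, -, hy⟩ := hmv.motion
    exact curl_free_of_motion (fun φ hφ => (hy φ hφ k).2 α) (fun φ hφ => (hy φ hφ k).2 β)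
      ((projF (k, α)).integrable_comp (hmv.integrable_U he))
      ((projF (k, β)).integrable_comp (hmv.integrable_U he)) hφ

/-- The deformation gradient of the strong solution is curl-free. Its initial value is also that
of the measure-valued solution, which is a gradient; and the evolution equation preserves this
property. -/
theorem ae_curl_free [IsMarkovKernel ν] (hT : 0 < T)
    (hmv : IsDissipativeMVSolution e p q ρ l r T ν₀ γ₀ ν γ U)
    (he : ConstitutiveAssumptions e p q ρ l) (hW : IsStrongSolution e r T M W)
    (h₀ : ∀ᵐ x ∂volX, ν₀ x = Measure.dirac (W (0, x)))
    (hr : Integrable (fun z => r z * ∫ lam, 1 / theta e (ext lam) ∂(ν z)) (volQ T)) :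
    ∀ᵐ z ∂(volQ T), ∀ k α β,
      dx β (fun y => (W y).1 (k, α)) z = dx α (fun y => (W y).1 (k, β)) z := by
  simp only [ae_all_iff]
  intro k α β
  by_cases hαβ : α = β
  · subst hαβ; exact ae_of_all _ fun _ => rfl
  refine hW.curl_free hT hαβ (hmv.isWeakCurlFree he k) (u := fun z => (U z).2.1 k)
    fun γ φ hφ => ?_
  let L : Ext × ℝ →L[ℝ] ℝ := (EuclideanSpace.proj (k, γ) : Mat3 →L[ℝ] ℝ).comp
    ((ContinuousLinearMap.fst ℝ Mat3 (Mat3 × ℝ)).comp (ContinuousLinearMap.fst ℝ Ext ℝ))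
  have h := hmv.weakForm_ext he hW h₀ L hr hφ
  have hL1 : L (0, 1) = 0 := rfl
  have hL2 : ∀ V : State, L (ext V) = V.1 (k, γ) := fun V => rfl
  have hL3 : ∀ (V : State) i α, L (V.2.1 i • dPhi V.1 i α, 0) =
      if i = k ∧ α = γ then V.2.1 k else 0 := by
    intro V i α
    have : L (V.2.1 i • dPhi V.1 i α, 0) = V.2.1 i * (dPhi V.1 i α).1 (k, γ) := rfl
    rw [this, dPhi_eq]
    simp only [unitMat, PiLp.single_apply, Prod.mk.injEq]
    by_cases hi : i = k <;> by_cases ha : α = γ <;> simp [hi, ha, eq_comm]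
    all_goals tauto
  have hL4 : ∀ (V : State) (d : Fin 3 → ℝ),
      ∑ α, d α * -∑ i, (if i = k ∧ α = γ then V.2.1 k else 0) = -(d γ * V.2.1 k) := by
    intro V d
    simp [ite_and]
  have hi1 : Integrable (fun z => dt φ z * (U z).1 (k, γ)) (volQ T) :=
    (hφ.fderiv_apply (1, 0)).integrable_mul ((hmv.isWeakCurlFree he k).integrable γ)
  have hi2 : Integrable (fun z => dx γ φ z * (U z).2.1 k) (volQ T) :=
    (hφ.fderiv_apply (0, unitVec γ)).integrable_mul
      ((projV k).integrable_comp (hmv.integrable_U he))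
  simp only [weakForm, hL1, hL2, hL3, hL4, zero_mul, mul_zero, add_zero, ← sub_eq_add_neg] at h
  rw [integral_sub hi1 hi2] at h
  linarith

end
end IsDissipativeMVSolution

/-! ### The relative energy inequality -/

/-- A weak equation, tested with the product of a time test function and a Lipschitz coefficient. -/
theorem IsTimeTest.integral_weakForm_mul {T : ℝ} (hT : 0 < T) {φ : ℝ → ℝ} (hφ : IsTimeTest T φ)
    {f a h : ℝ × E3 → ℝ} {g : Fin 3 → ℝ × E3 → ℝ} {a₀ : E3 → ℝ} (hf : IsCoeff f)
    (ha : Integrable a (volQ T)) (hg : ∀ α, Integrable (g α) (volQ T))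
    (hh : Integrable h (volQ T)) (ha₀ : Integrable a₀ volX)
    (H : ∀ φ, IsTest T φ → weakForm T a g h a₀ φ = 0) :
    Integrable (fun z => deriv φ z.1 * (f z * a z) +
      φ z.1 * (dt f z * a z + ∑ α, dx α f z * g α z + f z * h z)) (volQ T) ∧
    ∫ z, (deriv φ z.1 * (f z * a z) +
      φ z.1 * (dt f z * a z + ∑ α, dx α f z * g α z + f z * h z)) ∂(volQ T) =
        -(φ 0 * ∫ x, f (0, x) * a₀ x ∂volX) := by
  have hφt := hφ.isTest
  have hd : ∀ {b : ℝ × E3 → ℝ}, Integrable b (volQ T) →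
      Integrable (fun z => deriv φ z.1 * b z) (volQ T) := fun hb => by
    have := (hφt.fderiv_apply (1, 0)).integrable_mul hb
    simpa only [fderiv_comp_fst hφ.smooth, mul_one] using this
  refine ⟨(hd (hf.integrable_mul ha)).add (hφt.integrable_mul
    (((hf.integrable_fderiv_mul _ ha).add (integrable_finsetSum _ fun α _ =>
      hf.integrable_fderiv_mul _ (hg α))).add (hf.integrable_mul hh))), ?_⟩
  have key := hφt.weakForm_mul hT.le ha hg hh ha₀ H hf
  rw [eq_neg_iff_add_eq_zero, ← integral_const_mul]
  refine Eq.trans (congrArg₂ _ ?_ ?_) key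
  · refine integral_congr_ae (ae_of_all _ fun z => ?_)
    simp only [hφ.dt_eq, hφ.dx_eq_zero, zero_mul, zero_add, mul_assoc, ← Finset.mul_sum]
    ring
  · simp only [mul_assoc]

/-- Expansion of the pairing of `g` with `x` in coordinates. -/
theorem sum_apply_finBasis (g : Ext × ℝ →L[ℝ] ℝ) (x : Ext × ℝ) :
    ∑ B, g (Module.finBasis ℝ (Ext × ℝ) B) *
      LinearMap.toContinuousLinearMap ((Module.finBasis ℝ (Ext × ℝ)).coord B) x = g x := by
  conv_rhs => rw [← (Module.finBasis ℝ (Ext × ℝ)).sum_repr x, map_sum]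
  simp [mul_comm]

section
variable {e : Ext × ℝ → ℝ} {p q ρ l : ℝ} {r : ℝ × E3 → ℝ} {T M : ℝ} {W : ℝ × E3 → State}

/-- The energy of the strong solution minus its linear part. -/
def dualEnergy (e : Ext × ℝ → ℝ) (V : State) : ℝ :=
  energy e V - grad e V (ext V) - ∑ i, V.2.1 i * V.2.1 i

theorem IsStrongSolution.isCoeff_dualEnergy (he : ConstitutiveAssumptions e p q ρ l)
    (h : IsStrongSolution e r T M W) : IsCoeff fun z => dualEnergy e (W z) := by
  have h1 : IsCoeff fun z => e (ext (W z)) := h.isCoeff_comp_ext (he.smooth.of_le (by norm_num))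
  have h2 : IsCoeff fun z => grad e (W z) (ext (W z)) :=
    h.isCoeff_comp_ext (f := fun x => fderivWithin ℝ e dom x x)
      ((he.contDiffOn_grad.of_le (by norm_num)).clm_apply contDiffOn_id)
  have h3 : IsCoeff fun z => ∑ i, (W z).2.1 i * (W z).2.1 i :=
    IsCoeff.sum _ fun i _ => (h.isCoeff_v i).mul (h.isCoeff_v i)
  have h4 : ∀ V : State, dualEnergy e V = 1 / 2 * (∑ i, V.2.1 i * V.2.1 i) + e (ext V) -
      grad e V (ext V) - ∑ i, V.2.1 i * V.2.1 i := by
    intro V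
    rw [dualEnergy, energy, EuclideanSpace.real_norm_sq_eq]
    simp only [sq]
    rfl
  simp only [h4]
  exact ((((IsCoeff.const _).mul h3).add h1).sub h2).sub h3

/-- The first-order terms of the chain rule cancel, and only the derivatives of the coefficients
of the linear part remain. -/
theorem IsStrongSolution.dt_dualEnergy (he : ConstitutiveAssumptions e p q ρ l)
    (h : IsStrongSolution e r T M W) :
    ∀ᵐ z ∂(volQ T), dt (fun z => dualEnergy e (W z)) z =
      -hess e (W z) (dExt (W z) (fderiv ℝ W z (1, 0))) (ext (W z)) -
        ∑ i, (fderiv ℝ W z (1, 0)).2.1 i * (W z).2.1 i := by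
  filter_upwards [h.ae_differentiableAt] with z hd
  obtain ⟨g1, g2, -⟩ := fderiv_grad_comp he hd h.ext_mem
  obtain ⟨e1, e2⟩ := fderiv_comp_ext hd h.ext_mem
    (he.smooth.differentiableOn (by norm_num) _ (h.ext_mem z))
  obtain ⟨A, hA, hAv⟩ := hasFDerivAt_ext_comp hd
  have hv : ∀ i, HasFDerivAt (fun y => (W y).2.1 i) ((projV i).comp (fderiv ℝ W z)) z :=
    fun i => (projV i).hasFDerivAt.comp z hd.hasFDerivAt
  have hv2 := HasFDerivAt.fun_sum (u := Finset.univ) fun i _ => (hv i).fun_mul (hv i)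
  have h4 : (fun y => dualEnergy e (W y)) = fun y => e (ext (W y)) - grad e (W y) (ext (W y)) -
      1 / 2 * ∑ i, (W y).2.1 i * (W y).2.1 i := by
    funext y
    rw [dualEnergy, energy, EuclideanSpace.real_norm_sq_eq]
    simp only [sq]
    change _ + e (ext (W y)) - _ - _ = _
    ring
  have hd2 := (e1.hasFDerivAt.sub (g1.hasFDerivAt.clm_apply hA)).fun_sub
    (hv2.const_mul (1 / 2))
  rw [dt, h4]
  refine (congrArg (fun B : ℝ × E3 →L[ℝ] ℝ => B (1, 0)) hd2.fderiv).trans ?_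
  change fderiv ℝ (fun y => e (ext (W y))) z (1, 0) - (grad e (W z) (A (1, 0)) +
    fderiv ℝ (fun y => grad e (W y)) z (1, 0) (ext (W z))) -
      1 / 2 * ((∑ i, _ : ℝ × E3 →L[ℝ] ℝ) (1, 0)) = _
  rw [e2, hAv, g2, _root_.sum_apply]
  have : ∀ i, ((W z).2.1 i • (projV i).comp (fderiv ℝ W z) +
      (W z).2.1 i • (projV i).comp (fderiv ℝ W z)) (1, 0) =
      2 * ((fderiv ℝ W z (1, 0)).2.1 i * (W z).2.1 i) := by
    intro i
    change (W z).2.1 i * (fderiv ℝ W z (1, 0)).2.1 i +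
      (W z).2.1 i * (fderiv ℝ W z (1, 0)).2.1 i = _
    ring
  simp only [this, ← Finset.mul_sum]
  ring

end

namespace IsDissipativeMVSolution
variable {e : Ext × ℝ → ℝ} {p q ρ l : ℝ} {r : ℝ × E3 → ℝ} {T M : ℝ} {ν₀ : Kernel E3 State}
  {γ₀ : Measure E3} {ν : Kernel (ℝ × E3) State} {γ : Measure (ℝ × E3)} {U W : ℝ × E3 → State}
  [IsMarkovKernel ν] {φ : ℝ → ℝ}

/-- The equations for `Φ(F)` and for the entropy, tested with the gradient of the energy. -/
theorem integral_grad (hmv : IsDissipativeMVSolution e p q ρ l r T ν₀ γ₀ ν γ U)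
    (he : ConstitutiveAssumptions e p q ρ l) (hT : 0 < T) (hW : IsStrongSolution e r T M W)
    (h₀ : ∀ᵐ x ∂volX, ν₀ x = Measure.dirac (W (0, x)))
    (hr : Integrable (fun z => r z * ∫ lam, 1 / theta e (ext lam) ∂(ν z)) (volQ T))
    (hφ : IsTimeTest T φ) :
    let G := fun z => deriv φ z.1 * grad e (W z) (ext (U z)) +
      φ z.1 * (hess e (W z) (dExt (W z) (fderiv ℝ W z (1, 0))) (ext (U z)) -
        (∑ i, ∑ α, hess e (W z) (dExt (W z) (fderiv ℝ W z (0, unitVec α)))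
          ((U z).2.1 i • dPhi (U z).1 i α, 0)) +
        theta e (ext (W z)) * (r z * ∫ lam, 1 / theta e (ext lam) ∂(ν z)))
    Integrable G (volQ T) ∧
      ∫ z, G z ∂(volQ T) = -(φ 0 * ∫ x, grad e (W (0, x)) (ext (W (0, x))) ∂volX) := by
  intro G
  -- The test function is vector-valued: the scalar laws for the coordinates `L B` are tested with
  -- the coordinates of the gradient and summed over a basis.
  set b := Module.finBasis ℝ (Ext × ℝ) with hb
  set L : Fin (Module.finrank ℝ (Ext × ℝ)) → Ext × ℝ →L[ℝ] ℝ := fun B =>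
    LinearMap.toContinuousLinearMap (b.coord B) with hL
  have hsum : ∀ (g : Ext × ℝ →L[ℝ] ℝ) x, ∑ B, g (b B) * L B x = g x := sum_apply_finBasis
  have hc0 : Continuous fun x : E3 => W (0, x) := by
    obtain ⟨K, hK⟩ := hW.lipschitz
    exact hK.continuous.comp (by fun_prop)
  have hf := fun B => hW.isCoeff_grad he (b B)
  have ha₀ : ∀ B, Integrable (fun x => L B (ext (W (0, x)))) volX := fun B =>
    integrable_volX_of_continuous ((L B).continuous.comp (continuous_ext.comp hc0))
  have hkey := fun B => hφ.integral_weakForm_mul hT (hf B)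
    ((L B).integrable_comp (hmv.integrable_ext he))
    (fun α => (integrable_finsetSum Finset.univ fun i _ => ((L B).comp
      (ContinuousLinearMap.inl ℝ Ext ℝ)).integrable_comp (hmv.integrable_flux he i α)).neg)
    (hr.const_mul (L B (0, 1))) (ha₀ B) (fun φ hφ => hmv.weakForm_ext he hW h₀ (L B) hr hφ)
  have hG : ∀ᵐ z ∂(volQ T), ∑ B, (deriv φ z.1 * (grad e (W z) (b B) * L B (ext (U z))) +
      φ z.1 * (dt (fun y => grad e (W y) (b B)) z * L B (ext (U z)) +
        ∑ α, dx α (fun y => grad e (W y) (b B)) z *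
          -∑ i, L B ((U z).2.1 i • dPhi (U z).1 i α, 0) +
        grad e (W z) (b B) * (L B (0, 1) * (r z * ∫ lam, 1 / theta e (ext lam) ∂(ν z))))) =
      G z := by
    filter_upwards [hW.ae_differentiableAt] with z hd
    obtain ⟨-, -, g3⟩ := fderiv_grad_comp he hd hW.ext_mem
    simp only [dt, dx, g3, G]
    rw [Finset.sum_add_distrib, ← Finset.mul_sum, ← Finset.mul_sum, Finset.sum_add_distrib,
      Finset.sum_add_distrib, hsum, hsum, Finset.sum_comm]
    simp only [← mul_assoc (grad e (W z) (b _)), ← Finset.sum_mul, hsum, mul_neg,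
      Finset.sum_neg_distrib, Finset.mul_sum]
    have e1 : ∀ α, ∑ B, ∑ i, hess e (W z) (dExt (W z) (fderiv ℝ W z (0, unitVec α))) (b B) *
        L B ((U z).2.1 i • dPhi (U z).1 i α, 0) =
        ∑ i, hess e (W z) (dExt (W z) (fderiv ℝ W z (0, unitVec α)))
          ((U z).2.1 i • dPhi (U z).1 i α, 0) := by
      intro α
      rw [Finset.sum_comm]
      simp only [hsum]
    simp only [e1]
    rw [Finset.sum_comm, ← sub_eq_add_neg]
    rfl
  refine ⟨(integrable_finsetSum _ fun B _ => (hkey B).1).congr hG, ?_⟩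
  rw [← integral_congr_ae hG]
  refine (integral_finsetSum _ fun B _ => (hkey B).1).trans ?_
  refine (Finset.sum_congr rfl fun B _ => (hkey B).2).trans ?_
  simp only [Finset.sum_neg_distrib, ← Finset.mul_sum]
  rw [← integral_finsetSum]
  · simp only [hsum]
  · exact fun B _ => integrable_volX_of_continuous (((hf B).continuous.comp (by fun_prop)).mul
      ((L B).continuous.comp (continuous_ext.comp hc0)))

/-- The momentum equation, tested with the velocity of the strong solution. -/
theorem integral_velocity (hmv : IsDissipativeMVSolution e p q ρ l r T ν₀ γ₀ ν γ U)
    (he : ConstitutiveAssumptions e p q ρ l) (hT : 0 < T) (hW : IsStrongSolution e r T M W)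
    (h₀ : ∀ᵐ x ∂volX, ν₀ x = Measure.dirac (W (0, x))) (hφ : IsTimeTest T φ) :
    let G := fun z => deriv φ z.1 * (∑ i, (W z).2.1 i * (U z).2.1 i) +
      φ z.1 * ((∑ i, (fderiv ℝ W z (1, 0)).2.1 i * (U z).2.1 i) -
        ∑ i, ∑ α, (fderiv ℝ W z (0, unitVec α)).2.1 i *
          ∫ lam, stress e lam.1 lam.2.2 i α ∂(ν z))
    Integrable G (volQ T) ∧
      ∫ z, G z ∂(volQ T) = -(φ 0 * ∫ x, ∑ i, (W (0, x)).2.1 i * (W (0, x)).2.1 i ∂volX) := by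
  intro G
  have hc0 : ∀ i, Continuous fun x : E3 => (W (0, x)).2.1 i := by
    obtain ⟨K, hK⟩ := hW.lipschitz
    have : Continuous fun x : E3 => W (0, x) := hK.continuous.comp (by fun_prop)
    exact fun i => (projV i).continuous.comp this
  have hkey := fun i => hφ.integral_weakForm_mul hT (hW.isCoeff_v i)
    ((projV i).integrable_comp (hmv.integrable_U he))
    (fun α => (hmv.integrable_integral he (he.admissible_stress i α)).neg)
    (integrable_zero _ _ _) (integrable_volX_of_continuous (hc0 i))
    (fun φ hφ => hmv.weakForm_velocity he h₀ i hφ)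
  have hG : ∀ᵐ z ∂(volQ T), ∑ i, (deriv φ z.1 * ((W z).2.1 i * (U z).2.1 i) +
      φ z.1 * (dt (fun y => (W y).2.1 i) z * (U z).2.1 i +
        ∑ α, dx α (fun y => (W y).2.1 i) z * -∫ lam, stress e lam.1 lam.2.2 i α ∂(ν z) +
        (W z).2.1 i * 0)) = G z := by
    filter_upwards [hW.ae_differentiableAt] with z hd
    have hv : ∀ i v, fderiv ℝ (fun y => (W y).2.1 i) z v = (fderiv ℝ W z v).2.1 i := fun i v =>
      fderiv_comp_clm hd (projV i) v
    simp only [dt, dx, hv, G, mul_zero, add_zero, mul_neg, Finset.sum_neg_distrib]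
    rw [Finset.sum_add_distrib, ← Finset.mul_sum, ← Finset.mul_sum, Finset.sum_add_distrib,
      Finset.sum_neg_distrib, sub_eq_add_neg]
  refine ⟨(integrable_finsetSum _ fun i _ => (hkey i).1).congr hG, ?_⟩
  rw [← integral_congr_ae hG]
  refine (integral_finsetSum _ fun i _ => (hkey i).1).trans ?_
  refine (Finset.sum_congr rfl fun i _ => (hkey i).2).trans ?_
  simp only [Finset.sum_neg_distrib, ← Finset.mul_sum]
  rw [← integral_finsetSum]
  exact fun i _ => integrable_volX_of_continuous ((hc0 i).mul (hc0 i))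

end IsDissipativeMVSolution

namespace IsDissipativeMVSolution
variable {e : Ext × ℝ → ℝ} {p q ρ l : ℝ} {r : ℝ × E3 → ℝ} {T M : ℝ} {ν₀ : Kernel E3 State}
  {γ₀ : Measure E3} {ν : Kernel (ℝ × E3) State} {γ : Measure (ℝ × E3)} {U W : ℝ × E3 → State}
  [IsMarkovKernel ν] {φ : ℝ → ℝ}

/-- The mean relative energy is the average of the energy minus an affine function of `U` and
`Φ(F)` with bounded coefficients. -/
theorem integrable_meanRelEnergy (hmv : IsDissipativeMVSolution e p q ρ l r T ν₀ γ₀ ν γ U)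
    (he : ConstitutiveAssumptions e p q ρ l) (hW : IsStrongSolution e r T M W) :
    Integrable (fun z => meanRelEnergy e (W z) (U z) (∫ lam, energy e lam ∂(ν z))) (volQ T) := by
  have h1 := hmv.integrable_integral he he.admissible_energy
  have hWe : ∀ z, meanRelEnergy e (W z) (U z) (∫ lam, energy e lam ∂(ν z)) =
      (∫ lam, energy e lam ∂(ν z)) - dualEnergy e (W z) - (∑ B, grad e (W z)
        (Module.finBasis ℝ (Ext × ℝ) B) * LinearMap.toContinuousLinearMap
          ((Module.finBasis ℝ (Ext × ℝ)).coord B) (ext (U z))) -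
        ∑ i, (W z).2.1 i * (U z).2.1 i := by
    intro z
    rw [sum_apply_finBasis, meanRelEnergy, dualEnergy, map_sub]
    simp only [mul_sub, Finset.sum_sub_distrib]
    ring
  simp only [hWe]
  exact ((h1.sub (hW.isCoeff_dualEnergy he).integrable).sub
    (integrable_finsetSum _ fun B _ => (hW.isCoeff_grad he _).integrable_mul
      ((LinearMap.toContinuousLinearMap _).integrable_comp (hmv.integrable_ext he)))).sub
    (integrable_finsetSum _ fun i _ => (hW.isCoeff_v i).integrable_mul
      ((projV i).integrable_comp (hmv.integrable_U he)))

/-- The relative energy inequality: the energy inequality minus the balance laws of the averages,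
tested with `grad e (W z)` and with the velocity of `W`, and minus the time derivative of the
`dualEnergy` of `W`. The equality of the initial data makes the initial terms cancel, and the null
form may be subtracted on the right because its integral is zero. -/
theorem relEnergy_ineq (hmv : IsDissipativeMVSolution e p q ρ l r T ν₀ γ₀ ν γ U)
    (he : ConstitutiveAssumptions e p q ρ l) (hT : 0 < T) (hW : IsStrongSolution e r T M W)
    (h₀ : ∀ᵐ x ∂volX, ν₀ x = Measure.dirac (W (0, x))) (hγ₀ : γ₀ cell = 0)
    (hr : Integrable r (volQ T))
    (hrθ : Integrable (fun z => r z * ∫ lam, 1 / theta e (ext lam) ∂(ν z)) (volQ T))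
    (hφ : IsTimeTest T φ) :
    let P := fun z => meanProduction e (r z) (W z) (fderiv ℝ W z) (U z)
      (∫ lam, 1 / theta e (ext lam) ∂(ν z)) (fun i α => ∫ lam, stress e lam.1 lam.2.2 i α ∂(ν z))
    Integrable (fun z => φ z.1 * P z) (volQ T) ∧
    -(∫ z, deriv φ z.1 * meanRelEnergy e (W z) (U z) (∫ lam, energy e lam ∂(ν z)) ∂(volQ T)) -
      ∫ z in cylinder T, deriv φ z.1 ∂γ ≤ ∫ z, φ z.1 * P z ∂(volQ T) := by
  intro P
  have hφt := hφ.isTest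
  have hd : ∀ {b : ℝ × E3 → ℝ}, Integrable b (volQ T) →
      Integrable (fun z => deriv φ z.1 * b z) (volQ T) := fun hb => by
    have := (hφt.fderiv_apply (1, 0)).integrable_mul hb
    simpa only [fderiv_comp_fst hφ.smooth, mul_one] using this
  have hcurl := hmv.ae_curl_free hT he hW h₀ hrθ
  obtain ⟨n1, n2⟩ := hW.integral_nullForm he hT hcurl (hmv.isWeakCurlFree he) hφ
  obtain ⟨a1, a2⟩ := hmv.integral_grad he hT hW h₀ hrθ hφ
  obtain ⟨b1, b2⟩ := hmv.integral_velocity he hT hW h₀ hφ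
  have hk := hW.isCoeff_dualEnergy he
  have c2 := hφt.integral_dt_mul hT hk
  have c1 : Integrable (fun z => dt (fun z => φ z.1) z * dualEnergy e (W z) +
      φ z.1 * dt (fun y => dualEnergy e (W y)) z) (volQ T) :=
    ((hφt.fderiv_apply (1, 0)).integrable_mul hk.integrable).add
      (hφt.integrable_mul (hk.integrable_fderiv T (1, 0)))
  have hE := hd (hmv.integrable_integral he he.admissible_energy)
  have hR := hd (hmv.integrable_meanRelEnergy he hW)
  have hrφ := hφt.integrable_mul hr
  have hN := hφt.integrable_mul n1
  have hc0 : Continuous fun x : E3 => W (0, x) := by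
    obtain ⟨K, hK⟩ := hW.lipschitz
    exact hK.continuous.comp (by fun_prop)
  -- The sum of the three weak equations, with the terms grouped as in the relative energy.
  have hsum : (fun z => φ z.1 * P z) =ᵐ[volQ T] fun z =>
      deriv φ z.1 * (∫ lam, energy e lam ∂(ν z)) -
      deriv φ z.1 * meanRelEnergy e (W z) (U z) (∫ lam, energy e lam ∂(ν z)) + φ z.1 * r z -
      φ z.1 * nullForm e (W z) (fderiv ℝ W z) (U z).1 -
      ((deriv φ z.1 * grad e (W z) (ext (U z)) +
      φ z.1 * (hess e (W z) (dExt (W z) (fderiv ℝ W z (1, 0))) (ext (U z)) -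
        (∑ i, ∑ α, hess e (W z) (dExt (W z) (fderiv ℝ W z (0, unitVec α)))
          ((U z).2.1 i • dPhi (U z).1 i α, 0)) +
        theta e (ext (W z)) * (r z * ∫ lam, 1 / theta e (ext lam) ∂(ν z)))) +
      (deriv φ z.1 * (∑ i, (W z).2.1 i * (U z).2.1 i) +
      φ z.1 * ((∑ i, (fderiv ℝ W z (1, 0)).2.1 i * (U z).2.1 i) -
        ∑ i, ∑ α, (fderiv ℝ W z (0, unitVec α)).2.1 i *
          ∫ lam, stress e lam.1 lam.2.2 i α ∂(ν z))) +
      (dt (fun z => φ z.1) z * dualEnergy e (W z) +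
        φ z.1 * dt (fun y => dualEnergy e (W y)) z)) := by
    filter_upwards [hW.dt_dualEnergy he] with z hz
    rw [hz, hφ.dt_eq]
    simp only [P, meanProduction, meanRelEnergy, dualEnergy, map_sub, mul_sub,
      Finset.sum_sub_distrib, Finset.sum_add_distrib]
    ring
  have hPi : Integrable (fun z => φ z.1 * P z) (volQ T) :=
    ((((hE.sub hR).add hrφ).sub hN).sub ((a1.add b1).add c1)).congr hsum.symm
  refine ⟨hPi, ?_⟩
  have s0 := integral_congr_ae hsum
  have s1 := integral_sub' (((hE.sub hR).add hrφ).sub hN) ((a1.add b1).add c1)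
  rw [integral_sub' ((hE.sub hR).add hrφ) hN, integral_add' (hE.sub hR) hrφ,
    integral_sub' hE hR, integral_add' (a1.add b1) c1, integral_add' a1 b1, a2, b2, c2, n2] at s1
  have s2 := s0.trans s1
  -- the initial terms
  have i1 : ∫ x, ∫ lam, energy e lam ∂(ν₀ x) ∂volX = ∫ x, energy e (W (0, x)) ∂volX := by
    refine integral_congr_ae ?_
    filter_upwards [h₀] with x hx
    simp only [hx, integral_dirac]
  have i2 : ∫ x, energy e (W (0, x)) ∂volX = (∫ x, grad e (W (0, x)) (ext (W (0, x))) ∂volX) +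
      (∫ x, ∑ i, (W (0, x)).2.1 i * (W (0, x)).2.1 i ∂volX) +
        ∫ x, dualEnergy e (W (0, x)) ∂volX := by
    have j1 : Integrable (fun x => grad e (W (0, x)) (ext (W (0, x)))) volX :=
      integrable_volX_of_continuous ((he.continuousOn_grad.comp_continuous
        (continuous_ext.comp hc0) fun x => hW.ext_mem _).clm_apply (continuous_ext.comp hc0))
    have j2 : Integrable (fun x => ∑ i, (W (0, x)).2.1 i * (W (0, x)).2.1 i) volX :=
      integrable_volX_of_continuous (continuous_finsetSum _ fun i _ =>
        ((projV i).continuous.comp hc0).mul ((projV i).continuous.comp hc0))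
    have j3 : Integrable (fun x => dualEnergy e (W (0, x))) volX :=
      integrable_volX_of_continuous (hk.continuous.comp (by fun_prop))
    have := integral_add (j1.add j2) j3
    rw [integral_add' j1 j2] at this
    rw [← this]
    refine integral_congr_ae (ae_of_all _ fun x => ?_)
    simp only [dualEnergy, Pi.add_apply]
    ring
  have i3 : γ₀.real cell = 0 := by simp [Measure.real, hγ₀]
  have hineq := hmv.energy_ineq φ hφ
  rw [i1, i3, i2, add_zero] at hineq
  have i4 : ∫ x, φ ((0 : ℝ), (x : E3)).1 * dualEnergy e (W (0, x)) ∂volX =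
      φ 0 * ∫ x, dualEnergy e (W (0, x)) ∂volX := by simp only [integral_const_mul]
  have i5 : ∫ z, φ z.1 * r z ∂(volQ T) = ∫ z, r z * φ z.1 ∂(volQ T) := by
    simp only [mul_comm]
  rw [i4, i5] at s2
  rw [s2]
  linarith

end IsDissipativeMVSolution

/-! ### Uniqueness -/

theorem expNegInvGlue_hasDerivAt (x : ℝ) :
    HasDerivAt expNegInvGlue ((x⁻¹) ^ 2 * expNegInvGlue x) x := by
  simpa using expNegInvGlue.hasDerivAt_polynomial_eval_inv_mul 1 x

/-- A weight `φ` with `φ' + C φ ≤ 0`, with strict inequality before time `b`. Testing with it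
replaces Gronwall's inequality. -/
def decayWeight (C b t : ℝ) : ℝ := Real.exp (-C * t) * expNegInvGlue (b - t)

theorem deriv_decayWeight (C b t : ℝ) : deriv (decayWeight C b) t =
    -C * decayWeight C b t - Real.exp (-C * t) * (((b - t)⁻¹) ^ 2 * expNegInvGlue (b - t)) := by
  have h1 : HasDerivAt (fun t => Real.exp (-C * t)) (Real.exp (-C * t) * (-C * 1)) t :=
    ((hasDerivAt_id t).const_mul (-C)).exp
  have h2 : HasDerivAt (fun t => expNegInvGlue (b - t))
      (((b - t)⁻¹) ^ 2 * expNegInvGlue (b - t) * (-1)) t :=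
    (expNegInvGlue_hasDerivAt (b - t)).comp t ((hasDerivAt_id t).const_sub b)
  have h3 : HasDerivAt (decayWeight C b) _ t := h1.fun_mul h2
  rw [h3.deriv, decayWeight]
  ring

theorem isTimeTest_decayWeight {T b : ℝ} (hb : b < T) (C : ℝ) :
    IsTimeTest T (decayWeight C b) where
  smooth := (Real.contDiff_exp.comp (contDiff_const.mul contDiff_id)).mul
    (expNegInvGlue.contDiff.comp (contDiff_const.sub contDiff_id))
  nonneg := fun t _ => mul_nonneg (Real.exp_pos _).le (expNegInvGlue.nonneg _)
  support := ⟨b, hb, fun t ht => by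
    rw [decayWeight, expNegInvGlue.zero_of_nonpos (by linarith), mul_zero]⟩

theorem eq_dirac_of_ae_eq {X : Type*} [MeasurableSpace X] {μ : Measure X} [IsProbabilityMeasure μ]
    {a : X} (h : ∀ᵐ x ∂μ, x = a) : μ = Measure.dirac a := by
  have h1 : μ.map id = μ.map fun _ => a := Measure.map_congr h
  rwa [Measure.map_id, Measure.map_const, measure_univ, one_smul] at h1

theorem ConstitutiveAssumptions.eq_of_relEnergy_eq_zero {e : Ext × ℝ → ℝ} {p q ρ l : ℝ}
    (he : ConstitutiveAssumptions e p q ρ l) {U V : State} (hU : 0 ≤ U.2.2) (hV : 0 ≤ V.2.2)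
    (h : relEnergy e U V = 0) : U = V := by
  obtain ⟨C, -, hC⟩ := he.exists_sq_le_relEnergy
  obtain ⟨h1, h2⟩ := hC U V hU hV
  rw [h, mul_zero] at h1 h2
  have h3 : U.2.1 = V.2.1 := by
    rw [← sub_eq_zero, ← norm_eq_zero]
    exact pow_eq_zero_iff two_ne_zero |>.1 (le_antisymm h1 (sq_nonneg _))
  have h4 : ext U = ext V := by
    rw [← sub_eq_zero, ← norm_eq_zero]
    exact pow_eq_zero_iff two_ne_zero |>.1 (le_antisymm h2 (sq_nonneg _))
  exact Prod.ext (congrArg (fun x => x.1.1) h4) (Prod.ext h3 (congrArg (fun x => x.2) h4))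

theorem exists_ae_abs_le_of_memLp_top {X : Type*} [MeasurableSpace X] {μ : Measure X} {r : X → ℝ}
    (hr : MemLp r ⊤ μ) : ∃ B, ∀ᵐ z ∂μ, |r z| ≤ B := by
  refine ⟨(eLpNormEssSup r μ).toReal, ?_⟩
  have h : eLpNormEssSup r μ ≠ ⊤ := by
    rw [← eLpNorm_exponent_top]; exact hr.2.ne
  filter_upwards [ae_le_eLpNormEssSup (f := r) (μ := μ)] with z hz
  have := ENNReal.toReal_mono h hz
  simpa using this

/-- The mean relative energy vanishes: the relative energy inequality is tested with
`decayWeight C b`, for which `-φ' - C φ` is positive on `[0, b)`, so that the production term, which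
is at most `C` times the relative energy, is absorbed. -/
theorem IsDissipativeMVSolution.ae_meanRelEnergy_eq_zero {e : Ext × ℝ → ℝ} {p q ρ l : ℝ}
    {r : ℝ × E3 → ℝ} {T M : ℝ} {ν₀ : Kernel E3 State} {γ₀ : Measure E3}
    {ν : Kernel (ℝ × E3) State} {γ : Measure (ℝ × E3)} {U W : ℝ × E3 → State}
    [IsMarkovKernel ν]
    (hmv : IsDissipativeMVSolution e p q ρ l r T ν₀ γ₀ ν γ U)
    (he : ConstitutiveAssumptions e p q ρ l) (hT : 0 < T) (hr : MemLp r ⊤ (volQ T))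
    (hW : IsStrongSolution e r T M W)
    (h₀ : ∀ᵐ x ∂volX, ν₀ x = Measure.dirac (W (0, x))) (hγ₀ : γ₀ cell = 0) :
    ∀ᵐ z ∂(volQ T), meanRelEnergy e (W z) (U z) (∫ lam, energy e lam ∂(ν z)) = 0 := by
  obtain ⟨B, hB⟩ := exists_ae_abs_le_of_memLp_top hr
  obtain ⟨K, -, hK⟩ := hW.exists_norm_fderiv_le
  have hri : Integrable r (volQ T) := hr.integrable le_top
  have hrθ : Integrable (fun z => r z * ∫ lam, 1 / theta e (ext lam) ∂(ν z)) (volQ T) :=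
    (hmv.integrable_integral he he.admissible_inv_theta).bdd_mul hr.1 hB
  obtain ⟨C, hC0, hC⟩ := he.exists_meanProduction_le M K B
  set R := fun z => meanRelEnergy e (W z) (U z) (∫ lam, energy e lam ∂(ν z)) with hRdef
  have hR0 : ∀ᵐ z ∂(volQ T), 0 ≤ R z := by
    filter_upwards [hmv.ae_isAveraging he] with z hz
    rw [hRdef]
    simp only [← hz.integral_relEnergy]
    refine integral_nonneg_of_ae ?_
    filter_upwards [hz.pos] with lam hlam
    exact he.relEnergy_nonneg hlam (hW.mem_Gam z).2.2.2
  refine ae_of_forall_lt hT fun b hb0 hbT => ?_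
  set φ := decayWeight C b with hφdef
  have hφ : IsTimeTest T φ := isTimeTest_decayWeight hbT C
  obtain ⟨k1, k2⟩ := hmv.relEnergy_ineq he hT hW h₀ hγ₀ hri hrθ hφ
  have hRi : Integrable R (volQ T) := hmv.integrable_meanRelEnergy he hW
  have hφR : Integrable (fun z => φ z.1 * R z) (volQ T) := hφ.isTest.integrable_mul hRi
  have hdR : Integrable (fun z => deriv φ z.1 * R z) (volQ T) := by
    have := (hφ.isTest.fderiv_apply (1, 0)).integrable_mul hRi
    simpa only [fderiv_comp_fst hφ.smooth, mul_one] using this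
  have hφ0 : ∀ t, 0 ≤ φ t := fun t => mul_nonneg (Real.exp_pos _).le (expNegInvGlue.nonneg _)
  have k3 : ∫ z, φ z.1 * meanProduction e (r z) (W z) (fderiv ℝ W z) (U z)
      (∫ lam, 1 / theta e (ext lam) ∂(ν z)) (fun i α => ∫ lam, stress e lam.1 lam.2.2 i α ∂(ν z))
      ∂(volQ T) ≤ ∫ z, C * (φ z.1 * R z) ∂(volQ T) := by
    refine integral_mono_ae k1 (hφR.const_mul C) ?_
    filter_upwards [hB, hmv.ae_isAveraging he,
      hW.ae_solvesAt he (hmv.ae_curl_free hT he hW h₀ hrθ)] with z h1 h2 h3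
    have := mul_le_mul_of_nonneg_left (hC (r z) (W z) (fderiv ℝ W z) h1 (hW.mem_Gam z) (hK z) h3
      (ν z) (U z) h2) (hφ0 z.1)
    calc _ ≤ _ := this
      _ = _ := by ring
  -- The concentration measure has the favourable sign.
  have k4 : ∫ z in cylinder T, deriv φ z.1 ∂γ ≤ 0 := by
    refine integral_nonpos fun z => ?_
    simp only [Pi.zero_apply]
    rw [hφdef, deriv_decayWeight]
    have h1 := mul_nonneg hC0 (hφ0 z.1)
    have h2 : 0 ≤ Real.exp (-C * z.1) * (((b - z.1)⁻¹) ^ 2 * expNegInvGlue (b - z.1)) :=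
      mul_nonneg (Real.exp_pos _).le (mul_nonneg (sq_nonneg _) (expNegInvGlue.nonneg _))
    linarith
  set w : ℝ × E3 → ℝ := fun z =>
    Real.exp (-C * z.1) * (((b - z.1)⁻¹) ^ 2 * expNegInvGlue (b - z.1)) with hw
  have hw0 : ∀ z, 0 ≤ w z := fun z =>
    mul_nonneg (Real.exp_pos _).le (mul_nonneg (sq_nonneg _) (expNegInvGlue.nonneg _))
  have hwR : (fun z => w z * R z) = fun z => -(deriv φ z.1 * R z) - C * (φ z.1 * R z) := by
    funext z
    rw [hφdef, deriv_decayWeight, ← hφdef]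
    simp only [hw]
    ring
  have hdn : Integrable (fun z => -(deriv φ z.1 * R z)) (volQ T) := hdR.neg
  have hwi : Integrable (fun z => w z * R z) (volQ T) := by
    rw [hwR]; exact hdn.sub (hφR.const_mul C)
  have k5 : ∫ z, w z * R z ∂(volQ T) ≤ 0 := by
    have k6 : -(∫ z, deriv φ z.1 * R z ∂(volQ T)) - ∫ z in cylinder T, deriv φ z.1 ∂γ ≤
        ∫ z, C * (φ z.1 * R z) ∂(volQ T) := k2.trans k3
    rw [hwR, integral_sub hdn (hφR.const_mul C), integral_neg]
    linarith
  have hwn : 0 ≤ᵐ[volQ T] fun z => w z * R z := by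
    filter_upwards [hR0] with z hz using mul_nonneg (hw0 z) hz
  have k7 := (integral_eq_zero_iff_of_nonneg_ae hwn hwi).1
    (le_antisymm k5 (integral_nonneg_of_ae hwn))
  filter_upwards [k7] with z hz hzb
  have hpos : 0 < w z := by
    have h1 : 0 < b - z.1 := sub_pos.2 hzb
    have h2 := expNegInvGlue.pos_of_pos h1
    simp only [hw]
    positivity
  exact (mul_eq_zero.1 hz).resolve_left hpos.ne'

end Thermoelasticity

end

theorem mainTheorem2
    (e : Ext × ℝ → ℝ) (p q ρ l : ℝ) (he : ConstitutiveAssumptions e p q ρ l)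
    (T : ℝ) (hT : 0 < T) (M : ℝ)
    (r : ℝ × E3 → ℝ) (hr : MemLp r ⊤ (volQ T))
    (Ubar : ℝ × E3 → State) (hUbar : IsLipschitzSolution e r T M Ubar)
    (ν₀ : Kernel E3 State) [IsMarkovKernel ν₀] (γ₀ : Measure E3) [IsFiniteMeasure γ₀]
    (ν : Kernel (ℝ × E3) State) [IsMarkovKernel ν] (γ : Measure (ℝ × E3)) [IsFiniteMeasure γ]
    (U : ℝ × E3 → State)
    (hmv : IsDissipativeMVSolution e p q ρ l r T ν₀ γ₀ ν γ U)
    (U₀ : E3 → State)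
    (hν₀ : ∀ᵐ x ∂volX, ν₀ x = Measure.dirac (U₀ x))
    (hγ₀ : γ₀ cell = 0)
    (hU₀ : ∀ᵐ x ∂volX, U₀ x = Ubar (0, x)) :
    (∀ᵐ z ∂(volQ T), ν z = Measure.dirac (Ubar z)) ∧ (∀ᵐ z ∂(volQ T), U z = Ubar z) := by
  have hW := hUbar.isStrongSolution hT.le
  have h₀ : ∀ᵐ x ∂volX, ν₀ x = Measure.dirac (Ubar (clamp T (0, x))) := by
    filter_upwards [hν₀, hU₀] with x h1 h2
    rw [clamp_zero hT.le, h1, h2]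
  have key : ∀ᵐ z ∂(volQ T), ν z = Measure.dirac (Ubar z) ∧ U z = Ubar z := by
    filter_upwards [hmv.ae_meanRelEnergy_eq_zero he hT hr hW h₀ hγ₀, hmv.ae_isAveraging he,
      ae_mem_Ioo T] with z hz hav hzT
    have hV := (hW.mem_Gam z).2.2.2
    rw [clamp_eq_self (Ioo_subset_Icc_self hzT)] at hz hV
    -- The relative energy is non-negative with zero average, hence zero `ν z`-almost surely.
    rw [← hav.integral_relEnergy] at hz
    have hnn : 0 ≤ᵐ[ν z] fun lam => relEnergy e lam (Ubar z) := by
      filter_upwards [hav.pos] with lam hlam using he.relEnergy_nonneg hlam hV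
    have hrel := (integral_eq_zero_iff_of_nonneg_ae hnn (hav.integrable_relEnergy _)).1 hz
    have hν : ν z = Measure.dirac (Ubar z) := by
      refine eq_dirac_of_ae_eq ?_
      filter_upwards [hrel, hav.pos] with lam h1 h2
      exact he.eq_of_relEnergy_eq_zero h2 hV h1
    refine ⟨hν, ?_⟩
    rw [hav.average, hν, integral_dirac]
  exact ⟨key.mono fun z h => h.1, key.mono fun z h => h.2⟩
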